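/- Let $K\ge 1$. A mixture is a Borel probability measure $\vartheta$ on $[0,1]$. A coin drawn from $\vartheta$ has heads probability $p\sim\vartheta$; it is tossed $K$ times, the tosses being independent given $p$. For $m$ independently drawn coins, each tossed $K$ times, let $h_i$ $(0\le i\le K)$ be the number of coins that show heads exactly $i$ times. Let $\mathrm{Tran}(P,Q)=\inf_{\gamma}\int |x-y|\,d\gamma(x,y)$, over all couplings $\gamma$ of $P$ and $Q$, be the transportation distance on $[0,1]$. **Theorem.** There are a deterministic algorithm and an absolute constant $A>0$ such that for every $c>0$ there are a constant $C\in\mathbb N$ and a polynomial $T$ with the following property for every $K\ge 1$. Put $m=2^{CK}=\exp(O(K))$. Given the counts $h_0,\dots,h_K$ (in binary) of any $m$ coins tossed $K$ times each, the algorithm halts within $T(K)$ steps, counted with logarithmic cost on a random access machine, and outputs a mixture $\widehat\vartheta$ on $[0,1]$ with finitely many (at most $T(K)$) rational atoms and rational weights. For every mixture $\vartheta$, if the $m$ coins are drawn from $\vartheta$, then with probability at least $1-e^{-cK}$ $$\mathrm{Tran}(\vartheta,\widehat\vartheta)\le \frac{A}{K}.$$ -/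

import Mathlib

open MeasureTheory ProbabilityTheory unitInterval

namespace CoinProblem

/-! ### Transportation distance -/

/-- The transportation (Rubinstein, Wasserstein-1, earth mover) distance between two measures on a
metric space: the infimum of `∫ d(x, y) dγ(x, y)` over all couplings `γ` of `P` and `Q`. -/
noncomputable def tran {X : Type*} [PseudoEMetricSpace X] [MeasurableSpace X]
    (P Q : Measure X) : ENNReal :=
  ⨅ (γ : Measure (X × X)) (_ : γ.map Prod.fst = P ∧ γ.map Prod.snd = Q),
    ∫⁻ z, edist z.1 z.2 ∂γ

/-! ### The sampling model -/

/-- The law of `K` independent tosses of a coin that shows heads (`true`) with probability `p`. -/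
noncomputable def tossLaw (K : ℕ) (p : I) : Measure (Fin K → Bool) :=
  Measure.pi fun _ => bernoulliMeasure true false p

/-- The law of a `K`-snapshot of the mixture `ϑ`: draw a coin `p` from `ϑ`, then toss it `K` times
independently. -/
noncomputable def snapshotLaw (K : ℕ) (ϑ : Measure I) : Measure (Fin K → Bool) :=
  ϑ.bind (tossLaw K)

/-- The law of the tosses of `m` coins drawn independently from `ϑ`, each tossed `K` times. -/
noncomputable def sampleLaw (m K : ℕ) (ϑ : Measure I) : Measure (Fin m → Fin K → Bool) :=
  Measure.pi fun _ => snapshotLaw K ϑ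

instance (K : ℕ) (p : I) : IsProbabilityMeasure (tossLaw K p) := by
  unfold tossLaw; infer_instance

theorem measurable_tossLaw (K : ℕ) : Measurable (tossLaw K) := by
  refine Measurable.measure_of_isPiSystem_of_isProbabilityMeasure generateFrom_pi.symm
    isPiSystem_pi ?_
  rintro _ ⟨s, hs, rfl⟩
  simp only [tossLaw, Measure.pi_pi]
  refine Finset.measurable_prod _ fun i _ => ?_
  simp only [bernoulliMeasure_def, Measure.add_apply, Measure.smul_apply]
  have h1 : Measurable fun p : I => ((toNNReal p : NNReal) : ENNReal) := by
    simp only [toNNReal]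
    fun_prop
  have h2 : Measurable fun p : I => ((toNNReal (σ p) : NNReal) : ENNReal) :=
    h1.comp continuous_symm.measurable
  exact (h1.mul_const _).add (h2.mul_const _)

instance (K : ℕ) (ϑ : Measure I) [IsProbabilityMeasure ϑ] :
    IsProbabilityMeasure (snapshotLaw K ϑ) :=
  isProbabilityMeasure_bind (measurable_tossLaw K).aemeasurable
    (Filter.Eventually.of_forall fun _ => inferInstance)

instance (m K : ℕ) (ϑ : Measure I) [IsProbabilityMeasure ϑ] :
    IsProbabilityMeasure (sampleLaw m K ϑ) := by
  unfold sampleLaw; infer_instance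

/-- The number of the `m` coins that showed heads exactly `i` times. -/
def headsCount {m K : ℕ} (ω : Fin m → Fin K → Bool) (i : Fin (K + 1)) : ℕ :=
  (Finset.univ.filter fun c : Fin m =>
    (Finset.univ.filter fun j : Fin K => ω c j = true).card = (i : ℕ)).card

/-! ### A random access machine with logarithmic cost

Programs work on finitely many unbounded arrays of integers of arbitrary size. Every elementary
step is charged one unit plus the number of bits of all the integers it handles, so that a
polynomial time bound here is one for Turing machines. -/

/-- Contents of the memory: `s a i` is cell `i` of array `a`. -/
abbrev Store := ℕ → ℕ → ℤ

/-- `div` is division rounded down for a positive divisor, with `x div 0 = 0`; `lt` is the test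
`x < y` with value `1` or `0`. -/
inductive Op
  | add | sub | mul | div | lt

def Op.eval : Op → ℤ → ℤ → ℤ
  | .add, x, y => x + y
  | .sub, x, y => x - y
  | .mul, x, y => x * y
  | .div, x, y => x / y
  | .lt, x, y => if x < y then 1 else 0

inductive Expr
  | const (c : ℤ)
  | get (a : ℕ) (i : Expr)
  | op (o : Op) (e₁ e₂ : Expr)

/-- Value of an expression. Negative addresses are read as `0`. -/
def Expr.eval (s : Store) : Expr → ℤ
  | .const c => c
  | .get a i => s a (i.eval s).toNat
  | .op o e₁ e₂ => o.eval (e₁.eval s) (e₂.eval s)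

/-- Number of bits of an integer. -/
def bits (x : ℤ) : ℕ := x.natAbs.size

/-- Time for the evaluation of an expression. -/
def Expr.cost (s : Store) : Expr → ℕ
  | .const c => 1 + bits c
  | .get a i => i.cost s + 1 + bits (i.eval s) + bits (s a (i.eval s).toNat)
  | .op o e₁ e₂ => e₁.cost s + e₂.cost s + 1 + bits (e₁.eval s) + bits (e₂.eval s)

inductive Cmd
  | skip
  | set (a : ℕ) (i e : Expr)
  | seq (c₁ c₂ : Cmd)
  | ite (b : Expr) (c₁ c₂ : Cmd)
  | loop (b : Expr) (c : Cmd)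

/-- Write `v` into cell `i` of array `a`. -/
def Store.write (s : Store) (a i : ℕ) (v : ℤ) : Store :=
  Function.update s a (Function.update (s a) i v)

/-- `Exec c s t s'`: started on `s`, the program `c` halts after time `t` with memory `s'`.
A test counts as passed when its value is not `0`; `loop b c` repeats `c` while `b` is passed. -/
inductive Exec : Cmd → Store → ℕ → Store → Prop
  | skip (s : Store) : Exec .skip s 1 s
  | set (s : Store) (a : ℕ) (i e : Expr) :
      Exec (.set a i e) s
        (i.cost s + e.cost s + 1 + bits (i.eval s) + bits (e.eval s))
        (s.write a (i.eval s).toNat (e.eval s))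
  | seq {c₁ c₂ : Cmd} {s s₁ s₂ : Store} {t₁ t₂ : ℕ} :
      Exec c₁ s t₁ s₁ → Exec c₂ s₁ t₂ s₂ → Exec (.seq c₁ c₂) s (t₁ + t₂) s₂
  | ite_true {b : Expr} {c₁ c₂ : Cmd} {s s' : Store} {t : ℕ} :
      b.eval s ≠ 0 → Exec c₁ s t s' → Exec (.ite b c₁ c₂) s (b.cost s + 1 + t) s'
  | ite_false {b : Expr} {c₁ c₂ : Cmd} {s s' : Store} {t : ℕ} :
      b.eval s = 0 → Exec c₂ s t s' → Exec (.ite b c₁ c₂) s (b.cost s + 1 + t) s'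
  | loop_true {b : Expr} {c : Cmd} {s s₁ s₂ : Store} {t₁ t₂ : ℕ} :
      b.eval s ≠ 0 → Exec c s t₁ s₁ → Exec (.loop b c) s₁ t₂ s₂ →
      Exec (.loop b c) s (b.cost s + 1 + t₁ + t₂) s₂
  | loop_false {b : Expr} {c : Cmd} {s : Store} :
      b.eval s = 0 → Exec (.loop b c) s (b.cost s + 1) s

/-! ### Input and output of a reconstruction program -/

/-- Initial memory: array `0` holds the numbers `h 0, …, h K`, cell `0` of array `1` holds `K`, and
all other cells are `0`. -/
def inputStore {K : ℕ} (h : Fin (K + 1) → ℕ) : Store := fun a i =>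
  if a = 0 then (if hi : i < K + 1 then (h ⟨i, hi⟩ : ℤ) else 0)
  else if a = 1 ∧ i = 0 then (K : ℤ)
  else 0

/-- Number of points of the output mixture: cell `0` of array `4`. -/
def outSize (s : Store) : ℕ := (s 4 0).toNat

/-- Common denominator of the points of the output mixture: cell `1` of array `4`. -/
def outDenom (s : Store) : ℤ := s 4 1

/-- Total of the (unnormalized) weights of the output mixture, which are stored in array `3`. -/
def outTotal (s : Store) : ℤ := ∑ j ∈ Finset.range (outSize s), s 3 j

/-- The memory `s` is a valid description of the mixture `ν` on `[0,1]`, namely of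
`∑ j < N, (w j / W) δ_{a j / D}` with `N = outSize s`, `D = outDenom s`, `W = outTotal s`,
`a j = s 2 j` and `w j = s 3 j`. -/
def Describes (s : Store) (ν : ProbabilityMeasure I) : Prop :=
  0 < outDenom s ∧ 0 < outTotal s ∧
  (∀ j < outSize s, 0 ≤ s 2 j ∧ s 2 j ≤ outDenom s ∧ 0 ≤ s 3 j) ∧
  (ν : Measure I).map (Subtype.val : I → ℝ) =
    ∑ j ∈ Finset.range (outSize s),
      ENNReal.ofReal ((s 3 j : ℝ) / (outTotal s : ℝ)) •
        Measure.dirac ((s 2 j : ℝ) / (outDenom s : ℝ))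

/-- On input `h`, the program `c` halts within time `T` and its output, of at most `T` points, is
the mixture `ν`. -/
def OutputsWithin {K : ℕ} (c : Cmd) (h : Fin (K + 1) → ℕ) (T : ℕ) (ν : ProbabilityMeasure I) :
    Prop :=
  ∃ (t : ℕ) (s : Store), Exec c (inputStore h) t s ∧ t ≤ T ∧ outSize s ≤ T ∧ Describes s ν

end CoinProblem

/-! The chance that a coin drawn from `ϑ` shows `i` heads is `(K choose i) ∫ pⁱ (1 - p)ᴷ⁻ⁱ dϑ`, so
the counts estimate the `ϑ`-integral of every polynomial of degree at most `K`. It suffices to find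
nonnegative polynomials `D_j` of degree at most `K`, each concentrated within `O(1/K)` of a grid
point `x_j`, whose sum is nearly constant on `[0,1]`, and to give `x_j` a weight proportional to the
estimate of `∫ D_j dϑ`.

With `n = K / 8` and `N = 2 n + 1`, let `D_j` be the fourth power of `sin (N φ) / sin φ` at `sin φ =
(y - x_j) / 2`, a Jackson type kernel of degree `8 n` in `y`. The grid has mesh `1 / M` with `M =
(K+1)⁴` and covers `[-1, 2]`, so that boundary effects on the sum stay small (`abs_gridS_sub_le`).
The sum has order `M N³` (`le_gridS_zero`), its oscillation is `O(N⁶ + M)`, and the first absolute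
moment exceeds `1/N` of the sum by only `O(M N²)` (`sum_abs_mul_gridD_le`). Sending mass from `y` to
the points `x_j` in proportion to `D_j y` therefore costs `O(1/N) = O(1/K)`; grid points outside
`[0,1]` are moved to the nearest endpoint, which only brings them closer to `y`. The leftover mass
travels at most distance `1` (`tran_sum_dirac_le`, `tran_le_of_kernel`).

Statistical error: in the Bernstein basis `M^(8 n) D_j` has integer coefficients of size at most `(8
M²)^(4 n) (K choose i)` (`abs_coeff_gridA_le`, by coefficientwise majorization). Relative to `M^(8
n)` this is a loss of only `exp(O(K))`, so counts that are accurate to a relative precision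
`2^(-O(K))` are good enough. Chebyshev's inequality supplies such counts from `2^(C K)` coins.

Computation: after multiplication by `(K+1)!` each weight is an integer, namely one coefficient of a
product of two integer polynomials. The program evaluates the product at a single large integer `Z`
and reads off the digit (`kronDigit_eq`), which needs only a three-term recurrence, Horner's rule
and two rounded divisions. All numbers are below a power of `Z` with exponent linear in `K`, hence
have polynomially many bits (`reach_reconstruct`, `bits_le_totalBits`). -/

/-! ### A Jackson kernel -/

/-- The homogeneous form of `sin ((2 * n + 1) * φ) / sin φ`, as a polynomial in `u` and `v`;
the value of `4 sin² φ` is `v / u`. -/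
def chebW {R : Type*} [CommRing R] (u v : R) : ℕ → R
  | 0 => 1
  | 1 => 3 * u - v
  | n + 2 => (2 * u - v) * chebW u v (n + 1) - u ^ 2 * chebW u v n

theorem map_chebW {R S : Type*} [CommRing R] [CommRing S] (f : R →+* S) (u v : R) (n : ℕ) :
    f (chebW u v n) = chebW (f u) (f v) n := by
  induction n using Nat.twoStepInduction with
  | zero => simp [chebW]
  | one => simp only [chebW, map_sub, map_mul, map_ofNat]
  | more n h1 h2 => simp only [chebW, map_sub, map_mul, map_pow, map_ofNat, h1, h2]

theorem chebW_smul {R : Type*} [CommRing R] (c u v : R) (n : ℕ) :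
    chebW (c * u) (c * v) n = c ^ n * chebW u v n := by
  induction n using Nat.twoStepInduction with
  | zero => simp [chebW]
  | one => simp [chebW]; ring
  | more n h1 h2 => simp only [chebW, h1, h2]; ring

/-- The Dirichlet type kernel `sin ((2 * n + 1) * φ) / sin φ` as a polynomial in `t = sin φ`. -/
noncomputable def dirW (n : ℕ) (t : ℝ) : ℝ := chebW 1 (4 * t ^ 2) n

/-- At `u = 1`, `v = 4 sin² φ` the factor `2 u - v` equals `2 cos (2 φ)`, so the recurrence is the
product-to-sum rule for the Dirichlet kernel. -/
theorem dirW_sin (n : ℕ) (φ : ℝ) :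
    dirW n (Real.sin φ) = 1 + 2 * ∑ k ∈ Finset.range n, Real.cos (2 * ((k + 1 : ℕ) * φ)) := by
  unfold dirW
  induction n using Nat.twoStepInduction with
  | zero => simp [chebW]
  | one =>
    simp only [chebW, Finset.sum_range_one, Nat.cast_one, zero_add, one_mul]
    rw [Real.cos_two_mul, Real.cos_sq']; ring
  | more n h1 h2 =>
    simp only [chebW]
    rw [h1, h2]
    have key : ∀ m : ℕ, (2 - 4 * Real.sin φ ^ 2) * (1 + 2 * ∑ k ∈ Finset.range (m + 1),
        Real.cos (2 * ((k + 1 : ℕ) * φ))) = (1 + 2 * ∑ k ∈ Finset.range m,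
        Real.cos (2 * ((k + 1 : ℕ) * φ))) + (1 + 2 * ∑ k ∈ Finset.range (m + 2),
        Real.cos (2 * ((k + 1 : ℕ) * φ))) := by
      intro m
      have h0 : 2 - 4 * Real.sin φ ^ 2 = 2 * Real.cos (2 * φ) := by
        rw [Real.cos_two_mul, Real.cos_sq']; ring
      induction m with
      | zero =>
        simp only [Finset.sum_range_succ, Finset.sum_range_zero]
        have := Real.cos_two_mul (2 * φ)
        rw [h0]
        push_cast
        simp only [zero_add, one_mul, this]
        ring
      | succ m ih =>
        rw [Finset.sum_range_succ _ (m + 1), Finset.sum_range_succ _ (m + 2),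
          mul_add 2, ← add_assoc, mul_add, ih]
        have h3 : 2 * Real.cos (2 * φ) * Real.cos (2 * ((m + 1 + 1 : ℕ) * φ)) =
            Real.cos (2 * ((m + 1 : ℕ) * φ)) + Real.cos (2 * ((m + 2 + 1 : ℕ) * φ)) := by
          have e1 : 2 * ((m + 1 : ℕ) * φ) = 2 * ((m + 1 + 1 : ℕ) * φ) - 2 * φ := by
            push_cast; ring
          have e2 : 2 * ((m + 2 + 1 : ℕ) * φ) = 2 * ((m + 1 + 1 : ℕ) * φ) + 2 * φ := by
            push_cast; ring
          rw [e1, e2, Real.cos_sub, Real.cos_add]; ring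
        rw [Finset.sum_range_succ _ m]
        rw [h0]
        linear_combination 2 * h3
    have := key n
    linear_combination this

theorem sin_mul_dirW (n : ℕ) (φ : ℝ) :
    Real.sin φ * dirW n (Real.sin φ) = Real.sin ((2 * n + 1 : ℕ) * φ) := by
  rw [dirW_sin]
  induction n with
  | zero => simp
  | succ n ih =>
    rw [Finset.sum_range_succ, mul_add 2, ← add_assoc, mul_add, ih]
    have e1 : ((2 * n + 1 : ℕ) : ℝ) * φ = 2 * ((n + 1 : ℕ) * φ) - φ := by push_cast; ring
    have e2 : ((2 * (n + 1) + 1 : ℕ) : ℝ) * φ = 2 * ((n + 1 : ℕ) * φ) + φ := by push_cast; ring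
    rw [e1, e2, Real.sin_sub, Real.sin_add]; ring

theorem exists_sin_eq {t : ℝ} (ht : |t| ≤ 1) : ∃ φ, Real.sin φ = t :=
  ⟨Real.arcsin t, Real.sin_arcsin (abs_le.1 ht).1 (abs_le.1 ht).2⟩

theorem abs_mul_dirW_le (n : ℕ) {t : ℝ} (ht : |t| ≤ 1) : |t * dirW n t| ≤ 1 := by
  obtain ⟨φ, rfl⟩ := exists_sin_eq ht
  rw [sin_mul_dirW]
  exact Real.abs_sin_le_one _

theorem abs_dirW_le (n : ℕ) {t : ℝ} (ht : |t| ≤ 1) : |dirW n t| ≤ 2 * n + 1 := by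
  obtain ⟨φ, rfl⟩ := exists_sin_eq ht
  rw [dirW_sin]
  have h : |∑ k ∈ Finset.range n, Real.cos (2 * ((k + 1 : ℕ) * φ))| ≤ n := by
    refine (Finset.abs_sum_le_sum_abs _ _).trans ?_
    refine (Finset.sum_le_card_nsmul _ _ 1 fun k _ => Real.abs_cos_le_one _).trans ?_
    simp
  rw [abs_le] at *
  constructor <;> linarith [h.1, h.2]

theorem abs_sin_nat_mul_le (k : ℕ) (x : ℝ) : |Real.sin (k * x)| ≤ k * |Real.sin x| := by
  induction k with
  | zero => simp
  | succ k ih =>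
    push_cast
    rw [add_mul, one_mul, Real.sin_add]
    refine (abs_add_le _ _).trans ?_
    rw [abs_mul, abs_mul]
    have h1 := Real.abs_cos_le_one x
    have h2 := Real.abs_cos_le_one (k * x)
    nlinarith [abs_nonneg (Real.sin (k * x)), abs_nonneg (Real.sin x)]

/-- The difference factors as `-2 sin (k (x+y)) sin (k (x-y))`; each factor loses at most `k`
against its value at `k = 1`, and `sin (x+y) sin (x-y) = sin² x - sin² y`. -/
theorem abs_cos_sub_cos_le (k : ℕ) (x y : ℝ) :
    |Real.cos (2 * (k * x)) - Real.cos (2 * (k * y))| ≤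
      2 * k ^ 2 * |Real.sin x ^ 2 - Real.sin y ^ 2| := by
  rw [Real.cos_sub_cos]
  have e1 : (2 * (k * x) + 2 * (k * y)) / 2 = k * (x + y) := by ring
  have e2 : (2 * (k * x) - 2 * (k * y)) / 2 = k * (x - y) := by ring
  have e3 : Real.sin x ^ 2 - Real.sin y ^ 2 = Real.sin (x + y) * Real.sin (x - y) := by
    rw [Real.sin_add, Real.sin_sub]
    have hx := Real.sin_sq_add_cos_sq x
    have hy := Real.sin_sq_add_cos_sq y
    linear_combination Real.sin y ^ 2 * hx - Real.sin x ^ 2 * hy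
  rw [e1, e2, e3, abs_mul, abs_mul, abs_mul]
  have h1 := abs_sin_nat_mul_le k (x + y)
  have h2 := abs_sin_nat_mul_le k (x - y)
  have := mul_le_mul h1 h2 (abs_nonneg _) (by positivity)
  simp only [abs_neg, abs_two]
  nlinarith

theorem sum_sq_le (n : ℕ) : ∑ k ∈ Finset.range n, ((k + 1 : ℕ) : ℝ) ^ 2 ≤ (n : ℝ) ^ 3 := by
  have h := Finset.sum_le_card_nsmul (Finset.range n) (fun k => ((k + 1 : ℕ) : ℝ) ^ 2)
    ((n : ℝ) ^ 2) (fun k hk => by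
      have := Finset.mem_range.1 hk
      have : ((k + 1 : ℕ) : ℝ) ≤ n := by exact_mod_cast this
      gcongr)
  rw [Finset.card_range, nsmul_eq_mul] at h
  linarith [h]

/-- Keeping `t² - s²` on the right makes the bound quadratic near `s = 0`, which `le_dirW_pow` uses
to hold the peak over a width of order `1 / n`. -/
theorem abs_dirW_sub_le (n : ℕ) {t s : ℝ} (ht : |t| ≤ 1) (hs : |s| ≤ 1) :
    |dirW n t - dirW n s| ≤ 4 * (n : ℝ) ^ 3 * |t ^ 2 - s ^ 2| := by
  obtain ⟨x, rfl⟩ := exists_sin_eq ht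
  obtain ⟨y, rfl⟩ := exists_sin_eq hs
  rw [dirW_sin, dirW_sin, add_sub_add_left_eq_sub, ← mul_sub, ← Finset.sum_sub_distrib, abs_mul,
    abs_two]
  have h1 : |∑ k ∈ Finset.range n, (Real.cos (2 * ((k + 1 : ℕ) * x)) -
      Real.cos (2 * ((k + 1 : ℕ) * y)))| ≤
      ∑ k ∈ Finset.range n, ((k + 1 : ℕ) : ℝ) ^ 2 * (2 * |Real.sin x ^ 2 - Real.sin y ^ 2|) := by
    refine (Finset.abs_sum_le_sum_abs _ _).trans (Finset.sum_le_sum fun k _ => ?_)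
    refine (abs_cos_sub_cos_le (k + 1) x y).trans (le_of_eq (by ring))
  rw [← Finset.sum_mul] at h1
  have := mul_le_mul_of_nonneg_right (sum_sq_le n)
    (by positivity : 0 ≤ 2 * |Real.sin x ^ 2 - Real.sin y ^ 2|)
  linarith

theorem dirW_zero (n : ℕ) : dirW n 0 = 2 * n + 1 := by
  have := dirW_sin n 0
  simp at this
  rw [this]; ring

theorem abs_dirW_sub_le' (n : ℕ) {t s : ℝ} (ht : |t| ≤ 1) (hs : |s| ≤ 1) :
    |dirW n t - dirW n s| ≤ (2 * n + 1 : ℝ) ^ 3 * |t - s| := by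
  refine (abs_dirW_sub_le n ht hs).trans ?_
  have e : t ^ 2 - s ^ 2 = (t + s) * (t - s) := by ring
  rw [e, abs_mul]
  have h1 : |t + s| ≤ 2 := (abs_add_le t s).trans (by linarith)
  have h2 : 8 * (n : ℝ) ^ 3 ≤ (2 * n + 1 : ℝ) ^ 3 := by
    have : (0 : ℝ) ≤ n := by positivity
    nlinarith [pow_nonneg this 2]
  calc 4 * (n : ℝ) ^ 3 * (|t + s| * |t - s|) ≤ 4 * (n : ℝ) ^ 3 * (2 * |t - s|) := by gcongr
    _ = 8 * (n : ℝ) ^ 3 * |t - s| := by ring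
    _ ≤ _ := by gcongr

/-- Fourth powers of `dirW` are Lipschitz. -/
theorem abs_dirW_pow_sub_le (n : ℕ) {t s : ℝ} (ht : |t| ≤ 1) (hs : |s| ≤ 1) :
    |dirW n t ^ 4 - dirW n s ^ 4| ≤ 4 * (2 * n + 1 : ℝ) ^ 6 * |t - s| := by
  have h := abs_dirW_sub_le' n ht hs
  have ha := abs_dirW_le n ht
  have hb := abs_dirW_le n hs
  set a := dirW n t
  set b := dirW n s
  set N : ℝ := 2 * n + 1
  have hN : 0 ≤ N := (abs_nonneg _).trans ha
  have e : a ^ 4 - b ^ 4 = (a ^ 3 + a ^ 2 * b + a * b ^ 2 + b ^ 3) * (a - b) := by ring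
  have h1 : |a ^ 3 + a ^ 2 * b + a * b ^ 2 + b ^ 3| ≤ 4 * N ^ 3 := by
    refine (abs_add_le _ _).trans ?_
    refine (add_le_add_left ((abs_add_le _ _).trans
      (add_le_add_left (abs_add_le _ _) _)) _).trans ?_
    simp only [abs_mul, abs_pow]
    have h1 : |a| ^ 3 ≤ N ^ 3 := by gcongr
    have h2 : |b| ^ 3 ≤ N ^ 3 := by gcongr
    have h3 : |a| ^ 2 * |b| ≤ N ^ 2 * N := by gcongr
    have h4 : |a| * |b| ^ 2 ≤ N * N ^ 2 := by gcongr
    nlinarith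
  rw [e, abs_mul]
  calc _ ≤ 4 * N ^ 3 * (N ^ 3 * |t - s|) := by gcongr
    _ = _ := by ring

/-- The peak value at `0` is `N = 2 n + 1`. Within distance `1 / (2 N)` it drops by at most `N / 8`,
and `(7/8)⁴ ≥ 1/2`. -/
theorem le_dirW_pow (n : ℕ) {t : ℝ} (ht : |t| * (2 * (2 * n + 1)) ≤ 1) :
    (2 * n + 1 : ℝ) ^ 4 / 2 ≤ dirW n t ^ 4 := by
  have hn : (0 : ℝ) ≤ n := by positivity
  have ht1 : |t| ≤ 1 := by nlinarith [abs_nonneg t]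
  have h := abs_dirW_sub_le n ht1 (s := 0) (by simp)
  rw [dirW_zero] at h
  simp only [ne_eq, OfNat.ofNat_ne_zero, not_false_eq_true, zero_pow, sub_zero] at h
  set N : ℝ := 2 * n + 1 with hN
  have hN1 : 1 ≤ N := by linarith
  have h2 : |t ^ 2| * (4 * N ^ 2) ≤ 1 := by
    rw [abs_pow]
    calc |t| ^ 2 * (4 * N ^ 2) = (|t| * (2 * N)) ^ 2 := by ring
      _ ≤ 1 := pow_le_one₀ (by positivity) ht
  have h3 : 4 * (n : ℝ) ^ 3 ≤ N / 8 * (4 * N ^ 2) := by rw [hN]; nlinarith [pow_nonneg hn 2]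
  have h4 : 4 * (n : ℝ) ^ 3 * |t ^ 2| ≤ N / 8 := by
    calc _ ≤ N / 8 * (4 * N ^ 2) * |t ^ 2| := by gcongr
      _ = N / 8 * (|t ^ 2| * (4 * N ^ 2)) := by ring
      _ ≤ N / 8 * 1 := by gcongr
      _ = _ := by ring
  have h5 : 7 / 8 * N ≤ dirW n t := by
    have := (abs_le.1 (h.trans h4)).1
    linarith
  calc N ^ 4 / 2 ≤ (7 / 8 * N) ^ 4 := by nlinarith [pow_nonneg (by linarith : 0 ≤ N) 4]
    _ ≤ _ := by gcongr

theorem sq_mul_dirW_pow_le (n : ℕ) {t : ℝ} (ht : |t| ≤ 1) :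
    t ^ 2 * dirW n t ^ 4 ≤ dirW n t ^ 2 := by
  have h := abs_mul_dirW_le n ht
  have h2 : (t * dirW n t) ^ 2 ≤ 1 := by rw [← sq_abs]; exact pow_le_one₀ (abs_nonneg _) h
  nlinarith [sq_nonneg (dirW n t)]

theorem pow_mul_dirW_pow_le (n : ℕ) {t : ℝ} (ht : |t| ≤ 1) :
    t ^ 4 * dirW n t ^ 4 ≤ 1 := by
  have h := abs_mul_dirW_le n ht
  calc t ^ 4 * dirW n t ^ 4 = |t * dirW n t| ^ 4 := by
        rw [Even.pow_abs (by decide)]; ring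
    _ ≤ 1 := pow_le_one₀ (abs_nonneg _) h

/-! ### Sums of the kernel over a grid -/

/-- The function `x / (c + |x|)` has derivative `c / (c + |x|)²`, which on `[x, x+1]` is at least
the left side. Since the function is bounded by `1`, the sums telescope to at most `2`. -/
theorem inv_sq_le_telescope {c : ℝ} (hc : 0 < c) (x : ℝ) :
    c / (c + |x| + 1) ^ 2 ≤ (x + 1) / (c + |x + 1|) - x / (c + |x|) := by
  rcases le_or_gt 0 x with hx | hx
  · rw [abs_of_nonneg hx, abs_of_nonneg (by linarith : 0 ≤ x + 1),
      div_sub_div _ _ (by positivity) (by positivity),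
      div_le_div_iff₀ (by positivity) (by positivity)]
    have : (x + 1) * (c + x) - (c + (x + 1)) * x = c := by ring
    rw [this]
    gcongr
    nlinarith
  rcases le_or_gt 0 (x + 1) with hx1 | hx1
  · rw [abs_of_neg hx, abs_of_nonneg hx1]
    have h1 : c / (c + -x + 1) ^ 2 ≤ 1 / (c + 1) := by
      rw [div_le_div_iff₀ (by nlinarith [sq_nonneg (c + -x + 1)]) (by positivity)]
      nlinarith
    have h2 : (x + 1) / (c + 1) ≤ (x + 1) / (c + (x + 1)) := by
      gcongr
      linarith
    have h3 : -x / (c + 1) ≤ -x / (c + -x) := by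
      apply div_le_div_of_nonneg_left <;> linarith
    have h4 : (x + 1) / (c + 1) + -x / (c + 1) = 1 / (c + 1) := by
      rw [← add_div]; congr 1; ring
    rw [neg_div] at h3 h4
    rw [neg_div] at h3
    linarith
  · rw [abs_of_neg hx, abs_of_neg hx1,
      div_sub_div _ _ (by nlinarith) (by nlinarith),
      div_le_div_iff₀ (by nlinarith [sq_nonneg (c + -x + 1)])
        (mul_pos (by linarith) (by linarith))]
    have : (x + 1) * (c + -x) - (c + -(x + 1)) * x = c := by ring
    rw [this]
    gcongr
    nlinarith

theorem sum_inv_sq_le {c : ℝ} (hc : 0 < c) (z : ℝ) (J : ℕ) :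
    ∑ j ∈ Finset.range J, 1 / (c + |z - j| + 1) ^ 2 ≤ 2 / c := by
  have hφ : ∀ x : ℝ, |x / (c + |x|)| ≤ 1 := fun x => by
    rw [abs_div, abs_of_pos (by positivity : 0 < c + |x|), div_le_one (by positivity)]
    linarith
  have h : ∑ j ∈ Finset.range J, c / (c + |z - j| + 1) ^ 2 ≤
      ((J : ℝ) - z) / (c + |(J : ℝ) - z|) - ((0 : ℕ) - z) / (c + |((0 : ℕ) : ℝ) - z|) := by
    rw [← Finset.sum_range_sub (fun j : ℕ => ((j : ℝ) - z) / (c + |(j : ℝ) - z|))]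
    refine Finset.sum_le_sum fun j _ => ?_
    have := inv_sq_le_telescope hc (j - z)
    rw [abs_sub_comm z j]
    push_cast
    rw [show (j : ℝ) + 1 - z = j - z + 1 by ring]
    exact this
  have h2 : c * ∑ j ∈ Finset.range J, 1 / (c + |z - j| + 1) ^ 2 ≤ 2 := by
    rw [Finset.mul_sum]
    simp only [mul_one_div]
    have h1 := (abs_le.1 (hφ ((J : ℝ) - z))).2
    have h3 := (abs_le.1 (hφ (((0 : ℕ) : ℝ) - z))).1
    linarith
  rw [le_div_iff₀ hc]
  linarith

/-- The argument of the kernel for the `j`-th grid point `j / M - 1` and the point `y`. -/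
noncomputable def gridT (M : ℕ) (j : ℕ) (y : ℝ) : ℝ := (M * y + M - j) / (2 * M)

/-- The kernel for the `j`-th grid point. -/
noncomputable def gridD (n M : ℕ) (j : ℕ) (y : ℝ) : ℝ := dirW n (gridT M j y) ^ 4

/-- The sum of the kernels over the grid. -/
noncomputable def gridS (n M : ℕ) (y : ℝ) : ℝ := ∑ j ∈ Finset.range (3 * M + 1), gridD n M j y

theorem gridD_nonneg (n M j : ℕ) (y : ℝ) : 0 ≤ gridD n M j y := by
  unfold gridD; positivity

theorem continuous_gridD (n M j : ℕ) : Continuous fun y : ℝ => gridD n M j y := by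
  have hv : Continuous fun y : ℝ => 4 * gridT M j y ^ 2 := by unfold gridT; fun_prop
  refine Continuous.pow ?_ 4
  unfold dirW
  induction n using Nat.twoStepInduction with
  | zero => simp only [chebW]; fun_prop
  | one => simp only [chebW]; fun_prop
  | more n h1 h2 => simp only [chebW]; fun_prop

theorem abs_gridT_le {M j : ℕ} (hM : 0 < M) (hj : j < 3 * M + 1) {y : ℝ} (hy : y ∈ I) :
    |gridT M j y| ≤ 1 := by
  have hM' : (0 : ℝ) < M := by exact_mod_cast hM
  have hj' : (j : ℝ) ≤ 3 * M := by exact_mod_cast Nat.lt_succ_iff.1 hj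
  have hj0 : (0 : ℝ) ≤ j := by positivity
  unfold gridT
  rw [abs_le, le_div_iff₀ (by positivity), div_le_iff₀ (by positivity)]
  constructor <;> nlinarith [hy.1, hy.2]

/-- Rounding `y` down to the grid moves each kernel argument by at most `1 / (2 M)`; the Lipschitz
bound is summed over `3 M + 1 ≤ 4 M` kernels. -/
theorem abs_gridS_sub_floor_le (n : ℕ) {M : ℕ} (hM : 0 < M) {y : ℝ} (hy : y ∈ I) :
    |gridS n M y - gridS n M (⌊M * y⌋₊ / M)| ≤ 8 * (2 * n + 1 : ℝ) ^ 6 := by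
  have hM' : (0 : ℝ) < M := by exact_mod_cast hM
  have hM1 : (1 : ℝ) ≤ M := by exact_mod_cast hM
  have hMy : 0 ≤ M * y := mul_nonneg hM'.le hy.1
  have hf1 := Nat.floor_le hMy
  have hf2 := Nat.lt_floor_add_one (M * y)
  have hk : ((⌊M * y⌋₊ : ℝ) / M) ∈ I := by
    constructor
    · positivity
    · rw [div_le_one hM']; nlinarith [hy.2]
  unfold gridS
  rw [← Finset.sum_sub_distrib]
  refine (Finset.abs_sum_le_sum_abs _ _).trans ?_
  have : ∀ j ∈ Finset.range (3 * M + 1), |gridD n M j y - gridD n M j (⌊M * y⌋₊ / M)| ≤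
      4 * (2 * n + 1 : ℝ) ^ 6 * (1 / (2 * M)) := by
    intro j hj
    refine (abs_dirW_pow_sub_le n (abs_gridT_le hM (Finset.mem_range.1 hj) hy)
      (abs_gridT_le hM (Finset.mem_range.1 hj) hk)).trans ?_
    gcongr
    unfold gridT
    rw [← sub_div, abs_div, abs_of_pos (by positivity : (0 : ℝ) < 2 * M)]
    gcongr
    rw [mul_div_cancel₀ _ hM'.ne', abs_le]
    constructor <;> linarith
  refine (Finset.sum_le_card_nsmul _ _ _ this).trans ?_
  rw [Finset.card_range, nsmul_eq_mul]
  have e : ((3 * M + 1 : ℕ) : ℝ) * (4 * (2 * n + 1 : ℝ) ^ 6 * (1 / (2 * M))) =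
      ((3 * M + 1) / M) * (2 * (2 * n + 1 : ℝ) ^ 6) := by
    push_cast; field_simp; ring
  rw [e]
  have h4 : (3 * M + 1 : ℝ) / M ≤ 4 := by rw [div_le_iff₀ hM']; linarith
  calc _ ≤ 4 * (2 * (2 * n + 1 : ℝ) ^ 6) := by gcongr
    _ = _ := by ring

theorem dirW_pow_le_of_half_le (n : ℕ) {t : ℝ} (ht : |t| ≤ 1) (h : 1 / 2 ≤ |t|) :
    dirW n t ^ 4 ≤ 16 := by
  have h1 := pow_mul_dirW_pow_le n ht
  have h2 : (1 / 2 : ℝ) ^ 4 ≤ t ^ 4 := by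
    rw [← Even.pow_abs (by decide : Even 4) t]; gcongr
  have h3 : 0 ≤ dirW n t ^ 4 := by positivity
  nlinarith

/-- A shift of `y` by `1 / M` shifts the index `j` by one, so the sum gains one end term and loses
another. Because the grid reaches from `-1` to `2`, both have argument at least `1/2` in absolute
value and lie in `[0, 16]`. -/
theorem abs_gridS_nat_sub_le (n : ℕ) {M : ℕ} (hM : 0 < M) (k : ℕ) (hk : k ≤ M) :
    |gridS n M (k / M) - gridS n M 0| ≤ 16 * k := by
  have hM' : (0 : ℝ) < M := by exact_mod_cast hM
  induction k with
  | zero => simp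
  | succ k ih =>
    have ih := ih (by omega)
    have hk' : (k : ℝ) + 1 ≤ M := by exact_mod_cast hk
    have hk0 : (0 : ℝ) ≤ k := by positivity
    have e1 : gridS n M ((k + 1 : ℕ) / M) = gridD n M 0 ((k + 1 : ℕ) / M) +
        ∑ j ∈ Finset.range (3 * M), gridD n M j (k / M) := by
      unfold gridS
      rw [Finset.sum_range_succ', add_comm]
      congr 1
      refine Finset.sum_congr rfl fun j _ => ?_
      unfold gridD gridT
      congr 2
      field_simp
      push_cast
      ring
    have e2 : gridS n M (k / M) = ∑ j ∈ Finset.range (3 * M), gridD n M j (k / M) +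
        gridD n M (3 * M) (k / M) := by
      unfold gridS
      rw [Finset.sum_range_succ]
    have b1 : gridD n M 0 ((k + 1 : ℕ) / M) ≤ 16 := by
      have hy : (((k + 1 : ℕ) : ℝ) / M) ∈ I := ⟨by positivity, by
        rw [div_le_one hM']; push_cast; exact hk'⟩
      refine dirW_pow_le_of_half_le n (abs_gridT_le hM (by omega) hy) ?_
      refine le_trans ?_ (le_abs_self _)
      unfold gridT
      rw [mul_div_cancel₀ _ hM'.ne', le_div_iff₀ (by positivity)]
      push_cast
      linarith
    have b2 : gridD n M (3 * M) (k / M) ≤ 16 := by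
      have hy : ((k : ℝ) / M) ∈ I := ⟨by positivity, by
        rw [div_le_one hM']; linarith⟩
      refine dirW_pow_le_of_half_le n (abs_gridT_le hM (by omega) hy) ?_
      refine le_trans ?_ (neg_le_abs _)
      unfold gridT
      rw [mul_div_cancel₀ _ hM'.ne', ← neg_div, le_div_iff₀ (by positivity)]
      push_cast
      linarith
    have p1 := gridD_nonneg n M 0 ((k + 1 : ℕ) / M)
    have p2 := gridD_nonneg n M (3 * M) (k / M)
    rw [e1]
    rw [e2] at ih
    rw [abs_le] at *
    push_cast at *
    constructor <;> linarith [ih.1, ih.2]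

theorem abs_gridS_sub_le (n : ℕ) {M : ℕ} (hM : 0 < M) {y : ℝ} (hy : y ∈ I) :
    |gridS n M y - gridS n M 0| ≤ 8 * (2 * n + 1 : ℝ) ^ 6 + 16 * M := by
  have hM' : (0 : ℝ) < M := by exact_mod_cast hM
  have hk : ⌊M * y⌋₊ ≤ M := by
    refine Nat.floor_le_of_le ?_
    nlinarith [hy.2]
  have hk' : (⌊M * y⌋₊ : ℝ) ≤ M := by exact_mod_cast hk
  have h1 := abs_gridS_sub_floor_le n hM hy
  have h2 := abs_gridS_nat_sub_le n hM _ hk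
  refine (abs_sub_le _ _ _).trans (add_le_add h1 (h2.trans ?_))
  gcongr

/-- The `q + 1` grid points in `[-q/M, 0]`, with `q = ⌊M / N⌋`, see `0` within the peak of their
kernels; each contributes at least `N⁴ / 2`, and `(q + 1) N ≥ M`. -/
theorem le_gridS_zero (n : ℕ) {M : ℕ} (hM : 2 * n + 1 ≤ M) :
    M * (2 * n + 1 : ℝ) ^ 3 / 2 ≤ gridS n M 0 := by
  have hM' : (0 : ℝ) < M := by exact_mod_cast (by omega : 0 < M)
  set q := M / (2 * n + 1) with hq
  have hqM : q ≤ M := Nat.div_le_self _ _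
  have hq2 : q * (2 * n + 1) ≤ M := Nat.div_mul_le_self _ _
  have hq3 : (M : ℝ) ≤ (q + 1) * (2 * n + 1) := by
    have : M ≤ (q + 1) * (2 * n + 1) := by
      have := Nat.lt_div_mul_add (a := M) (b := 2 * n + 1) (by omega)
      rw [← hq] at this
      nlinarith
    exact_mod_cast this
  clear_value q
  have hsub : Finset.Icc (M - q) M ⊆ Finset.range (3 * M + 1) := by
    intro j hj
    simp only [Finset.mem_Icc, Finset.mem_range] at *
    omega
  calc (M : ℝ) * (2 * n + 1 : ℝ) ^ 3 / 2 ≤ (q + 1) * (2 * n + 1) * (2 * n + 1 : ℝ) ^ 3 / 2 := by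
        gcongr
    _ = ∑ _j ∈ Finset.Icc (M - q) M, (2 * n + 1 : ℝ) ^ 4 / 2 := by
        rw [Finset.sum_const, Nat.card_Icc, nsmul_eq_mul, show M + 1 - (M - q) = q + 1 by omega]
        push_cast
        ring
    _ ≤ ∑ j ∈ Finset.Icc (M - q) M, gridD n M j 0 := by
        refine Finset.sum_le_sum fun j hj => le_dirW_pow n ?_
        rw [Finset.mem_Icc] at hj
        have h1 : (j : ℝ) ≤ M := by exact_mod_cast hj.2
        have h2 : ((M : ℝ) - j) * (2 * n + 1) ≤ M := by
          have : (M - j) * (2 * n + 1) ≤ M :=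
            (Nat.mul_le_mul_right _ (by omega : M - j ≤ q)).trans hq2
          have h3 : (((M - j) * (2 * n + 1) : ℕ) : ℝ) ≤ M := by exact_mod_cast this
          rw [Nat.cast_mul, Nat.cast_sub hj.2] at h3
          push_cast at h3
          exact h3
        unfold gridT
        rw [mul_zero, zero_add, abs_div, abs_of_nonneg (by linarith),
          abs_of_pos (by positivity : (0 : ℝ) < 2 * M), div_mul_eq_mul_div,
          div_le_one (by positivity)]
        linarith
    _ ≤ _ := Finset.sum_le_sum_of_subset_of_nonneg hsub fun j _ _ => gridD_nonneg _ _ _ _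

/-- This merges the bounds `|w| ≤ N` and `|w| ≤ 2 M / |z|`: each of the three summands of the
denominator, multiplied by `|w|`, is at most `2 M`, whence `36 = 6²`. The form fits `sum_inv_sq_le`.
-/
theorem dirW_sq_le (n M : ℕ) (hM : 2 * n + 1 ≤ M) {z : ℝ} (hz : |z / (2 * M)| ≤ 1) :
    dirW n (z / (2 * M)) ^ 2 ≤
      36 * (M : ℝ) ^ 2 * (1 / (2 * M / (2 * n + 1 : ℝ) + |z| + 1) ^ 2) := by
  have hM' : (0 : ℝ) < M := by exact_mod_cast (by omega : 0 < M)
  have hM2 : (2 * n + 1 : ℝ) ≤ M := by exact_mod_cast hM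
  set N : ℝ := 2 * n + 1 with hN
  have hN0 : 0 < N := by rw [hN]; positivity
  have h1 := abs_dirW_le n hz
  have h2 := abs_mul_dirW_le n hz
  set w := dirW n (z / (2 * M)) with hw
  have hc : 1 ≤ 2 * M / N := by rw [le_div_iff₀ hN0]; linarith
  have h3 : |w| * (2 * M / N) ≤ 2 * M := by
    calc |w| * (2 * M / N) ≤ N * (2 * M / N) := by gcongr
      _ = 2 * M := by field_simp
  have h4 : |w| * |z| ≤ 2 * M := by
    rw [abs_mul, abs_div, abs_of_pos (by positivity : (0 : ℝ) < 2 * M)] at h2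
    rw [div_mul_eq_mul_div, div_le_one (by positivity)] at h2
    linarith
  have h5 : |w| * (2 * M / N + |z| + 1) ≤ 6 * M := by nlinarith [abs_nonneg w]
  rw [mul_one_div, le_div_iff₀ (by positivity), ← sq_abs w]
  calc |w| ^ 2 * (2 * M / N + |z| + 1 : ℝ) ^ 2 = (|w| * (2 * M / N + |z| + 1)) ^ 2 := by ring
    _ ≤ (6 * M : ℝ) ^ 2 := by gcongr
    _ = _ := by ring

theorem sum_dirW_sq_le (n M : ℕ) (hM : 2 * n + 1 ≤ M) {y : ℝ} (hy : y ∈ I) :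
    ∑ j ∈ Finset.range (3 * M + 1), dirW n (gridT M j y) ^ 2 ≤ 36 * M * (2 * n + 1) := by
  have hM' : (0 : ℝ) < M := by exact_mod_cast (by omega : 0 < M)
  have hc : 0 < 2 * M / (2 * n + 1 : ℝ) := by positivity
  calc _ ≤ ∑ j ∈ Finset.range (3 * M + 1), 36 * (M : ℝ) ^ 2 *
        (1 / (2 * M / (2 * n + 1 : ℝ) + |M * y + M - j| + 1) ^ 2) :=
        Finset.sum_le_sum fun j hj => dirW_sq_le n M hM
          (abs_gridT_le (by omega) (Finset.mem_range.1 hj) hy)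
    _ ≤ 36 * (M : ℝ) ^ 2 * (2 / (2 * M / (2 * n + 1 : ℝ))) := by
        rw [← Finset.mul_sum]
        gcongr
        exact sum_inv_sq_le hc (M * y + M) _
    _ = _ := by field_simp

/-- The first absolute moment of the kernel. -/
theorem sum_abs_mul_gridD_le (n M : ℕ) (hM : 2 * n + 1 ≤ M) {y : ℝ} (hy : y ∈ I) :
    ∑ j ∈ Finset.range (3 * M + 1), 2 * |gridT M j y| * gridD n M j y ≤
      gridS n M y / (2 * n + 1) + 36 * M * (2 * n + 1 : ℝ) ^ 2 := by
  have hN0 : (0 : ℝ) < 2 * n + 1 := by positivity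
  have h := sum_dirW_sq_le n M hM hy
  have h2 : ∀ j ∈ Finset.range (3 * M + 1), 2 * |gridT M j y| * gridD n M j y ≤
      gridD n M j y / (2 * n + 1) + (2 * n + 1) * dirW n (gridT M j y) ^ 2 := by
    intro j hj
    have h1 := sq_mul_dirW_pow_le n (abs_gridT_le (by omega) (Finset.mem_range.1 hj) hy)
    have hD := gridD_nonneg n M j y
    -- The arithmetic-geometric mean inequality, balanced at the kernel width `|t| = 1 / N`, reduces
    -- the first moment to the second.
    have h3 : 2 * |gridT M j y| ≤ 1 / (2 * n + 1) + (2 * n + 1) * gridT M j y ^ 2 := by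
      have := sq_nonneg ((2 * n + 1) * |gridT M j y| - 1)
      rw [← sq_abs (gridT M j y), ← sub_nonneg]
      have e : 1 / (2 * n + 1) + (2 * n + 1) * |gridT M j y| ^ 2 - 2 * |gridT M j y| =
          ((2 * n + 1) * |gridT M j y| - 1) ^ 2 / (2 * n + 1) := by field_simp; ring
      rw [e]
      positivity
    calc _ ≤ (1 / (2 * n + 1) + (2 * n + 1) * gridT M j y ^ 2) * gridD n M j y := by gcongr
      _ = gridD n M j y / (2 * n + 1) + (2 * n + 1) * (gridT M j y ^ 2 * gridD n M j y) := by ring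
      _ ≤ _ := by gcongr; exact h1
  refine (Finset.sum_le_sum h2).trans ?_
  rw [Finset.sum_add_distrib, ← Finset.sum_div, ← Finset.mul_sum]
  refine add_le_add le_rfl ?_
  calc _ ≤ (2 * n + 1 : ℝ) * (36 * M * (2 * n + 1)) := by gcongr
    _ = _ := by ring

/-! ### Transportation bounds from kernels -/

open scoped ENNReal in
-- The `f j` describe a partial transport plan that exhausts neither marginal. The two remainders
-- `ρ₁`, `ρ₂` have the same mass `η`; their normalized product completes the coupling and costs at
-- most `η`, because `[0,1]` has diameter `1`.
theorem tran_sum_dirac_le (ϑ : Measure I) [IsProbabilityMeasure ϑ] (s : Finset ℕ)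
    (f : ℕ → I → ℝ≥0∞) (hf : ∀ j, Measurable (f j)) (x : ℕ → I) (p : ℕ → ℝ≥0∞)
    (hp : ∑ j ∈ s, p j = 1) (hf1 : ∀ y, ∑ j ∈ s, f j y ≤ 1)
    (hfp : ∀ j ∈ s, ∫⁻ y, f j y ∂ϑ ≤ p j) :
    CoinProblem.tran ϑ (∑ j ∈ s, p j • Measure.dirac (x j)) ≤
      ∫⁻ y, ∑ j ∈ s, f j y * edist y (x j) ∂ϑ + (1 - ∑ j ∈ s, ∫⁻ y, f j y ∂ϑ) := by
  classical
  set m : ℕ → ℝ≥0∞ := fun j => ∫⁻ y, f j y ∂ϑ with hm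
  set η := 1 - ∑ j ∈ s, m j with hη
  set ρ₁ : Measure I := ϑ.withDensity fun y => 1 - ∑ j ∈ s, f j y with hρ₁
  set ρ₂ : Measure I := ∑ j ∈ s, (p j - m j) • Measure.dirac (x j) with hρ₂
  have hsm : Measurable fun y => ∑ j ∈ s, f j y := Finset.measurable_sum _ fun j _ => hf j
  have hmsum : ∑ j ∈ s, m j = ∫⁻ y, ∑ j ∈ s, f j y ∂ϑ :=
    (lintegral_finsetSum _ fun j _ => hf j).symm
  have hm1 : ∑ j ∈ s, m j ≤ 1 := hp ▸ Finset.sum_le_sum hfp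
  have hmtop : ∑ j ∈ s, m j ≠ ∞ := (hm1.trans_lt ENNReal.one_lt_top).ne
  have hη1 : η ≤ 1 := tsub_le_self
  have hηtop : η ≠ ∞ := (hη1.trans_lt ENNReal.one_lt_top).ne
  have hρ₁s : ∀ t, MeasurableSet t → ρ₁ t + ∑ j ∈ s, ∫⁻ y in t, f j y ∂ϑ = ϑ t := by
    intro t ht
    rw [hρ₁, withDensity_apply _ ht, ← lintegral_finsetSum _ fun j _ => hf j,
      ← lintegral_add_right _ hsm]
    simp_rw [tsub_add_cancel_of_le (hf1 _)]
    simp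
  have hρ₁u : ρ₁ Set.univ = η := by
    have := hρ₁s Set.univ MeasurableSet.univ
    simp only [Measure.restrict_univ, measure_univ] at this
    exact ENNReal.eq_sub_of_add_eq hmtop this
  have hρ₂s : ∀ t, MeasurableSet t → ρ₂ t + ∑ j ∈ s, m j * Set.indicator t 1 (x j) =
      (∑ j ∈ s, p j • Measure.dirac (x j)) t := by
    intro t ht
    simp only [hρ₂, Measure.finsetSum_apply, Measure.smul_apply, smul_eq_mul,
      Measure.dirac_apply' _ ht]
    rw [← Finset.sum_add_distrib]
    refine Finset.sum_congr rfl fun j hj => ?_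
    rw [← add_mul, tsub_add_cancel_of_le (hfp j hj)]
  have hρ₂u : ρ₂ Set.univ = η := by
    have := hρ₂s Set.univ MeasurableSet.univ
    simp only [Measure.finsetSum_apply, Measure.smul_apply, smul_eq_mul, measure_univ, mul_one,
      hp, Set.indicator_univ, Pi.one_apply] at this
    exact ENNReal.eq_sub_of_add_eq hmtop this
  have : IsFiniteMeasure ρ₁ := ⟨by rw [hρ₁u]; exact hηtop.lt_top⟩
  have : IsFiniteMeasure ρ₂ := ⟨by rw [hρ₂u]; exact hηtop.lt_top⟩
  -- For `η = 0` the inverse is `∞`, but then `r = 0` and `∞ * 0 = 0`, so a complete partial plan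
  -- needs no separate treatment.
  have hcancel : ∀ r : ℝ≥0∞, r ≤ η → η⁻¹ * (r * η) = r := by
    intro r hr
    rcases eq_or_ne η 0 with h0 | h0
    · have : r = 0 := le_antisymm (h0 ▸ hr) bot_le
      simp [this]
    · rw [mul_comm r, ← mul_assoc, ENNReal.inv_mul_cancel h0 hηtop, one_mul]
  set γ : Measure (I × I) := ∑ j ∈ s, (ϑ.withDensity (f j)).map (fun y => (y, x j)) +
    η⁻¹ • ρ₁.prod ρ₂ with hγ
  have hmap : ∀ j, Measurable fun y : I => (y, x j) := fun j => by fun_prop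
  have hγ1 : γ.map Prod.fst = ϑ := by
    ext t ht
    rw [Measure.map_apply measurable_fst ht, hγ, ← hρ₁s t ht, add_comm]
    simp only [Measure.add_apply, Measure.finsetSum_apply, Measure.smul_apply, smul_eq_mul]
    congr 1
    · have : (Prod.fst ⁻¹' t : Set (I × I)) = t ×ˢ Set.univ := by ext; simp
      rw [this, Measure.prod_prod, hρ₂u]
      exact hcancel _ (hρ₁u ▸ measure_mono (Set.subset_univ _))
    · refine Finset.sum_congr rfl fun j _ => ?_
      rw [Measure.map_apply (hmap j) (measurable_fst ht)]
      exact withDensity_apply _ ht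
  have hγ2 : γ.map Prod.snd = ∑ j ∈ s, p j • Measure.dirac (x j) := by
    ext t ht
    rw [Measure.map_apply measurable_snd ht, hγ, ← hρ₂s t ht, add_comm]
    simp only [Measure.add_apply, Measure.finsetSum_apply, Measure.smul_apply, smul_eq_mul]
    congr 1
    · have : (Prod.snd ⁻¹' t : Set (I × I)) = Set.univ ×ˢ t := by ext; simp
      rw [this, Measure.prod_prod, hρ₁u, mul_comm η]
      exact hcancel _ (hρ₂u ▸ measure_mono (Set.subset_univ _))
    · refine Finset.sum_congr rfl fun j _ => ?_
      rw [Measure.map_apply (hmap j) (measurable_snd ht)]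
      by_cases hx : x j ∈ t
      · have : (fun y : I => (y, x j)) ⁻¹' (Prod.snd ⁻¹' t) = Set.univ := by ext; simp [hx]
        rw [this, withDensity_apply _ MeasurableSet.univ]
        simp [hx, hm]
      · have : (fun y : I => (y, x j)) ⁻¹' (Prod.snd ⁻¹' t) = ∅ := by ext; simp [hx]
        rw [this]
        simp [hx]
  refine (iInf₂_le γ ⟨hγ1, hγ2⟩).trans ?_
  have hed : Measurable fun z : I × I => edist z.1 z.2 := measurable_edist
  rw [hγ, lintegral_add_measure, lintegral_finsetSum_measure, lintegral_smul_measure]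
  refine add_le_add ?_ ?_
  · rw [lintegral_finsetSum s (f := fun j y => f j y * edist y (x j))
      fun j _ => (hf j).mul (by fun_prop)]
    refine le_of_eq (Finset.sum_congr rfl fun j _ => ?_)
    rw [lintegral_map hed (hmap j), lintegral_withDensity_eq_lintegral_mul _ (hf j) (by fun_prop)]
    rfl
  · have hle : ∀ z : I × I, edist z.1 z.2 ≤ 1 := by
      intro z
      rw [edist_dist, Subtype.dist_eq, Real.dist_eq]
      refine ENNReal.ofReal_le_one.2 (abs_le.2 ⟨?_, ?_⟩)
      · linarith [z.1.2.1, z.2.2.2]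
      · linarith [z.1.2.2, z.2.2.1]
    calc η⁻¹ • ∫⁻ z, edist z.1 z.2 ∂ρ₁.prod ρ₂ ≤ η⁻¹ • ∫⁻ _, 1 ∂ρ₁.prod ρ₂ := by
          gcongr
          exact hle _
      _ = η⁻¹ * (η * η) := by
          rw [lintegral_one, ← Set.univ_prod_univ, Measure.prod_prod, hρ₁u, hρ₂u, smul_eq_mul]
      _ = η := hcancel _ le_rfl

/-- A mixture that is smoothed by nonnegative kernels `D j` with nearly constant sum is close to
the mixture `∑ j, (w j / W) δ_{x j}` when `w j` is nearly proportional to `∫ D j`. -/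
theorem tran_le_of_kernel (ϑ : Measure I) [IsProbabilityMeasure ϑ] (s : Finset ℕ)
    (D : ℕ → I → ℝ) (hD : ∀ j, Continuous (D j)) (hD0 : ∀ j y, 0 ≤ D j y) (x : ℕ → I) (w : ℕ → ℝ)
    (hw : ∀ j ∈ s, 0 ≤ w j) (hW : 0 < ∑ j ∈ s, w j) {S κ Λ Δ b : ℝ} (hS : 0 < S)
    (hΛ : 0 < Λ) (hDS : ∀ y, ∑ j ∈ s, D j y ≤ S) (hDκ : ∀ y, S - κ ≤ ∑ j ∈ s, D j y)
    (hΔ : ∑ j ∈ s, |w j / Λ - ∫ y, D j y ∂ϑ| ≤ Δ)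
    (hb : ∀ y, ∑ j ∈ s, D j y * dist y (x j) ≤ b) :
    CoinProblem.tran ϑ (∑ j ∈ s, ENNReal.ofReal (w j / ∑ i ∈ s, w i) • Measure.dirac (x j)) ≤
      ENNReal.ofReal ((b + κ + 2 * Δ) / S) := by
  set W := ∑ j ∈ s, w j with hWdef
  set g : ℕ → ℝ := fun j => ∫ y, D j y ∂ϑ with hg
  have hint : ∀ j, Integrable (D j) ϑ := fun j =>
    (hD j).integrable_of_hasCompactSupport (HasCompactSupport.of_compactSpace _)
  have hg0 : ∀ j, 0 ≤ g j := fun j => integral_nonneg (hD0 j)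
  -- The scaling is the largest one bounded by `1 / S` that puts at most `w j / W` on the `j`-th
  -- point. If `g j = 0`, division by zero gives `c j = 0`, which is harmless.
  set c : ℕ → ℝ := fun j => min (1 / S) (w j / W / g j) with hc
  have hc0 : ∀ j ∈ s, 0 ≤ c j := fun j hj =>
    le_min (by positivity) (div_nonneg (div_nonneg (hw j hj) hW.le) (hg0 j))
  have hcg : ∀ j ∈ s, c j * g j = min (g j / S) (w j / W) := by
    intro j hj
    rcases (hg0 j).eq_or_lt with h | h
    · rw [← h, mul_zero, zero_div, min_eq_left (div_nonneg (hw j hj) hW.le)]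
    · rw [hc]
      simp only
      rw [min_mul_of_nonneg _ _ h.le, div_mul_cancel₀ _ h.ne', one_div_mul_eq_div]
  have hcS : ∀ j y, c j * D j y ≤ D j y / S := by
    intro j y
    rw [div_eq_mul_one_div, mul_comm (D j y)]
    exact mul_le_mul_of_nonneg_right (min_le_left _ _) (hD0 j y)
  have hlin : ∀ j ∈ s, ∫⁻ y, ENNReal.ofReal (c j * D j y) ∂ϑ = ENNReal.ofReal (c j * g j) := by
    intro j hj
    rw [← ofReal_integral_eq_lintegral_ofReal ((hint j).const_mul _)
      (Filter.Eventually.of_forall fun y => mul_nonneg (hc0 j hj) (hD0 j y)), integral_const_mul]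
  have hp0 : ∀ j ∈ s, 0 ≤ w j / W := fun j hj => div_nonneg (hw j hj) hW.le
  have hp1 : ∑ j ∈ s, w j / W = 1 := by rw [← Finset.sum_div, div_self hW.ne']
  have hmain := tran_sum_dirac_le ϑ s (fun j y => ENNReal.ofReal (c j * D j y))
    (fun j => ENNReal.measurable_ofReal.comp ((hD j).measurable.const_mul _)) x
    (fun j => ENNReal.ofReal (w j / W))
    (by rw [← ENNReal.ofReal_sum_of_nonneg hp0, hp1, ENNReal.ofReal_one])
    (fun y => by
      rw [← ENNReal.ofReal_sum_of_nonneg fun j hj => mul_nonneg (hc0 j hj) (hD0 j y)]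
      refine ENNReal.ofReal_le_one.2 ((Finset.sum_le_sum fun j _ => hcS j y).trans ?_)
      rw [← Finset.sum_div, div_le_one hS]
      exact hDS y)
    (fun j hj => by
      rw [hlin j hj, hcg j hj]
      exact ENNReal.ofReal_le_ofReal (min_le_right _ _))
  refine hmain.trans ?_
  have hcg0 : ∀ j ∈ s, 0 ≤ c j * g j := fun j hj => mul_nonneg (hc0 j hj) (hg0 j)
  rw [Finset.sum_congr rfl hlin, ← ENNReal.ofReal_sum_of_nonneg hcg0, ← ENNReal.ofReal_one,
    ← ENNReal.ofReal_sub _ (Finset.sum_nonneg hcg0)]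
  have hx1 : ∫⁻ y, ∑ j ∈ s, ENNReal.ofReal (c j * D j y) * edist y (x j) ∂ϑ ≤
      ENNReal.ofReal (b / S) := by
    calc _ ≤ ∫⁻ _, ENNReal.ofReal (b / S) ∂ϑ := by
          refine lintegral_mono fun y => ?_
          simp only [edist_dist]
          rw [Finset.sum_congr rfl fun j hj =>
            (ENNReal.ofReal_mul (mul_nonneg (hc0 j hj) (hD0 j y))).symm,
            ← ENNReal.ofReal_sum_of_nonneg fun j hj =>
              mul_nonneg (mul_nonneg (hc0 j hj) (hD0 j y)) dist_nonneg]
          refine ENNReal.ofReal_le_ofReal ?_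
          refine (Finset.sum_le_sum fun j _ =>
            mul_le_mul_of_nonneg_right (hcS j y) dist_nonneg).trans ?_
          simp_rw [div_mul_eq_mul_div]
          rw [← Finset.sum_div]
          gcongr
          exact hb y
      _ = _ := by simp
  have hgsum : ∑ j ∈ s, g j = ∫ y, ∑ j ∈ s, D j y ∂ϑ :=
    (integral_finsetSum _ fun j _ => hint j).symm
  have hsint : Integrable (fun y => ∑ j ∈ s, D j y) ϑ := integrable_finsetSum _ fun j _ => hint j
  have hg1 : ∑ j ∈ s, g j ≤ S := by
    rw [hgsum]
    simpa using integral_mono hsint (integrable_const S) hDS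
  have hg2 : S - κ ≤ ∑ j ∈ s, g j := by
    rw [hgsum]
    simpa using integral_mono (integrable_const (S - κ)) hsint hDκ
  have hWΛ : |W / Λ - ∑ j ∈ s, g j| ≤ Δ := by
    rw [hWdef, Finset.sum_div, ← Finset.sum_sub_distrib]
    exact (Finset.abs_sum_le_sum_abs _ _).trans hΔ
  have hx2 : 1 - ∑ j ∈ s, c j * g j ≤ (κ + 2 * Δ) / S := by
    rw [Finset.sum_congr rfl hcg, ← hp1, ← Finset.sum_sub_distrib]
    -- The missing mass is the positive part of `w j / W - g j / S`; it is split at `w j / (Λ S)`,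
    -- separating the error of normalization from that of estimation.
    have h1 : ∀ j ∈ s, w j / W - min (g j / S) (w j / W) ≤
        |w j / W - w j / Λ / S| + |w j / Λ - g j| / S := by
      intro j hj
      rw [← abs_of_pos hS, ← abs_div, abs_of_pos hS, sub_div]
      refine le_trans ?_ (abs_add_le _ _)
      rw [sub_add_sub_cancel]
      rcases min_cases (g j / S) (w j / W) with h | h
      · rw [h.1]; exact le_abs_self _
      · rw [h.1, sub_self]; exact abs_nonneg _
    refine (Finset.sum_le_sum h1).trans ?_
    rw [Finset.sum_add_distrib, ← Finset.sum_div]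
    -- Both families are proportional to `w`, so the sum is the difference of their totals. Only
    -- this comparison involves `Λ`, so it need not be known to normalize the weights.
    have h2 : ∑ j ∈ s, |w j / W - w j / Λ / S| = |S - W / Λ| / S := by
      have : ∀ j ∈ s, |w j / W - w j / Λ / S| = w j / W * (|S - W / Λ| / S) := by
        intro j hj
        nth_rewrite 3 [← abs_of_pos hS]
        nth_rewrite 2 [← abs_of_nonneg (hp0 j hj)]
        rw [← abs_div, ← abs_mul]
        congr 1
        field_simp
      rw [Finset.sum_congr rfl this, ← Finset.sum_mul, hp1, one_mul]
    rw [h2, ← add_div]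
    refine div_le_div_of_nonneg_right ?_ hS.le
    have h3 : |S - W / Λ| ≤ κ + Δ := by
      rw [abs_le] at hWΛ ⊢
      constructor <;> linarith [hWΛ.1, hWΛ.2]
    linarith
  refine (add_le_add hx1 (ENNReal.ofReal_le_ofReal hx2)).trans ?_
  have hΔ0 : 0 ≤ Δ := (abs_nonneg _).trans hWΛ
  have hκ0 : 0 ≤ κ := by linarith
  have hb0 : 0 ≤ b :=
    le_trans (Finset.sum_nonneg fun j _ => mul_nonneg (hD0 j 0) dist_nonneg) (hb 0)
  rw [← ENNReal.ofReal_add (by positivity) (by positivity), ← add_div, add_assoc]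

/-! ### Majorization of polynomials -/

section Majorization

open Polynomial

/-- Every coefficient of `A` is at most the corresponding coefficient of `G` in absolute value. -/
def Majorizes (G A : ℤ[X]) : Prop := ∀ i, |A.coeff i| ≤ G.coeff i

namespace Majorizes

variable {A B G H : ℤ[X]}

theorem nonneg (h : Majorizes G A) (i : ℕ) : 0 ≤ G.coeff i := (abs_nonneg _).trans (h i)

theorem refl_of_nonneg (h : ∀ i, 0 ≤ G.coeff i) : Majorizes G G := fun i => (abs_of_nonneg (h i)).le

theorem add (hA : Majorizes G A) (hB : Majorizes H B) : Majorizes (G + H) (A + B) := fun i => by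
  rw [coeff_add, coeff_add]
  exact (abs_add_le _ _).trans (add_le_add (hA i) (hB i))

theorem neg (hA : Majorizes G A) : Majorizes G (-A) := fun i => by
  rw [coeff_neg, abs_neg]; exact hA i

theorem sub (hA : Majorizes G A) (hB : Majorizes H B) : Majorizes (G + H) (A - B) := by
  rw [sub_eq_add_neg]; exact hA.add hB.neg

theorem mul (hA : Majorizes G A) (hB : Majorizes H B) : Majorizes (G * H) (A * B) := fun i => by
  rw [coeff_mul, coeff_mul]
  refine (Finset.abs_sum_le_sum_abs _ _).trans (Finset.sum_le_sum fun p _ => ?_)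
  rw [abs_mul]
  exact mul_le_mul (hA _) (hB _) (abs_nonneg _) (hA.nonneg _)

theorem one : Majorizes 1 1 := fun i => by
  rw [coeff_one]; split_ifs <;> simp

theorem pow (hA : Majorizes G A) (n : ℕ) : Majorizes (G ^ n) (A ^ n) := by
  induction n with
  | zero => simpa using one
  | succ n ih => rw [pow_succ, pow_succ]; exact ih.mul hA

theorem C {a b : ℤ} (h : |a| ≤ b) : Majorizes (C b) (C a) := fun i => by
  rw [coeff_C, coeff_C]; split_ifs
  · exact h
  · simp

theorem X : Majorizes X X := fun i => by
  rw [coeff_X]; split_ifs <;> simp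

theorem trans (hA : Majorizes G A) (h : Majorizes H G) : Majorizes H A := fun i =>
  (hA i).trans ((le_abs_self _).trans (h i))

theorem abs_eval_le (hA : Majorizes G A) {z : ℤ} (hz : 0 ≤ z) : |A.eval z| ≤ G.eval z := by
  have hA' : A.natDegree < max A.natDegree G.natDegree + 1 := by omega
  have hG' : G.natDegree < max A.natDegree G.natDegree + 1 := by omega
  rw [eval_eq_sum_range' hA', eval_eq_sum_range' hG']
  refine (Finset.abs_sum_le_sum_abs _ _).trans (Finset.sum_le_sum fun i _ => ?_)
  rw [abs_mul, abs_of_nonneg (pow_nonneg hz i)]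
  exact mul_le_mul_of_nonneg_right (hA i) (pow_nonneg hz i)

theorem abs_coeff_le (hA : Majorizes G A) (k : ℕ) : |A.coeff k| ≤ G.eval 1 := by
  refine (hA k).trans ?_
  have hG' : G.natDegree < max k G.natDegree + 1 := by omega
  rw [eval_eq_sum_range' hG']
  simp only [one_pow, mul_one]
  exact Finset.single_le_sum (f := fun i => G.coeff i) (fun i _ => hA.nonneg i)
    (Finset.mem_range.2 (by omega))

end Majorizes

theorem coeff_C_mul_one_add_X_pow (a : ℤ) (d i : ℕ) :
    (C a * (1 + X : ℤ[X]) ^ d).coeff i = a * (d.choose i : ℤ) := by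
  rw [coeff_C_mul, coeff_one_add_X_pow]

theorem majorizes_C_mul_one_add_X_pow {a b : ℤ} (h0 : 0 ≤ a) (h : a ≤ b) (d : ℕ) :
    Majorizes (C b * (1 + X) ^ d) (C a * (1 + X) ^ d) := by
  intro i
  rw [coeff_C_mul_one_add_X_pow, coeff_C_mul_one_add_X_pow, abs_mul, abs_of_nonneg h0, Nat.abs_cast]
  gcongr

theorem majorizes_one_add_X : Majorizes (1 + X) (1 + X) := Majorizes.one.add .X

/-- Signs in the recurrence are discarded. One step multiplies the constant by at most `8 c`,
because `(2 + 4) * 8 + 1 = 49 ≤ 8²`; the start uses `3 + 4 ≤ 8`. -/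
theorem majorizes_chebW {u v : ℤ[X]} {c : ℤ} (hc : 0 ≤ c)
    (hu : Majorizes (C c * (1 + X) ^ 2) u) (hv : Majorizes (C (4 * c) * (1 + X) ^ 2) v) (n : ℕ) :
    Majorizes (C ((8 * c) ^ n) * (1 + X) ^ (2 * n)) (chebW u v n) := by
  induction n using Nat.twoStepInduction with
  | zero => simpa [chebW] using Majorizes.one
  | one =>
    have h := ((Majorizes.C (a := 3) (b := 3) (by norm_num)).mul hu).sub hv
    have e : C 3 * (C c * (1 + X) ^ 2) + C (4 * c) * (1 + X) ^ 2 =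
        (C (7 * c) * (1 + X) ^ 2 : ℤ[X]) := by
      simp only [C_mul, map_ofNat]; ring
    rw [e] at h
    have h2 := h.trans (majorizes_C_mul_one_add_X_pow (b := 8 * c) (by linarith) (by linarith) 2)
    simpa [chebW] using h2
  | more n h1 h2 =>
    have h := ((((Majorizes.C (a := 2) (b := 2) (by norm_num)).mul hu).sub hv).mul h2).sub
      ((hu.pow 2).mul h1)
    have e : (C 2 * (C c * (1 + X) ^ 2) + C (4 * c) * (1 + X) ^ 2) *
          (C ((8 * c) ^ (n + 1)) * (1 + X) ^ (2 * (n + 1))) +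
        (C c * (1 + X) ^ 2) ^ 2 * (C ((8 * c) ^ n) * (1 + X) ^ (2 * n)) =
        (C (49 * c ^ 2 * (8 * c) ^ n) * (1 + X) ^ (2 * (n + 2)) : ℤ[X]) := by
      simp only [C_mul, C_pow, map_ofNat]; ring
    rw [e] at h
    have hp : 0 ≤ c ^ 2 * (8 * c) ^ n := by positivity
    have h2 := h.trans (majorizes_C_mul_one_add_X_pow (b := (8 * c) ^ (n + 2))
      (by positivity) (by rw [pow_add]; nlinarith) (2 * (n + 2)))
    simpa [chebW] using h2

/-! ### The kernels as integer polynomials in the odds `p / (1 - p)` -/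

/-- `M² (1 + X)²`. -/
noncomputable def gridU (M : ℕ) : ℤ[X] := C ((M : ℤ) ^ 2) * (1 + X) ^ 2

/-- The square of the linear form that vanishes at the `j`-th grid point. -/
noncomputable def gridV (M j : ℕ) : ℤ[X] := (C (2 * (M : ℤ) - j) * X + C ((M : ℤ) - j)) ^ 2

/-- The coefficients of the kernel for the `j`-th grid point in the basis `pⁱ (1 - p)ᴷ⁻ⁱ`. -/
noncomputable def gridA (K M j : ℕ) : ℤ[X] :=
  chebW (gridU M) (gridV M j) (K / 8) ^ 4 * (1 + X) ^ (K - 8 * (K / 8))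

theorem majorizes_gridU (M : ℕ) : Majorizes (C ((M : ℤ) ^ 2) * (1 + X) ^ 2) (gridU M) :=
  majorizes_C_mul_one_add_X_pow (by positivity) le_rfl 2

theorem majorizes_gridV {M j : ℕ} (hj : j ≤ 3 * M) :
    Majorizes (C (4 * (M : ℤ) ^ 2) * (1 + X) ^ 2) (gridV M j) := by
  have h := ((Majorizes.C (a := 2 * (M : ℤ) - j) (b := 2 * M)
    (by rw [abs_le]; constructor <;> linarith [(by exact_mod_cast hj : (j : ℤ) ≤ 3 * M)])).mul
    Majorizes.X).add (Majorizes.C (a := (M : ℤ) - j) (b := 2 * M)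
    (by rw [abs_le]; constructor <;> linarith [(by exact_mod_cast hj : (j : ℤ) ≤ 3 * M)]))
  have h2 := h.pow 2
  have e : (C (2 * (M : ℤ)) * X + C (2 * (M : ℤ))) ^ 2 =
      (C (4 * (M : ℤ) ^ 2) * (1 + X) ^ 2 : ℤ[X]) := by
    simp only [C_mul, C_pow, map_ofNat]; ring
  rw [e] at h2
  exact h2

theorem majorizes_gridA {K M j : ℕ} (hj : j ≤ 3 * M) :
    Majorizes (C ((8 * (M : ℤ) ^ 2) ^ (4 * (K / 8))) * (1 + X) ^ K) (gridA K M j) := by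
  have h := ((majorizes_chebW (by positivity) (majorizes_gridU M) (majorizes_gridV hj)
    (K / 8)).pow 4).mul (majorizes_one_add_X.pow (K - 8 * (K / 8)))
  have e : (C ((8 * (M : ℤ) ^ 2) ^ (K / 8)) * (1 + X) ^ (2 * (K / 8))) ^ 4 *
      (1 + X) ^ (K - 8 * (K / 8)) =
      (C ((8 * (M : ℤ) ^ 2) ^ (4 * (K / 8))) * (1 + X) ^ K : ℤ[X]) := by
    rw [mul_pow, ← C_pow, ← pow_mul, ← pow_mul, mul_assoc, ← pow_add, mul_comm (K / 8) 4]
    congr 2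
    omega
  rw [e] at h
  exact h

theorem abs_coeff_gridA_le {K M j : ℕ} (hj : j ≤ 3 * M) (i : ℕ) :
    |(gridA K M j).coeff i| ≤ (8 * (M : ℤ) ^ 2) ^ (4 * (K / 8)) * (K.choose i : ℤ) := by
  rw [← coeff_C_mul_one_add_X_pow]
  exact majorizes_gridA hj i

/-- The majorant is a multiple of `(1 + X)ᴷ`, whose coefficients vanish beyond `K`. -/
theorem natDegree_gridA_lt {K M j : ℕ} (hj : j ≤ 3 * M) : (gridA K M j).natDegree < K + 1 := by
  refine Nat.lt_succ_of_le (natDegree_le_iff_coeff_eq_zero.2 fun i hi => ?_)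
  have := abs_coeff_gridA_le (K := K) hj i
  rw [Nat.choose_eq_zero_of_lt hi] at this
  simpa using this

/-- With `q = 1 - y`, the left side is `qᴷ` times the polynomial at `X = y / q`. There `1 + X = 1 /
q`, and `gridV / gridU` equals `4 t²` for `t = gridT M j y`; homogeneity of `chebW` extracts the
powers of `M / q`. The factor `(1 + X)^(K - 8 n)` raises the degree to exactly `K`. -/
theorem sum_gridA_eq_of_ne {K M j : ℕ} (hM : 0 < M) (hj : j ≤ 3 * M) {y : ℝ} (hy : y ≠ 1) :
    ∑ i ∈ Finset.range (K + 1), ((gridA K M j).coeff i : ℝ) * (y ^ i * (1 - y) ^ (K - i)) =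
      (M : ℝ) ^ (8 * (K / 8)) * gridD (K / 8) M j y := by
  have hq : 1 - y ≠ 0 := sub_ne_zero.2 hy.symm
  have hM' : (M : ℝ) ≠ 0 := by exact_mod_cast hM.ne'
  set q := 1 - y with hqd
  have e1 : ∑ i ∈ Finset.range (K + 1), ((gridA K M j).coeff i : ℝ) * (y ^ i * q ^ (K - i)) =
      q ^ K * eval₂ (Int.castRingHom ℝ) (y / q) (gridA K M j) := by
    rw [eval₂_eq_sum_range' _ (natDegree_gridA_lt hj), Finset.mul_sum]
    refine Finset.sum_congr rfl fun i hi => ?_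
    have hi' : i ≤ K := Nat.lt_succ_iff.1 (Finset.mem_range.1 hi)
    rw [eq_intCast, div_pow, ← Nat.sub_add_cancel hi', pow_add, Nat.add_sub_cancel]
    field_simp
  have e2 : eval₂ (Int.castRingHom ℝ) (y / q) (gridA K M j) =
      (((M : ℝ) ^ 2 / q ^ 2) ^ (K / 8) * dirW (K / 8) (gridT M j y)) ^ 4 *
        (1 / q) ^ (K - 8 * (K / 8)) := by
    have hs : 1 + y / q = 1 / q := by field_simp; rw [hqd]; ring
    have eu : eval₂RingHom (Int.castRingHom ℝ) (y / q) (gridU M) = (M : ℝ) ^ 2 / q ^ 2 * 1 := by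
      simp only [gridU, coe_eval₂RingHom, eval₂_mul, eval₂_pow, eval₂_add, eval₂_one, eval₂_X,
        eval₂_C, hs]
      simp
      field_simp
    have ev : eval₂RingHom (Int.castRingHom ℝ) (y / q) (gridV M j) =
        (M : ℝ) ^ 2 / q ^ 2 * (4 * gridT M j y ^ 2) := by
      simp only [gridV, gridT, coe_eval₂RingHom, eval₂_mul, eval₂_pow, eval₂_add, eval₂_X,
        eval₂_C]
      simp
      field_simp
      rw [hqd]
      ring
    rw [dirW, ← chebW_smul, ← eu, ← ev, ← map_chebW, ← coe_eval₂RingHom, gridA, map_mul, map_pow,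
      map_pow, map_add, map_one]
    rw [coe_eval₂RingHom, eval₂_X, hs]
  rw [e1, e2, gridD, mul_pow, ← pow_mul]
  have hK : K = K - 8 * (K / 8) + 8 * (K / 8) := by omega
  generalize K - 8 * (K / 8) = r at hK ⊢
  generalize K / 8 = n at hK ⊢
  subst hK
  rw [div_pow, ← pow_mul, ← pow_mul, one_div, inv_pow, pow_add]
  have e3 : 2 * (n * 4) = 8 * n := by ring
  rw [e3]
  field_simp

/-- The kernel in the Bernstein basis. -/
theorem sum_gridA_eq {K M j : ℕ} (hM : 0 < M) (hj : j ≤ 3 * M) (y : ℝ) :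
    ∑ i ∈ Finset.range (K + 1), ((gridA K M j).coeff i : ℝ) * (y ^ i * (1 - y) ^ (K - i)) =
      (M : ℝ) ^ (8 * (K / 8)) * gridD (K / 8) M j y := by
  -- The odds are infinite at `y = 1`; that point is recovered by continuity.
  have h := Continuous.ext_on (dense_compl_singleton (1 : ℝ))
    (f := fun y : ℝ => ∑ i ∈ Finset.range (K + 1),
      ((gridA K M j).coeff i : ℝ) * (y ^ i * (1 - y) ^ (K - i)))
    (g := fun y : ℝ => (M : ℝ) ^ (8 * (K / 8)) * gridD (K / 8) M j y)
    (by fun_prop) (continuous_const.mul (continuous_gridD _ M j))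
    (fun y hy => sum_gridA_eq_of_ne hM hj hy)
  exact congrFun h y

/-! ### Kronecker substitution -/

/-- The quotient `(2 y + m) / (2 m)` rounds `y / m` to the nearest integer, as required when the
error `e` may be negative. -/
theorem ediv_round_eq {x m e : ℤ} (h : 2 * |e| < m) : (2 * (x * m + e) + m) / (2 * m) = x := by
  have h1 := abs_le.1 (le_refl |e|)
  have hm : 0 < m := by linarith [abs_nonneg e]
  rw [Int.ediv_eq_iff_of_pos (by linarith)]
  constructor <;> linarith

/-- Reads off the coefficient of `Zᵏ` in the value `y` at a large `Z` of a polynomial. -/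
def kronDigit (Z Zk y : ℤ) : ℤ :=
  (2 * y + Zk) / (2 * Zk) - Z * ((2 * ((2 * y + Zk) / (2 * Zk)) + Z) / (2 * Z))

/-- The value is cut below `Zᵏ`: `Q` carries the higher coefficients, and the geometric series
bounds the remainder `e`, in a form free of division. -/
theorem exists_eval_eq_add_pow_mul (P : ℤ[X]) {Z B : ℤ} (hZ : 1 ≤ Z) (hP : ∀ i, |P.coeff i| ≤ B)
    (k : ℕ) : ∃ (Q : ℤ[X]) (e : ℤ), (∀ i, Q.coeff i = P.coeff (i + k)) ∧
      P.eval Z = Q.eval Z * Z ^ k + e ∧ |e| * (Z - 1) ≤ B * (Z ^ k - 1) := by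
  induction k with
  | zero => exact ⟨P, 0, fun i => rfl, by simp, by simp⟩
  | succ k ih =>
    obtain ⟨Q, e, h1, h2, h3⟩ := ih
    refine ⟨Q.divX, Q.coeff 0 * Z ^ k + e, fun i => ?_, ?_, ?_⟩
    · rw [coeff_divX, h1]
      congr 1
      ring
    · rw [h2]
      nth_rewrite 1 [← divX_mul_X_add Q]
      simp only [eval_add, eval_mul, eval_X, eval_C]
      ring
    · have hc : |Q.coeff 0| ≤ B := by rw [h1]; exact hP _
      have hZk : 0 ≤ Z ^ k := by positivity
      calc |Q.coeff 0 * Z ^ k + e| * (Z - 1) ≤ (|Q.coeff 0| * Z ^ k + |e|) * (Z - 1) := by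
            refine mul_le_mul_of_nonneg_right ?_ (by linarith)
            refine (abs_add_le _ _).trans ?_
            rw [abs_mul, abs_of_nonneg hZk]
        _ = |Q.coeff 0| * (Z ^ k * (Z - 1)) + |e| * (Z - 1) := by ring
        _ ≤ B * (Z ^ k * (Z - 1)) + B * (Z ^ k - 1) := by
            gcongr
        _ = _ := by ring

/-- The first rounding discards all lower coefficients and leaves `Q.eval Z`. This differs from a
multiple of `Z` by the wanted coefficient, which is less than `Z / 2` in absolute value, so a second
rounding isolates it with its sign. -/
theorem kronDigit_eq (P : ℤ[X]) {Z B : ℤ} (hB : 4 * B + 4 ≤ Z) (hP : ∀ i, |P.coeff i| ≤ B)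
    (k : ℕ) : kronDigit Z (Z ^ k) (P.eval Z) = P.coeff k := by
  have hB0 : 0 ≤ B := (abs_nonneg _).trans (hP 0)
  obtain ⟨Q, e, h1, h2, h3⟩ := exists_eval_eq_add_pow_mul P (by linarith) hP k
  have hZk : 1 ≤ Z ^ k := one_le_pow₀ (by linarith)
  have he : 2 * |e| < Z ^ k := by
    have h4 : 2 * |e| * (Z - 1) ≤ (Z ^ k - 1) * (Z - 1) := by nlinarith
    have := le_of_mul_le_mul_right h4 (by linarith)
    linarith
  have hq : (2 * P.eval Z + Z ^ k) / (2 * Z ^ k) = Q.eval Z := by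
    rw [h2]; exact ediv_round_eq he
  have hQ : Q.eval Z = Q.divX.eval Z * Z + P.coeff k := by
    nth_rewrite 1 [← divX_mul_X_add Q]
    simp only [eval_add, eval_mul, eval_X, eval_C]
    rw [h1, zero_add]
  have hc : 2 * |P.coeff k| < Z := by linarith [hP k]
  rw [kronDigit, hq, hQ, ediv_round_eq hc]
  ring

/-! ### The integer weights as digits -/

/-- The number of grid intervals of length one that the algorithm uses. -/
def gridM (K : ℕ) : ℕ := (K + 1) ^ 4

/-- `(K+1)! / (K choose i)`. -/
def binomWeight (K i : ℕ) : ℕ := (K + 1) * (i.factorial * (K - i).factorial)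

/-- The integer at which polynomials are evaluated by the algorithm. -/
def kronZ (K m : ℕ) : ℕ := 4 * (16 * gridM K ^ 2) ^ (K + 1) * (K + 1).factorial * (m + 1)

theorem gridM_pos (K : ℕ) : 0 < gridM K := by unfold gridM; positivity

theorem binomWeight_mul_choose {K i : ℕ} (hi : i ≤ K) :
    binomWeight K i * K.choose i = (K + 1).factorial := by
  rw [binomWeight, Nat.factorial_succ, ← Nat.choose_mul_factorial_mul_factorial hi]; ring

theorem binomWeight_le (K i : ℕ) (hi : i ≤ K) : binomWeight K i ≤ (K + 1).factorial := by
  rw [← binomWeight_mul_choose hi]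
  exact Nat.le_mul_of_pos_right _ (Nat.choose_pos hi)

theorem four_le_kronZ (K m : ℕ) : 4 ≤ kronZ K m := by
  have h1 : 0 < (16 * gridM K ^ 2) ^ (K + 1) := by have := gridM_pos K; positivity
  have h2 := (K + 1).factorial_pos
  unfold kronZ
  have : 0 < (16 * gridM K ^ 2) ^ (K + 1) * (K + 1).factorial * (m + 1) := by positivity
  nlinarith

/-- The polynomial with coefficients the weighted counts. -/
noncomputable def countPoly (K k : ℕ) (h : ℕ → ℕ) : ℤ[X] :=
  ∑ i ∈ Finset.range k, C ((binomWeight K i * h i : ℕ) : ℤ) * X ^ (k - i)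

/-- This is the Horner step of the program. Adding before multiplying by `X` explains the exponents
`k - i` and why the wanted coefficient sits at `K + 1` instead of `K`. -/
theorem countPoly_succ (K k : ℕ) (h : ℕ → ℕ) :
    countPoly K (k + 1) h = (countPoly K k h + C ((binomWeight K k * h k : ℕ) : ℤ)) * X := by
  unfold countPoly
  rw [Finset.sum_range_succ, add_mul, Finset.sum_mul]
  congr 1
  · refine Finset.sum_congr rfl fun i hi => ?_
    rw [Nat.succ_sub (Finset.mem_range.1 hi).le, pow_succ, mul_assoc]
  · simp

theorem coeff_countPoly_nonneg (K k : ℕ) (h : ℕ → ℕ) (i : ℕ) : 0 ≤ (countPoly K k h).coeff i := by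
  unfold countPoly
  rw [finsetSum_coeff]
  refine Finset.sum_nonneg fun j _ => ?_
  rw [coeff_C_mul, coeff_X_pow]
  split_ifs
  · positivity
  · simp

theorem eval_one_countPoly_le (K : ℕ) (h : ℕ → ℕ) :
    (countPoly K (K + 1) h).eval 1 ≤
      ((K + 1).factorial * ∑ i ∈ Finset.range (K + 1), h i : ℕ) := by
  unfold countPoly
  rw [eval_finsetSum, Finset.mul_sum, Nat.cast_sum]
  refine Finset.sum_le_sum fun i hi => ?_
  simp only [eval_mul, eval_C, eval_pow, eval_X, one_pow, mul_one]
  exact_mod_cast Nat.mul_le_mul_right _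
    (binomWeight_le K i (Nat.lt_succ_iff.1 (Finset.mem_range.1 hi)))

/-- The counts enter in reversed order, which turns the scalar product of coefficients and counts
into a single coefficient of a product. -/
theorem coeff_mul_countPoly (A : ℤ[X]) (K : ℕ) (h : ℕ → ℕ) :
    (A * countPoly K (K + 1) h).coeff (K + 1) =
      ∑ i ∈ Finset.range (K + 1), A.coeff i * ((binomWeight K i * h i : ℕ) : ℤ) := by
  unfold countPoly
  rw [Finset.mul_sum, finsetSum_coeff]
  refine Finset.sum_congr rfl fun i hi => ?_
  have hi' := (Finset.mem_range.1 hi).le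
  rw [← mul_assoc, coeff_mul_X_pow', if_pos (Nat.sub_le _ _), coeff_mul_C, Nat.sub_sub_self hi']

/-- The unnormalized weight of the `j`-th grid point, before clipping. -/
noncomputable def rawWeight (K : ℕ) (h : ℕ → ℕ) (j : ℕ) : ℤ :=
  ∑ i ∈ Finset.range (K + 1),
    (gridA K (gridM K) j).coeff i * ((binomWeight K i * h i : ℕ) : ℤ)

/-- The choice of `kronZ` is dictated here: the value at `1` of a majorant of the product bounds all
its coefficients, and this is the condition of `kronDigit_eq`. The `4` and the `m + 1` in `kronZ`
absorb the summand `4`. -/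
theorem four_mul_coeff_bound (K : ℕ) (h : ℕ → ℕ) :
    4 * (C ((8 * (gridM K : ℤ) ^ 2) ^ (4 * (K / 8))) * (1 + X) ^ K *
      countPoly K (K + 1) h).eval 1 + 4 ≤ (kronZ K (∑ i ∈ Finset.range (K + 1), h i) : ℤ) := by
  have hM : (1 : ℤ) ≤ gridM K := by exact_mod_cast gridM_pos K
  simp only [eval_mul, eval_C, eval_pow, eval_add, eval_one, eval_X]
  have h1 := eval_one_countPoly_le K h
  set m := ∑ i ∈ Finset.range (K + 1), h i
  have h8 : (1 : ℤ) ≤ 8 * (gridM K : ℤ) ^ 2 := by nlinarith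
  have h2 : (8 * (gridM K : ℤ) ^ 2) ^ (4 * (K / 8)) * (1 + 1) ^ K ≤
      (16 * (gridM K : ℤ) ^ 2) ^ (K + 1) := by
    calc _ ≤ (8 * (gridM K : ℤ) ^ 2) ^ (K + 1) * (1 + 1) ^ (K + 1) := by
          gcongr
          · omega
          · norm_num
          · omega
      _ = _ := by rw [← mul_pow]; ring
  have h3 : (1 : ℤ) ≤ (16 * (gridM K : ℤ) ^ 2) ^ (K + 1) := one_le_pow₀ (by nlinarith)
  have h4 : (1 : ℤ) ≤ (K + 1).factorial := by exact_mod_cast (K + 1).factorial_pos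
  have h5 : (1 : ℤ) ≤ (16 * (gridM K : ℤ) ^ 2) ^ (K + 1) * (K + 1).factorial := by nlinarith
  have h6 : (8 * (gridM K : ℤ) ^ 2) ^ (4 * (K / 8)) * (1 + 1) ^ K *
      (countPoly K (K + 1) h).eval 1 ≤
      (16 * (gridM K : ℤ) ^ 2) ^ (K + 1) * ((K + 1).factorial * m : ℕ) := by
    calc _ ≤ (8 * (gridM K : ℤ) ^ 2) ^ (4 * (K / 8)) * (1 + 1) ^ K *
          ((K + 1).factorial * m : ℕ) := by
          gcongr
      _ ≤ _ := by gcongr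
  unfold kronZ
  push_cast at h6 ⊢
  nlinarith

theorem kronDigit_gridA {K j : ℕ} (hj : j ≤ 3 * gridM K) (h : ℕ → ℕ) :
    kronDigit (kronZ K (∑ i ∈ Finset.range (K + 1), h i))
      ((kronZ K (∑ i ∈ Finset.range (K + 1), h i) : ℤ) ^ (K + 1))
      ((gridA K (gridM K) j * countPoly K (K + 1) h).eval
        (kronZ K (∑ i ∈ Finset.range (K + 1), h i) : ℤ)) = rawWeight K h j := by
  have hmaj := (majorizes_gridA (K := K) hj).mul
    (Majorizes.refl_of_nonneg (coeff_countPoly_nonneg K (K + 1) h))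
  rw [kronDigit_eq _ (four_mul_coeff_bound K h) (fun i => hmaj.abs_coeff_le i),
    coeff_mul_countPoly, rawWeight]

theorem abs_rawWeight_le {K j : ℕ} (hj : j ≤ 3 * gridM K) (h : ℕ → ℕ) :
    |rawWeight K h j| ≤ kronZ K (∑ i ∈ Finset.range (K + 1), h i) := by
  have hmaj := (majorizes_gridA (K := K) hj).mul
    (Majorizes.refl_of_nonneg (coeff_countPoly_nonneg K (K + 1) h))
  have h1 := hmaj.abs_coeff_le (K + 1)
  rw [coeff_mul_countPoly, ← rawWeight] at h1
  have h2 := four_mul_coeff_bound K h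
  linarith [abs_nonneg (rawWeight K h j)]

end Majorization

/-! ### Concentration of the counts -/

/-- The number of heads in a sequence of tosses. -/
def numHeads {K : ℕ} (f : Fin K → Bool) : ℕ := (Finset.univ.filter fun j => f j = true).card

theorem card_filter_numHeads (K i : ℕ) :
    (Finset.univ.filter fun f : Fin K → Bool => numHeads f = i).card = K.choose i := by
  rw [← Fintype.card_fin K, ← Finset.card_univ, ← Finset.card_powersetCard, Finset.card_univ,
    Fintype.card_fin]
  refine Finset.card_nbij' (fun f => Finset.univ.filter fun j => f j = true)
    (fun s j => decide (j ∈ s)) ?_ ?_ ?_ ?_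
  · intro f hf
    rw [Finset.mem_coe, Finset.mem_filter] at hf
    exact Finset.mem_coe.2 (Finset.mem_powersetCard.2 ⟨Finset.subset_univ _, hf.2⟩)
  · intro s hs
    rw [Finset.mem_coe, Finset.mem_powersetCard] at hs
    rw [Finset.mem_coe, Finset.mem_filter]
    simpa [numHeads] using hs.2
  · intro f _
    ext j
    simp
  · intro s _
    ext j
    simp

theorem tossLaw_real_singleton (K : ℕ) (p : I) (f : Fin K → Bool) :
    (CoinProblem.tossLaw K p).real {f} =
      (p : ℝ) ^ numHeads f * (1 - (p : ℝ)) ^ (K - numHeads f) := by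
  have h1 : ∀ b : Bool, (bernoulliMeasure true false p).real {b} =
      if b = true then (p : ℝ) else 1 - (p : ℝ) := by
    intro b
    rw [bernoulliMeasure_real_apply p (MeasurableSet.singleton b)]
    cases b <;> simp
  rw [CoinProblem.tossLaw, measureReal_def, Measure.pi_singleton, ENNReal.toReal_prod]
  simp_rw [← measureReal_def, h1]
  rw [Finset.prod_ite, Finset.prod_const, Finset.prod_const, numHeads]
  congr 2
  have := Finset.card_filter_add_card_filter_not (s := (Finset.univ : Finset (Fin K)))
    (fun j => f j = true)
  simp only [Finset.card_univ, Fintype.card_fin] at this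
  omega

theorem tossLaw_real_numHeads (K i : ℕ) (p : I) :
    (CoinProblem.tossLaw K p).real {f | numHeads f = i} =
      K.choose i * ((p : ℝ) ^ i * (1 - (p : ℝ)) ^ (K - i)) := by
  have e : {f : Fin K → Bool | numHeads f = i} =
      ((Finset.univ.filter fun f : Fin K → Bool => numHeads f = i : Finset _) : Set _) := by
    ext; simp
  rw [e, ← sum_measureReal_singleton]
  rw [Finset.sum_congr rfl fun f hf => by
    rw [tossLaw_real_singleton, (Finset.mem_filter.1 hf).2], Finset.sum_const,
    card_filter_numHeads, nsmul_eq_mul]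

/-- The probability that a coin drawn from `ϑ` shows exactly `i` heads. -/
theorem snapshotLaw_real_numHeads (K i : ℕ) (ϑ : Measure I) [IsProbabilityMeasure ϑ] :
    (CoinProblem.snapshotLaw K ϑ).real {f | numHeads f = i} =
      K.choose i * ∫ p : I, (p : ℝ) ^ i * (1 - (p : ℝ)) ^ (K - i) ∂ϑ := by
  rw [measureReal_def, CoinProblem.snapshotLaw, Measure.bind_apply (Set.toFinite _).measurableSet
    (CoinProblem.measurable_tossLaw K).aemeasurable, ← integral_const_mul]
  simp_rw [← tossLaw_real_numHeads, measureReal_def]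
  rw [integral_toReal]
  · exact ((Measure.measurable_coe (Set.toFinite _).measurableSet).comp
      (CoinProblem.measurable_tossLaw K)).aemeasurable
  · exact Filter.Eventually.of_forall fun p => measure_lt_top _ _

theorem headsCount_eq_sum {m K : ℕ} (ω : Fin m → Fin K → Bool) (i : Fin (K + 1)) :
    (CoinProblem.headsCount ω i : ℝ) =
      ∑ c, Set.indicator {f | numHeads f = (i : ℕ)} (fun _ => (1 : ℝ)) (ω c) := by
  rw [CoinProblem.headsCount, Finset.card_filter, Nat.cast_sum]
  refine Finset.sum_congr rfl fun c _ => ?_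
  change ((if numHeads (ω c) = (i : ℕ) then 1 else 0 : ℕ) : ℝ) = _
  by_cases h : numHeads (ω c) = (i : ℕ)
  · rw [Set.indicator_of_mem (by exact h), if_pos h, Nat.cast_one]
  · rw [Set.indicator_of_notMem (by exact h), if_neg h, Nat.cast_zero]

/-- Chebyshev's inequality for a sum of `m` independent indicators. A second moment suffices,
because an exponential number of coins already makes `m / r²` exponentially small. -/
theorem sampleLaw_real_deviation_le (m K : ℕ) (ϑ : Measure I) [IsProbabilityMeasure ϑ]
    (i : Fin (K + 1)) {r : ℝ} (hr : 0 < r) :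
    (CoinProblem.sampleLaw m K ϑ).real {ω | r ≤ |(CoinProblem.headsCount ω i : ℝ) -
      m * (CoinProblem.snapshotLaw K ϑ).real {f | numHeads f = (i : ℕ)}|} ≤ m / r ^ 2 := by
  set μ := CoinProblem.snapshotLaw K ϑ with hμ
  set A : Set (Fin K → Bool) := {f | numHeads f = (i : ℕ)} with hA
  have hAm : MeasurableSet A := (Set.toFinite _).measurableSet
  set Y : (Fin K → Bool) → ℝ := A.indicator fun _ => 1 with hY
  have hYL : MemLp Y 2 μ := memLp_indicator_const 2 hAm 1 (Or.inr (measure_ne_top _ _))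
  have hYv : Var[Y; μ] ≤ 1 := by
    have h := variance_le_sub_mul_sub (μ := μ) (X := Y) (a := 0) (b := 1)
      (Filter.Eventually.of_forall fun f => by
        rw [hY]; by_cases hf : f ∈ A <;> simp [hf])
      hYL.aestronglyMeasurable.aemeasurable
    have h0 : ∫ f, Y f ∂μ = μ.real A := integral_indicator_one hAm
    have h1 : μ.real A ≤ 1 := measureReal_le_one
    have h2 : 0 ≤ μ.real A := measureReal_nonneg
    rw [h0] at h
    nlinarith
  set X : (Fin m → Fin K → Bool) → ℝ := ∑ c, fun ω => Y (ω c) with hX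
  have hXe : ∀ ω, X ω = (CoinProblem.headsCount ω i : ℝ) := fun ω => by
    rw [headsCount_eq_sum, hX, Finset.sum_apply]
  have hev : ∀ c : Fin m, MeasurePreserving (fun ω : Fin m → Fin K → Bool => ω c)
      (Measure.pi fun _ => μ) μ := fun c => measurePreserving_eval (fun _ : Fin m => μ) c
  have hYc : ∀ c : Fin m, MemLp (fun ω : Fin m → Fin K → Bool => Y (ω c)) 2
      (Measure.pi fun _ => μ) := fun c => hYL.comp_measurePreserving (hev c)
  have hXL : MemLp X 2 (Measure.pi fun _ : Fin m => μ) := memLp_finsetSum' _ fun c _ => hYc c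
  have hXv : Var[X; Measure.pi fun _ : Fin m => μ] ≤ m := by
    rw [hX, variance_sum_pi (μ := fun _ : Fin m => μ) (X := fun _ => Y) fun _ => hYL]
    refine (Finset.sum_le_card_nsmul _ _ 1 fun _ _ => hYv).trans ?_
    simp
  have hXi : ∫ ω, X ω ∂(Measure.pi fun _ : Fin m => μ) = m * μ.real A := by
    rw [hX]
    simp only [Finset.sum_apply]
    rw [integral_finsetSum _ fun c _ => (hYc c).integrable (by norm_num)]
    have : ∀ c : Fin m, ∫ ω, Y (ω c) ∂(Measure.pi fun _ : Fin m => μ) = μ.real A := by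
      intro c
      have h0 : ∫ f, Y f ∂μ = μ.real A := integral_indicator_one hAm
      have h1 := integral_map (hev c).aemeasurable (f := Y)
        (by rw [(hev c).map_eq]; exact hYL.aestronglyMeasurable)
      rw [← h1, (hev c).map_eq, h0]
    simp [this]
  have h := meas_ge_le_variance_div_sq hXL hr
  rw [hXi] at h
  simp only [hXe] at h
  rw [measureReal_def]
  refine ENNReal.toReal_le_of_le_ofReal (by positivity) (h.trans (ENNReal.ofReal_le_ofReal ?_))
  gcongr

/-- All relative counts are close to their expectations with high probability. -/
theorem le_sampleLaw_real_counts (m K : ℕ) (ϑ : Measure I) [IsProbabilityMeasure ϑ]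
    {r : ℝ} (hr : 0 < r) :
    1 - (K + 1) * (m / r ^ 2) ≤ (CoinProblem.sampleLaw m K ϑ).real
      {ω | ∀ i : Fin (K + 1), |(CoinProblem.headsCount ω i : ℝ) -
        m * (CoinProblem.snapshotLaw K ϑ).real {f | numHeads f = (i : ℕ)}| < r} := by
  set P := CoinProblem.sampleLaw m K ϑ
  set bad : Fin (K + 1) → Set (Fin m → Fin K → Bool) := fun i =>
    {ω | r ≤ |(CoinProblem.headsCount ω i : ℝ) -
      m * (CoinProblem.snapshotLaw K ϑ).real {f | numHeads f = (i : ℕ)}|} with hbad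
  have e : {ω : Fin m → Fin K → Bool | ∀ i : Fin (K + 1), |(CoinProblem.headsCount ω i : ℝ) -
        m * (CoinProblem.snapshotLaw K ϑ).real {f | numHeads f = (i : ℕ)}| < r} =
      (⋃ i, bad i)ᶜ := by
    ext ω; simp [hbad]
  rw [e, measureReal_compl (Set.toFinite _).measurableSet, probReal_univ]
  have h1 : P.real (⋃ i, bad i) ≤ ∑ i, P.real (bad i) := measureReal_iUnion_fintype_le _
  have h2 : ∑ i, P.real (bad i) ≤ (K + 1) * (m / r ^ 2) := by
    refine (Finset.sum_le_card_nsmul _ _ _ fun i _ =>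
      sampleLaw_real_deviation_le m K ϑ i hr).trans ?_
    simp
  linarith

namespace CoinProblem

/-! ### Time bounds for programs -/

instance : Add Expr := ⟨.op .add⟩
instance : Sub Expr := ⟨.op .sub⟩
instance : Mul Expr := ⟨.op .mul⟩
instance : Div Expr := ⟨.op .div⟩

/-- A numeral. -/
def Expr.lit (n : ℕ) : Expr := .const n

/-- The test `e₁ < e₂`. -/
def Expr.lt (e₁ e₂ : Expr) : Expr := .op .lt e₁ e₂

/-- The `k`-th scalar variable, which is cell `k` of array `5`. -/
def Expr.var (k : ℕ) : Expr := .get 5 (.const k)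

/-- The input parameter. -/
def Expr.param : Expr := .get 1 (.const 0)

/-- Assignment to the `k`-th scalar variable. -/
def Cmd.assign (k : ℕ) (e : Expr) : Cmd := .set 5 (.const k) e

/-- Sequential composition of a list of commands. -/
def Cmd.block : List Cmd → Cmd
  | [] => .skip
  | c :: cs => .seq c (block cs)

@[simp]
theorem Expr.eval_add (s : Store) (a b : Expr) : (a + b).eval s = a.eval s + b.eval s := rfl
@[simp]
theorem Expr.eval_sub (s : Store) (a b : Expr) : (a - b).eval s = a.eval s - b.eval s := rfl
@[simp]
theorem Expr.eval_mul (s : Store) (a b : Expr) : (a * b).eval s = a.eval s * b.eval s := rfl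
@[simp]
theorem Expr.eval_div (s : Store) (a b : Expr) : (a / b).eval s = a.eval s / b.eval s := rfl
@[simp]
theorem Expr.eval_lt (s : Store) (a b : Expr) :
    (a.lt b).eval s = if a.eval s < b.eval s then 1 else 0 := rfl
@[simp]
theorem Expr.eval_lit (s : Store) (n : ℕ) : (lit n).eval s = n := rfl

/-- The size of an expression, where constants count with their values. -/
def Expr.size : Expr → ℕ
  | .const c => c.natAbs + 1
  | .get _ i => i.size + 1
  | .op _ e₁ e₂ => e₁.size + e₂.size + 1

/-- All cells hold numbers of at most `B` bits. -/
def Store.Bounded (B : ℕ) (s : Store) : Prop := ∀ a i, bits (s a i) ≤ B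

theorem bits_le_iff {x : ℤ} {b : ℕ} : bits x ≤ b ↔ x.natAbs < 2 ^ b := Nat.size_le

theorem natAbs_lt_two_pow_bits (x : ℤ) : x.natAbs < 2 ^ bits x := bits_le_iff.1 le_rfl

theorem bits_op_le (o : Op) (x y : ℤ) : bits (o.eval x y) ≤ bits x + bits y + 1 := by
  rw [bits_le_iff]
  have hx := natAbs_lt_two_pow_bits x
  have hy := natAbs_lt_two_pow_bits y
  have h1 : 2 ^ bits x ≤ 2 ^ (bits x + bits y) := Nat.pow_le_pow_right (by norm_num) (by omega)
  have h2 : 2 ^ bits y ≤ 2 ^ (bits x + bits y) := Nat.pow_le_pow_right (by norm_num) (by omega)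
  have h3 : 2 ^ (bits x + bits y + 1) = 2 * 2 ^ (bits x + bits y) := by ring
  rw [h3]
  cases o with
  | add => exact lt_of_le_of_lt (Int.natAbs_add_le x y) (by omega)
  | sub => exact lt_of_le_of_lt (Int.natAbs_sub_le x y) (by omega)
  | mul =>
    rw [Op.eval, Int.natAbs_mul]
    have : x.natAbs * y.natAbs ≤ 2 ^ bits x * 2 ^ bits y := Nat.mul_le_mul hx.le hy.le
    rw [← pow_add] at this
    have : 0 < 2 ^ (bits x + bits y) := by positivity
    omega
  | div =>
    have : (x / y).natAbs ≤ x.natAbs := Int.natAbs_ediv_le_natAbs x y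
    simp only [Op.eval]
    omega
  | lt =>
    have : 0 < 2 ^ (bits x + bits y) := by positivity
    simp only [Op.eval]
    split_ifs
    · simp; omega
    · simp

theorem bits_const_le (c : ℤ) : bits c ≤ c.natAbs := bits_le_iff.2 Nat.lt_two_pow_self

theorem Expr.bits_eval_le {B : ℕ} {s : Store} (hs : s.Bounded B) (e : Expr) :
    bits (e.eval s) ≤ e.size * (B + 1) := by
  induction e with
  | const c =>
    have := bits_const_le c
    simp only [Expr.eval, Expr.size]
    nlinarith
  | get a i _ =>
    have := hs a (i.eval s).toNat
    simp only [Expr.eval, Expr.size]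
    nlinarith
  | op o e₁ e₂ h1 h2 =>
    have := bits_op_le o (e₁.eval s) (e₂.eval s)
    simp only [Expr.eval, Expr.size]
    nlinarith

/-- The size enters squared because the value of each subexpression may have as many as its size
times `B + 1` bits. -/
theorem Expr.cost_le {B : ℕ} {s : Store} (hs : s.Bounded B) (e : Expr) :
    e.cost s ≤ 2 * e.size ^ 2 * (B + 1) := by
  induction e with
  | const c =>
    have := bits_const_le c
    simp only [Expr.cost, Expr.size]
    nlinarith [Nat.zero_le (c.natAbs * B), Nat.zero_le (c.natAbs ^ 2 * B)]
  | get a i ih =>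
    have h1 := hs a (i.eval s).toNat
    have h2 := i.bits_eval_le hs
    simp only [Expr.cost, Expr.size]
    nlinarith [Nat.zero_le (i.size * B)]
  | op o e₁ e₂ h1 h2 =>
    have h3 := e₁.bits_eval_le hs
    have h4 := e₂.bits_eval_le hs
    simp only [Expr.cost, Expr.size]
    nlinarith [Nat.zero_le (e₁.size * B), Nat.zero_le (e₂.size * B),
      Nat.zero_le (e₁.size * e₂.size * B), Nat.zero_le (e₁.size * e₂.size)]

/-- A bound for the time of a single step on a store with numbers of `B` bits. -/
def stepCost (B : ℕ) : ℕ := 320000 * (B + 1)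

/-- Started on `s`, the program halts in `s'` after at most `N` steps, provided that `s` holds
numbers of at most `B` bits only; then so does `s'`. -/
def Reach (B N : ℕ) (c : Cmd) (s s' : Store) : Prop :=
  s.Bounded B → s'.Bounded B ∧ ∃ t, Exec c s t s' ∧ t ≤ N * stepCost B

namespace Reach

variable {B N N₁ N₂ : ℕ} {s s₁ s₂ : Store}

theorem mono {c : Cmd} (h : Reach B N₁ c s s₁) (hN : N₁ ≤ N₂) : Reach B N₂ c s s₁ := fun hs => by
  obtain ⟨h1, t, h2, h3⟩ := h hs
  exact ⟨h1, t, h2, h3.trans (Nat.mul_le_mul_right _ hN)⟩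

theorem nil : Reach B 1 (Cmd.block []) s s := fun hs =>
  ⟨hs, 1, .skip s, by unfold stepCost; omega⟩

theorem cons {c : Cmd} {cs : List Cmd} (h1 : Reach B N₁ c s s₁)
    (h2 : Reach B N₂ (Cmd.block cs) s₁ s₂) : Reach B (N₁ + N₂) (Cmd.block (c :: cs)) s s₂ :=
  fun hs => by
  obtain ⟨hs1, t1, e1, l1⟩ := h1 hs
  obtain ⟨hs2, t2, e2, l2⟩ := h2 hs1
  exact ⟨hs2, t1 + t2, .seq e1 e2, by rw [add_mul]; omega⟩

theorem step {c : Cmd} {cs : List Cmd} (h1 : Reach B 1 c s s₁)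
    (h2 : Reach B N (Cmd.block cs) s₁ s₂) : Reach B (N + 1) (Cmd.block (c :: cs)) s s₂ :=
  (h1.cons h2).mono (by omega)

/-- Expressions of total size below `400` cost at most `2 * 400² * (B + 1)`, which is the constant
in `stepCost`. Only the stored value has to obey the bound `B`; intermediate values are covered by
the size. -/
theorem set {a k : ℕ} {i e : Expr} {v : ℤ} (hi : (i.eval s).toNat = k) (hv : e.eval s = v)
    (hb : bits v ≤ B) (hz : i.size + e.size + 1 ≤ 400) :
    Reach B 1 (.set a i e) s (s.write a k v) := fun hs => by
  refine ⟨fun a' i' => ?_, _, hi ▸ hv ▸ Exec.set s a i e, ?_⟩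
  · unfold Store.write
    by_cases ha : a' = a
    · subst ha
      by_cases hk : i' = k
      · subst hk; simpa using hb
      · simpa [hk] using hs a' i'
    · simpa [ha] using hs a' i'
  · have h1 := i.cost_le hs
    have h2 := e.cost_le hs
    have h3 := i.bits_eval_le hs
    have h4 := e.bits_eval_le hs
    have h5 : (i.size + e.size + 1) ^ 2 ≤ 400 ^ 2 := Nat.pow_le_pow_left hz 2
    have h6 : i.size ^ 2 + e.size ^ 2 + i.size + e.size + 1 ≤ (i.size + e.size + 1) ^ 2 := by
      nlinarith [Nat.zero_le (i.size * e.size)]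
    have h7 : (i.size ^ 2 + e.size ^ 2 + i.size + e.size + 1) * (B + 1) ≤ 400 ^ 2 * (B + 1) :=
      Nat.mul_le_mul_right _ (h6.trans h5)
    unfold stepCost
    nlinarith

/-- The invariant is indexed by the number of rounds done. Each round is charged one extra step for
its test, and the last failing test is the final `+ 1`. -/
theorem loop {Inv : ℕ → Store → Prop} {n : ℕ} {b : Expr} {c : Cmd} (hz : b.size ≤ 399)
    (h1 : ∀ k < n, ∀ s, Inv k s → b.eval s ≠ 0 ∧ ∃ s', Reach B N c s s' ∧ Inv (k + 1) s')
    (h2 : ∀ s, Inv n s → b.eval s = 0) (h0 : Inv 0 s) :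
    ∃ s', Reach B (n * (N + 1) + 1) (.loop b c) s s' ∧ Inv n s' := by
  have hc : ∀ s : Store, s.Bounded B → b.cost s + 1 ≤ stepCost B := by
    intro s hs
    have h3 := b.cost_le hs
    have h5 : b.size ^ 2 ≤ 399 ^ 2 := Nat.pow_le_pow_left hz 2
    have h7 : b.size ^ 2 * (B + 1) ≤ 399 ^ 2 * (B + 1) := Nat.mul_le_mul_right _ h5
    unfold stepCost
    nlinarith
  have main : ∀ d k s, k + d = n → Inv k s →
      ∃ s', Reach B (d * (N + 1) + 1) (.loop b c) s s' ∧ Inv n s' := by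
    intro d
    induction d with
    | zero =>
      intro k s hk hs
      obtain rfl : k = n := by omega
      exact ⟨s, fun hB => ⟨hB, _, .loop_false (h2 s hs), by have := hc s hB; omega⟩, hs⟩
    | succ d ih =>
      intro k s hk hs
      obtain ⟨hb, s₁, hr, hi⟩ := h1 k (by omega) s hs
      obtain ⟨s₂, hr2, hi2⟩ := ih (k + 1) s₁ (by omega) hi
      refine ⟨s₂, fun hB => ?_, hi2⟩
      obtain ⟨hB1, t1, e1, l1⟩ := hr hB
      obtain ⟨hB2, t2, e2, l2⟩ := hr2 hB1
      refine ⟨hB2, _, .loop_true hb e1 e2, ?_⟩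
      have := hc s hB
      have e : ((d + 1) * (N + 1) + 1) * stepCost B =
          (d * (N + 1) + 1) * stepCost B + N * stepCost B + stepCost B := by ring
      omega
  exact main n 0 s (by omega) h0

end Reach

/-! ### Memory layout -/

/-- The memory with parameter `K`, counts `h`, points `x`, weights `w` and scalars `L`. -/
def mem (K : ℕ) (h : ℕ → ℕ) (x w : ℕ → ℤ) (L : List ℤ) : Store := fun a i =>
  match a with
  | 0 => h i
  | 1 => if i = 0 then K else 0
  | 2 => x i
  | 3 => w i
  | 5 => L.getD i 0
  | _ => 0

section mem

variable {B K : ℕ} {h : ℕ → ℕ} {x w : ℕ → ℤ} {L : List ℤ}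

@[simp]
theorem eval_var_mem (k : ℕ) : (Expr.var k).eval (mem K h x w L) = L.getD k 0 := rfl

@[simp]
theorem eval_param_mem : Expr.param.eval (mem K h x w L) = K := rfl

@[simp]
theorem eval_count_mem (i : Expr) :
    (Expr.get 0 i).eval (mem K h x w L) = h (i.eval (mem K h x w L)).toNat := rfl

theorem write_mem_scalar (k : ℕ) (v : ℤ) (hk : k < L.length) :
    (mem K h x w L).write 5 k v = mem K h x w (L.set k v) := by
  funext a i
  unfold Store.write
  by_cases ha : a = 5
  · subst ha
    by_cases hi : i = k
    · subst hi
      simp [mem, hk]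
    · have : k ≠ i := fun h => hi h.symm
      simp [mem, hi, this]
  · rw [Function.update_of_ne ha]
    unfold mem
    split <;> simp_all

theorem write_mem_point (k : ℕ) (v : ℤ) :
    (mem K h x w L).write 2 k v = mem K h (Function.update x k v) w L := by
  funext a i
  unfold Store.write
  by_cases ha : a = 2
  · subst ha; simp only [Function.update_self]; rfl
  · rw [Function.update_of_ne ha]
    unfold mem
    split <;> simp_all

theorem write_mem_weight (k : ℕ) (v : ℤ) :
    (mem K h x w L).write 3 k v = mem K h x (Function.update w k v) L := by
  funext a i
  unfold Store.write
  by_cases ha : a = 3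
  · subst ha; simp only [Function.update_self]; rfl
  · rw [Function.update_of_ne ha]
    unfold mem
    split <;> simp_all

theorem reach_assign {k : ℕ} {e : Expr} {v : ℤ} (hv : e.eval (mem K h x w L) = v)
    (hb : bits v ≤ B) (hz : k + e.size ≤ 398 := by decide) (hk : k < L.length := by simp) :
    Reach B 1 (Cmd.assign k e) (mem K h x w L) (mem K h x w (L.set k v)) := by
  rw [← write_mem_scalar k v hk]
  refine Reach.set rfl hv hb ?_
  simp only [Expr.size, Int.natAbs_natCast]
  omega

end mem

/-! ### The program -/

section program

open CoinProblem.Expr CoinProblem.Cmd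

/-- Sums up the counts and computes a factorial and a power. -/
def sumBody : Cmd := block
  [assign 3 (var 3 + get 0 (var 0)), assign 4 (var 4 * (var 0 + lit 1)),
    assign 5 (var 5 * (lit 16 * (var 2 * var 2))), assign 0 (var 0 + lit 1)]

/-- Evaluates the polynomial of the weighted counts by Horner's rule. -/
def hornerBody : Cmd := block
  [assign 6 ((var 6 + var 4 * get 0 (var 0)) * var 5),
    assign 4 (var 4 * (var 0 + lit 1) / (param - var 0)), assign 7 (var 7 * var 5),
    assign 8 (var 8 * (lit 1 + (var 0).lt (param - lit 8 * var 1) * var 5)),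
    assign 0 (var 0 + lit 1)]

/-- One step of the recurrence for `chebW`. -/
def chebBody : Cmd := block
  [assign 14 (var 13), assign 13 ((lit 2 * var 11 - var 10) * var 13 - var 11 * var 11 * var 12),
    assign 12 (var 14), assign 0 (var 0 + lit 1)]

/-- Computes one point of the output together with its weight. -/
def pointBody : Cmd := block
  [assign 10 ((lit 2 * var 2 - var 9) * var 5 + (var 2 - var 9)), assign 10 (var 10 * var 10),
    assign 11 (var 2 * var 2 * ((lit 1 + var 5) * (lit 1 + var 5))), assign 12 (lit 1),
    assign 13 (lit 3 * var 11 - var 10), assign 0 (lit 0), loop ((var 0).lt (var 1)) chebBody,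
    assign 15 (var 12 * var 12 * (var 12 * var 12) * var 6),
    assign 14 ((lit 2 * var 15 + var 7) / (lit 2 * var 7)),
    assign 15 (var 14 - var 5 * ((lit 2 * var 14 + var 5) / (lit 2 * var 5))),
    set 3 (var 9) (lit 1 + (lit 1).lt (var 15) * (var 15 - lit 1)),
    set 2 (var 9) ((var 2).lt (var 9) * ((var 9).lt (lit 2 * var 2) * (var 9 - var 2) +
      (lit 1 - (var 9).lt (lit 2 * var 2)) * var 2)),
    assign 9 (var 9 + lit 1)]

/-- The reconstruction program. -/
def reconstruct : Cmd := block
  -- Scalars: 0 inner counter, 1 `n = K / 8`, 2 `M`, 3 the sum of the counts, 4 the factorial and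
  -- then the binomial weight, 5 the power of `16 M²` and then `Z`, 6 the value of the count
  -- polynomial, 7 `Z^(K+1)`, 8 `(1 + Z)^(K - 8 n)`, 9 the grid index `j`, 10 and 11 the values of
  -- `gridV` and `gridU`, 12 and 13 consecutive `chebW`, 14 and 15 temporaries.
  [assign 1 (param / lit 8),
    assign 2 ((param + lit 1) * (param + lit 1) * ((param + lit 1) * (param + lit 1))),
    assign 4 (lit 1), assign 5 (lit 1), loop ((var 0).lt (param + lit 1)) sumBody,
    assign 5 (lit 4 * var 5 * var 4 * (var 3 + lit 1)), assign 7 (lit 1), assign 8 (lit 1),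
    assign 0 (lit 0),
    loop ((var 0).lt (param + lit 1)) hornerBody, assign 6 (var 6 * var 8),
    loop ((var 9).lt (lit 3 * var 2 + lit 1)) pointBody, set 4 (lit 0) (var 9),
    set 4 (lit 1) (var 2)]

section loops

variable {B K : ℕ} {h : ℕ → ℕ} {x w : ℕ → ℤ}

theorem reach_sum_loop (n : ℤ) (M : ℕ)
    (hb0 : ∀ k ≤ K + 1, bits (k : ℤ) ≤ B)
    (hb3 : ∀ k ≤ K + 1, bits ((∑ i ∈ Finset.range k, h i : ℕ) : ℤ) ≤ B)
    (hb4 : ∀ k ≤ K + 1, bits (k.factorial : ℤ) ≤ B)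
    (hb5 : ∀ k ≤ K + 1, bits ((16 * M ^ 2) ^ k : ℤ) ≤ B) :
    Reach B ((K + 1) * (5 + 1) + 1) (loop ((var 0).lt (param + lit 1)) sumBody)
      (mem K h x w [0, n, M, 0, 1, 1, 0, 0, 0, 0, 0, 0, 0, 0, 0, 0])
      (mem K h x w [(K + 1 : ℕ), n, M, (∑ i ∈ Finset.range (K + 1), h i : ℕ),
        (K + 1).factorial, (16 * M ^ 2) ^ (K + 1), 0, 0, 0, 0, 0, 0, 0, 0, 0, 0]) := by
  obtain ⟨s', hr, rfl⟩ := Reach.loop (B := B) (N := 5) (n := K + 1)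
    (b := (var 0).lt (param + lit 1)) (c := sumBody)
    (s := mem K h x w [0, n, M, 0, 1, 1, 0, 0, 0, 0, 0, 0, 0, 0, 0, 0])
    (Inv := fun k s => s = mem K h x w [(k : ℕ), n, M, (∑ i ∈ Finset.range k, h i : ℕ),
        k.factorial, (16 * M ^ 2) ^ k, 0, 0, 0, 0, 0, 0, 0, 0, 0, 0]) (by decide)
    (by
      rintro k hk s rfl
      refine ⟨?_, _, ?_, rfl⟩
      · have : (k : ℤ) < K + 1 := by exact_mod_cast hk
        simp [this]
      · refine Reach.step (reach_assign (v := (∑ i ∈ Finset.range (k + 1), h i : ℕ)) ?_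
          (hb3 _ hk)) ?_
        · simp [Finset.sum_range_succ]
        refine Reach.step (reach_assign (v := (k + 1).factorial) ?_ (hb4 _ hk)) ?_
        · simp [Nat.factorial_succ]; ring
        refine Reach.step (reach_assign (v := (16 * M ^ 2) ^ (k + 1)) ?_ (hb5 _ hk)) ?_
        · simp; ring
        refine Reach.step (reach_assign (v := (k + 1 : ℕ)) ?_ (hb0 _ hk)) ?_
        · simp
        exact Reach.nil)
    (by
      rintro s rfl
      simp)
    (by simp)
  exact hr

/-- The sequence of weights produced by the Horner loop. -/
def hornerWeight (K k : ℕ) : ℕ := if k ≤ K then binomWeight K k else 0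

/-- The division is exact for `k < K`. In the last round the machine divides by `0` and gets `0`,
which is why `hornerWeight` is `0` at `K + 1`. The start is `(K+1)!`, left behind by the summation
loop. -/
theorem hornerWeight_succ {K k : ℕ} (hk : k ≤ K) :
    (hornerWeight K k : ℤ) * (k + 1) / (K - k) = hornerWeight K (k + 1) := by
  rcases hk.eq_or_lt with rfl | hk'
  · simp [hornerWeight]
  · have h1 : hornerWeight K k * (k + 1) = hornerWeight K (k + 1) * (K - k) := by
      rw [hornerWeight, hornerWeight, if_pos hk, if_pos (by omega), binomWeight, binomWeight,
        Nat.factorial_succ, show K - k = (K - (k + 1)) + 1 by omega, Nat.factorial_succ]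
      ring
    have h2 : (hornerWeight K k : ℤ) * (k + 1) = hornerWeight K (k + 1) * (K - k) := by
      rw [← Nat.cast_sub hk]
      exact_mod_cast h1
    rw [h2, Int.mul_ediv_cancel]
    have : (k : ℤ) < K := by exact_mod_cast hk'
    linarith

theorem reach_horner_loop (n : ℕ) (M m Z : ℤ)
    (hb0 : ∀ k ≤ K + 1, bits (k : ℤ) ≤ B)
    (hb4 : ∀ k ≤ K + 1, bits (hornerWeight K k : ℤ) ≤ B)
    (hb6 : ∀ k ≤ K + 1, bits ((countPoly K k h).eval Z) ≤ B)
    (hb7 : ∀ k ≤ K + 1, bits (Z ^ k) ≤ B)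
    (hb8 : ∀ k ≤ K, bits ((1 + Z) ^ k) ≤ B) :
    Reach B ((K + 1) * (6 + 1) + 1) (loop ((var 0).lt (param + lit 1)) hornerBody)
      (mem K h x w [0, n, M, m, (K + 1).factorial, Z, 0, 1, 1, 0, 0, 0, 0, 0, 0, 0])
      (mem K h x w [(K + 1 : ℕ), n, M, m, 0, Z, (countPoly K (K + 1) h).eval Z, Z ^ (K + 1),
        (1 + Z) ^ (K - 8 * n), 0, 0, 0, 0, 0, 0, 0]) := by
  obtain ⟨s', hr, hs'⟩ := Reach.loop (B := B) (N := 6) (n := K + 1)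
    (b := (var 0).lt (param + lit 1)) (c := hornerBody)
    (s := mem K h x w [0, n, M, m, (K + 1).factorial, Z, 0, 1, 1, 0, 0, 0, 0, 0, 0, 0])
    -- The power of `1 + Z` grows only during the first `K - 8 n` rounds, since the factor in the
    -- program is `1 + [k < K - 8 n] Z`.
    (Inv := fun k s => s = mem K h x w [(k : ℕ), n, M, m, hornerWeight K k, Z,
      (countPoly K k h).eval Z, Z ^ k, (1 + Z) ^ (min k (K - 8 * n)), 0, 0, 0, 0, 0, 0, 0])
    (by decide)
    (by
      rintro k hk s rfl
      have hk' : k ≤ K := Nat.lt_succ_iff.1 hk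
      refine ⟨?_, _, ?_, rfl⟩
      · have : (k : ℤ) < K + 1 := by exact_mod_cast hk
        simp [this]
      · refine Reach.step (reach_assign (v := (countPoly K (k + 1) h).eval Z) ?_ (hb6 _ hk)) ?_
        · simp [countPoly_succ, hornerWeight, hk']
        refine Reach.step (reach_assign (v := hornerWeight K (k + 1)) ?_ (hb4 _ hk)) ?_
        · rw [← hornerWeight_succ hk']
          simp
        refine Reach.step (reach_assign (v := Z ^ (k + 1)) ?_ (hb7 _ hk)) ?_
        · simp [pow_succ]
        refine Reach.step (reach_assign (v := (1 + Z) ^ (min (k + 1) (K - 8 * n))) ?_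
          (hb8 _ ((min_le_right _ _).trans (Nat.sub_le _ _)))) ?_
        · by_cases hlt : k < K - 8 * n
          · have h1 : (k : ℤ) < K - 8 * n := by omega
            rw [min_eq_left (by omega : k + 1 ≤ K - 8 * n)]
            simp [h1, hlt.le, pow_succ]
          · have h1 : ¬ (k : ℤ) < K - 8 * n := by omega
            rw [min_eq_right (by omega : K - 8 * n ≤ k + 1)]
            have h2 : K - 8 * n ≤ k := by omega
            simp [h1, h2]
        refine Reach.step (reach_assign (v := (k + 1 : ℕ)) ?_ (hb0 _ hk)) ?_
        · simp
        exact Reach.nil)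
    (by
      rintro s rfl
      simp)
    (by simp [hornerWeight, binomWeight, countPoly, Nat.factorial_succ])
  subst hs'
  have e : min (K + 1) (K - 8 * n) = K - 8 * n := min_eq_right (by omega)
  have e2 : hornerWeight K (K + 1) = 0 := by simp [hornerWeight]
  rw [e, e2] at hr
  exact hr

/-- Two consecutive terms are carried, so `n` rounds also produce term `n + 1`, and the size bound
must include it. -/
theorem reach_cheb_loop (n : ℕ) (l2 l3 l4 l5 l6 l7 l8 l9 u v l14 l15 : ℤ)
    (hb0 : ∀ k ≤ n, bits (k : ℤ) ≤ B) (hb : ∀ k ≤ n + 1, bits (chebW u v k) ≤ B) :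
    ∃ t, Reach B (n * (5 + 1) + 1) (loop ((var 0).lt (var 1)) chebBody)
      (mem K h x w [0, n, l2, l3, l4, l5, l6, l7, l8, l9, v, u, 1, 3 * u - v, l14, l15])
      (mem K h x w [n, n, l2, l3, l4, l5, l6, l7, l8, l9, v, u, chebW u v n, chebW u v (n + 1),
        t, l15]) := by
  obtain ⟨s', hr, t, rfl⟩ := Reach.loop (B := B) (N := 5) (n := n)
    (b := (var 0).lt (var 1)) (c := chebBody)
    (s := mem K h x w [0, n, l2, l3, l4, l5, l6, l7, l8, l9, v, u, 1, 3 * u - v, l14, l15])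
    (Inv := fun k s => ∃ t, s = mem K h x w [(k : ℕ), n, l2, l3, l4, l5, l6, l7, l8, l9, v, u,
      chebW u v k, chebW u v (k + 1), t, l15])
    (by decide)
    (by
      rintro k hk s ⟨t, rfl⟩
      refine ⟨?_, _, ?_, chebW u v (k + 1), rfl⟩
      · simp [hk]
      · refine Reach.step (reach_assign (v := chebW u v (k + 1)) ?_ (hb _ (by omega))) ?_
        · simp
        refine Reach.step (reach_assign (v := chebW u v (k + 2)) ?_ (hb _ (by omega))) ?_
        · simp [chebW, sq]
        refine Reach.step (reach_assign (v := chebW u v (k + 1)) ?_ (hb _ (by omega))) ?_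
        · simp
        refine Reach.step (reach_assign (v := (k + 1 : ℕ)) ?_ (hb0 _ hk)) ?_
        · simp
        exact Reach.nil)
    (by
      rintro s ⟨t, rfl⟩
      simp)
    ⟨l14, by simp [chebW]⟩
  exact ⟨t, hr⟩

end loops

/-! ### Sizes of the numbers -/

section sizes

variable {K m : ℕ}

theorem natCast_le_kronZ {a : ℕ} (ha : a ≤ (16 * gridM K ^ 2) ^ (K + 1)) : a ≤ kronZ K m := by
  refine ha.trans ?_
  unfold kronZ
  rw [mul_assoc, mul_comm 4, mul_assoc]
  exact Nat.le_mul_of_pos_right _ (by have := (K + 1).factorial_pos; positivity)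

theorem pow_le_kronZ {k : ℕ} (hk : k ≤ K + 1) : (16 * gridM K ^ 2) ^ k ≤ kronZ K m :=
  natCast_le_kronZ (Nat.pow_le_pow_right (by have := gridM_pos K; positivity) hk)

theorem sq_le_kronZ : 16 * gridM K ^ 2 ≤ kronZ K m := by
  simpa using pow_le_kronZ (K := K) (m := m) (k := 1) (by omega)

theorem factorial_le_kronZ : (K + 1).factorial * (m + 1) ≤ kronZ K m := by
  unfold kronZ
  rw [mul_assoc]
  refine Nat.le_mul_of_pos_left _ ?_
  have := gridM_pos K
  positivity

theorem le_gridM : K + 1 ≤ gridM K := by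
  unfold gridM
  exact Nat.le_self_pow (by norm_num) _

theorem four_mul_gridM_le : 16 * gridM K ≤ kronZ K m := by
  refine le_trans ?_ sq_le_kronZ
  have := gridM_pos K
  nlinarith

/-- The majorant is evaluated at `Z`, with `8 M² ≤ Z` and `1 + Z ≤ Z²`. Measuring everything in
powers of `Z` reduces later size checks to comparing exponents. -/
theorem abs_chebW_eval_le {j : ℕ} (hj : j ≤ 3 * gridM K) (k : ℕ) :
    |chebW ((gridU (gridM K)).eval (kronZ K m : ℤ)) ((gridV (gridM K) j).eval (kronZ K m : ℤ)) k| ≤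
      (kronZ K m : ℤ) ^ (5 * k) := by
  have hZ : (4 : ℤ) ≤ kronZ K m := by exact_mod_cast four_le_kronZ K m
  have hM : (16 * gridM K ^ 2 : ℤ) ≤ kronZ K m := by exact_mod_cast sq_le_kronZ
  have h := (majorizes_chebW (by positivity) (majorizes_gridU (gridM K)) (majorizes_gridV hj)
    k).abs_eval_le (z := kronZ K m) (by positivity)
  have e := map_chebW (Polynomial.evalRingHom (kronZ K m : ℤ)) (gridU (gridM K))
    (gridV (gridM K) j) k
  simp only [Polynomial.coe_evalRingHom] at e
  rw [e] at h
  refine h.trans ?_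
  simp only [Polynomial.eval_mul, Polynomial.eval_C, Polynomial.eval_pow, Polynomial.eval_add,
    Polynomial.eval_one, Polynomial.eval_X]
  set Z : ℤ := ((kronZ K m : ℕ) : ℤ)
  calc (8 * (gridM K : ℤ) ^ 2) ^ k * (1 + Z) ^ (2 * k) ≤ Z ^ k * (Z ^ 2) ^ (2 * k) := by
        gcongr
        · nlinarith [sq_nonneg (gridM K : ℤ)]
        · nlinarith
    _ = Z ^ (5 * k) := by rw [← pow_mul, ← pow_add]; congr 1; ring

theorem countPoly_eval_nonneg (k : ℕ) (h : ℕ → ℕ) {z : ℤ} (hz : 0 ≤ z) :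
    0 ≤ (countPoly K k h).eval z :=
  (abs_nonneg _).trans ((Majorizes.refl_of_nonneg
    (coeff_countPoly_nonneg K k h)).abs_eval_le hz)

theorem countPoly_eval_le {k : ℕ} (hk : k ≤ K + 1) (h : ℕ → ℕ)
    (hm : m = ∑ i ∈ Finset.range (K + 1), h i) :
    (countPoly K k h).eval (kronZ K m : ℤ) ≤ (kronZ K m : ℤ) ^ (K + 2) := by
  have hZ : (4 : ℤ) ≤ kronZ K m := by exact_mod_cast four_le_kronZ K m
  have hf : ((K + 1).factorial * (m + 1) : ℤ) ≤ kronZ K m := by exact_mod_cast factorial_le_kronZ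
  have hfac : (0 : ℤ) ≤ (K + 1).factorial := by positivity
  set Z : ℤ := ((kronZ K m : ℕ) : ℤ)
  unfold countPoly
  rw [Polynomial.eval_finsetSum]
  calc ∑ i ∈ Finset.range k, (Polynomial.C ((binomWeight K i * h i : ℕ) : ℤ) *
        Polynomial.X ^ (k - i)).eval Z ≤
        ∑ i ∈ Finset.range k, ((K + 1).factorial : ℤ) * h i * Z ^ (K + 1) := by
        refine Finset.sum_le_sum fun i hi => ?_
        simp only [Polynomial.eval_mul, Polynomial.eval_C, Polynomial.eval_pow, Polynomial.eval_X]
        have hi' := Finset.mem_range.1 hi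
        have h1 := binomWeight_le K i (by omega)
        push_cast
        gcongr
        · linarith
        · omega
    _ = ((K + 1).factorial : ℤ) * (∑ i ∈ Finset.range k, h i : ℕ) * Z ^ (K + 1) := by
        rw [← Finset.sum_mul, ← Finset.mul_sum, Nat.cast_sum]
    _ ≤ ((K + 1).factorial : ℤ) * (m + 1) * Z ^ (K + 1) := by
        have : ∑ i ∈ Finset.range k, h i ≤ m := by
          rw [hm]
          exact Finset.sum_le_sum_of_subset (Finset.range_subset_range.2 hk)
        have : ((∑ i ∈ Finset.range k, h i : ℕ) : ℤ) ≤ m + 1 := by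
          have : ((∑ i ∈ Finset.range k, h i : ℕ) : ℤ) ≤ m := by exact_mod_cast this
          linarith
        gcongr
    _ ≤ Z * Z ^ (K + 1) := by gcongr
    _ = Z ^ (K + 2) := by ring

theorem gridA_mul_eval (j : ℕ) (P : Polynomial ℤ) (Z : ℤ) :
    (gridA K (gridM K) j * P).eval Z =
      chebW ((gridU (gridM K)).eval Z) ((gridV (gridM K) j).eval Z) (K / 8) ^ 4 *
        (P.eval Z * (1 + Z) ^ (K - 8 * (K / 8))) := by
  have e := map_chebW (Polynomial.evalRingHom Z) (gridU (gridM K)) (gridV (gridM K) j) (K / 8)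
  simp only [Polynomial.coe_evalRingHom] at e
  simp only [gridA, Polynomial.eval_mul, Polynomial.eval_pow, Polynomial.eval_add,
    Polynomial.eval_one, Polynomial.eval_X]
  rw [e]
  ring

end sizes

/-! ### The main loop over the grid points -/

/-- The numerator of the `j`-th point of the output. -/
def gridPoint (M j : ℕ) : ℕ := min (j - M) M

/-- The number that is stored in the sixth scalar variable during the main loop. -/
noncomputable def paddedCount (K : ℕ) (h : ℕ → ℕ) (Z : ℤ) : ℤ :=
  (countPoly K (K + 1) h).eval Z * (1 + Z) ^ (K - 8 * (K / 8))

theorem reach_set_weight {B K : ℕ} {h : ℕ → ℕ} {x w : ℕ → ℤ} {L : List ℤ} {i e : Expr} {k : ℕ}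
    {v : ℤ} (hi : i.eval (mem K h x w L) = k) (hv : e.eval (mem K h x w L) = v)
    (hb : bits v ≤ B) (hz : i.size + e.size + 1 ≤ 400) :
    Reach B 1 (.set 3 i e) (mem K h x w L) (mem K h x (Function.update w k v) L) := by
  rw [← write_mem_weight]
  exact Reach.set (by rw [hi, Int.toNat_natCast]) hv hb hz

theorem reach_set_point {B K : ℕ} {h : ℕ → ℕ} {x w : ℕ → ℤ} {L : List ℤ} {i e : Expr} {k : ℕ}
    {v : ℤ} (hi : i.eval (mem K h x w L) = k) (hv : e.eval (mem K h x w L) = v)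
    (hb : bits v ≤ B) (hz : i.size + e.size + 1 ≤ 400) :
    Reach B 1 (.set 2 i e) (mem K h x w L) (mem K h (Function.update x k v) w L) := by
  rw [← write_mem_point]
  exact Reach.set (by rw [hi, Int.toNat_natCast]) hv hb hz

theorem gridPoint_eq (M j : ℕ) :
    (if (M : ℤ) < j then 1 else 0) * ((if (j : ℤ) < 2 * M then 1 else 0) * ((j : ℤ) - M) +
      (1 - if (j : ℤ) < 2 * M then 1 else 0) * M) = (gridPoint M j : ℤ) := by
  unfold gridPoint
  split_ifs <;> push_cast <;> omega

theorem one_add_ite_eq_max (r : ℤ) : 1 + (if 1 < r then 1 else 0) * (r - 1) = max 1 r := by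
  split_ifs <;> omega

theorem abs_paddedCount_le {K m : ℕ} {h : ℕ → ℕ} (hm : m = ∑ i ∈ Finset.range (K + 1), h i) :
    |paddedCount K h (kronZ K m)| ≤ (kronZ K m : ℤ) ^ (3 * K + 2) := by
  have hZ : (4 : ℤ) ≤ kronZ K m := by exact_mod_cast four_le_kronZ K m
  have h1 := countPoly_eval_le (k := K + 1) le_rfl h hm
  have h2 := countPoly_eval_nonneg (K := K) (K + 1) h (z := kronZ K m) (by linarith)
  set Z : ℤ := ((kronZ K m : ℕ) : ℤ)
  rw [paddedCount, abs_mul, abs_of_nonneg h2, abs_of_nonneg (by positivity)]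
  calc _ ≤ Z ^ (K + 2) * (Z ^ 2) ^ K := by
        refine mul_le_mul h1 ?_ (by positivity) (by positivity)
        calc (1 + Z) ^ (K - 8 * (K / 8)) ≤ (1 + Z) ^ K := by
              gcongr
              · linarith
              · omega
          _ ≤ (Z ^ 2) ^ K := by gcongr; nlinarith
    _ = _ := by rw [← pow_mul, ← pow_add]; congr 1; ring

theorem abs_ediv_le_abs (a b : ℤ) : |a / b| ≤ |a| := by
  have := Int.natAbs_ediv_le_natAbs a b
  rw [Int.abs_eq_natAbs, Int.abs_eq_natAbs]
  exact_mod_cast this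

/-- The round is treated for arbitrary integers subject to size bounds, without reference to the
polynomials behind them. The largest value is the dividend in the digit extraction: `20 (K / 8) + 3
K + 2 ≤ 6 K + 2` bounds the exponent of `y`, and the rounding adds one. -/
theorem reach_pointBody_aux {B K M j : ℕ} {h : ℕ → ℕ} {x w : ℕ → ℤ} {m Z u v l V r : ℤ}
    (hB : ∀ v : ℤ, |v| ≤ Z ^ (6 * K + 10) → bits v ≤ B) (hZ : 4 ≤ Z)
    (hM16 : (16 * M : ℤ) ≤ Z) (hKM : ((K : ℤ) + 1) ≤ M) (hj' : (j : ℤ) ≤ 3 * M)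
    (hpad : |V| ≤ Z ^ (3 * K + 2)) (hW : ∀ k, |chebW u v k| ≤ Z ^ (5 * k))
    (hdig : kronDigit Z (Z ^ (K + 1)) (chebW u v (K / 8) ^ 4 * V) = r) (hraw : |r| ≤ Z)
    (hue : u = (M : ℤ) * M * ((1 + Z) * (1 + Z))) (hl : l = (2 * M - j) * Z + (M - j))
    (hve : v = l * l) (hlb : |l| ≤ Z ^ 3) (hvb : |v| ≤ Z ^ 6) (hub : |u| ≤ Z ^ 5)
    (l0 l8 l10 l11 l12 l13 l14 l15 : ℤ) :
    ∃ l0' l10' l11' l12' l13' l14' l15', Reach B (K * 6 + 14) pointBody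
      (mem K h x w [l0, (K / 8 : ℕ), M, m, 0, Z, V, Z ^ (K + 1), l8, j, l10, l11, l12, l13, l14,
        l15])
      (mem K h (Function.update x j (gridPoint M j)) (Function.update w j (max 1 r))
        [l0', (K / 8 : ℕ), M, m, 0, Z, V, Z ^ (K + 1), l8, (j + 1 : ℕ), l10', l11', l12', l13',
        l14', l15']) := by
  have hZ0 : 0 ≤ Z := by linarith
  have hZ1 : 1 ≤ Z := by linarith
  have hBp : ∀ a ≤ 6 * K + 10, ∀ v : ℤ, |v| ≤ Z ^ a → bits v ≤ B := fun a ha v hv =>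
    hB v (hv.trans (pow_le_pow_right₀ hZ1 ha))
  have hB1 : ∀ v : ℤ, |v| ≤ Z → bits v ≤ B := fun v hv => hBp 1 (by omega) v (by simpa using hv)
  have hWb : ∀ k ≤ K / 8 + 1, bits (chebW u v k) ≤ B := fun k hk =>
    hBp (5 * k) (by omega) _ (hW k)
  obtain ⟨y, hy⟩ : ∃ y, y = chebW u v (K / 8) ^ 4 * V := ⟨_, rfl⟩
  have hyb : |y| ≤ Z ^ (6 * K + 2) := by
    rw [hy, abs_mul, abs_pow]
    calc |chebW u v (K / 8)| ^ 4 * |V| ≤ (Z ^ (5 * (K / 8))) ^ 4 * Z ^ (3 * K + 2) := by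
          gcongr
          exact hW _
      _ = Z ^ (5 * (K / 8) * 4 + (3 * K + 2)) := by rw [← pow_mul, ← pow_add]
      _ ≤ _ := pow_le_pow_right₀ hZ1 (by omega)
  obtain ⟨q, hq⟩ : ∃ q, q = (2 * y + Z ^ (K + 1)) / (2 * Z ^ (K + 1)) := ⟨_, rfl⟩
  have hqb : |q| ≤ Z ^ (6 * K + 3) := by
    rw [hq]
    refine (abs_ediv_le_abs _ _).trans ((abs_add_le _ _).trans ?_)
    rw [abs_mul, abs_two, abs_of_nonneg (by positivity : 0 ≤ Z ^ (K + 1))]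
    have h1 : Z ^ (K + 1) ≤ Z ^ (6 * K + 2) := pow_le_pow_right₀ hZ1 (by omega)
    have h2 : Z ^ (6 * K + 3) = Z ^ (6 * K + 2) * Z := by ring
    have h3 : 0 ≤ Z ^ (6 * K + 2) := by positivity
    nlinarith
  have hr : q - Z * ((2 * q + Z) / (2 * Z)) = r := by
    rw [← hdig, kronDigit, ← hy, ← hq]
  have hkn : ∀ k ≤ K / 8, bits (k : ℤ) ≤ B := fun k hk => hB1 _ (by
    rw [Nat.abs_cast]
    have : (k : ℤ) ≤ K := by exact_mod_cast hk.trans (Nat.div_le_self _ _)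
    linarith)
  obtain ⟨t, hloop⟩ := reach_cheb_loop (B := B) (K := K) (h := h) (x := x) (w := w) (K / 8)
    (M) m 0 Z V (Z ^ (K + 1)) l8 j u v l14 l15 hkn hWb
  refine ⟨(K / 8 : ℕ), v, u, chebW u v (K / 8), chebW u v (K / 8 + 1), q, r, Reach.mono
    (N₁ := K / 8 * (5 + 1) + 1 + 7 + 1 + 1 + 1 + 1 + 1 + 1) ?_ (by omega)⟩
  refine Reach.step (reach_assign (v := l) ?_ (hBp 3 (by omega) _ hlb)) ?_
  · simp [hl]
  refine Reach.step (reach_assign (v := v) ?_ (hBp 6 (by omega) _ hvb)) ?_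
  · simp [hve]
  refine Reach.step (reach_assign (v := u) ?_ (hBp 5 (by omega) _ hub)) ?_
  · simp [hue]
  refine Reach.step (reach_assign (v := 1) ?_ (hB1 _ (by simpa using hZ1))) ?_
  · simp
  refine Reach.step (reach_assign (v := 3 * u - v) ?_ (hWb 1 (by omega))) ?_
  · simp
  refine Reach.step (reach_assign (v := 0) ?_ (hB1 _ (by simpa using hZ0))) ?_
  · simp
  refine Reach.mono (Reach.cons (N₂ := 7) hloop ?_) (by omega)
  refine Reach.step (reach_assign (v := y) ?_ (hBp _ (by omega) _ hyb)) ?_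
  · have h4 : y = chebW u v (K / 8) * chebW u v (K / 8) *
        (chebW u v (K / 8) * chebW u v (K / 8)) * V := by rw [hy]; ring
    simp [h4]
  refine Reach.step (reach_assign (v := q) ?_ (hBp _ (by omega) _ hqb)) ?_
  · simp [hq]
  refine Reach.step (reach_assign (v := r) ?_ (hB1 _ hraw)) ?_
  · rw [← hr]; simp
  refine Reach.step (reach_set_weight (k := j) (v := max 1 (r)) ?_ ?_ (hB1 _ ?_)
    (by decide)) ?_
  · simp
  · rw [← one_add_ite_eq_max]; simp
  · rw [abs_of_nonneg (by positivity)]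
    exact max_le hZ1 ((le_abs_self _).trans hraw)
  refine Reach.step (reach_set_point (k := j) (v := gridPoint (M) j) ?_ ?_ (hB1 _ ?_)
    (by decide)) ?_
  · simp
  · rw [← gridPoint_eq]; simp
  · rw [Nat.abs_cast]
    have : (gridPoint (M) j : ℤ) ≤ M := by exact_mod_cast Nat.min_le_right (j - M) M
    linarith
  refine Reach.step (reach_assign (v := (j + 1 : ℕ)) ?_ (hB1 _ ?_)) ?_
  · simp
  · rw [Nat.abs_cast]; push_cast; linarith
  exact Reach.nil

theorem reach_pointBody {B K m : ℕ} {h : ℕ → ℕ} {x w : ℕ → ℤ}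
    (hm : m = ∑ i ∈ Finset.range (K + 1), h i)
    (hB : ∀ v : ℤ, |v| ≤ (kronZ K m : ℤ) ^ (6 * K + 10) → bits v ≤ B)
    {j : ℕ} (hj : j ≤ 3 * gridM K) (l0 l8 l10 l11 l12 l13 l14 l15 : ℤ) :
    ∃ l0' l10' l11' l12' l13' l14' l15', Reach B (K * 6 + 14) pointBody
      (mem K h x w [l0, (K / 8 : ℕ), gridM K, m, 0, kronZ K m, paddedCount K h (kronZ K m),
        (kronZ K m : ℤ) ^ (K + 1), l8, j, l10, l11, l12, l13, l14, l15])
      (mem K h (Function.update x j (gridPoint (gridM K) j))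
        (Function.update w j (max 1 (rawWeight K h j)))
        [l0', (K / 8 : ℕ), gridM K, m, 0, kronZ K m, paddedCount K h (kronZ K m),
        (kronZ K m : ℤ) ^ (K + 1), l8, (j + 1 : ℕ), l10', l11', l12', l13', l14', l15']) := by
  have hZ : (4 : ℤ) ≤ kronZ K m := by exact_mod_cast four_le_kronZ K m
  have hM16 : (16 * gridM K : ℤ) ≤ kronZ K m := by exact_mod_cast four_mul_gridM_le
  have hM2 : (16 * gridM K ^ 2 : ℤ) ≤ kronZ K m := by exact_mod_cast sq_le_kronZ
  have hM1 : (1 : ℤ) ≤ gridM K := by exact_mod_cast gridM_pos K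
  have hKM : ((K : ℤ) + 1) ≤ gridM K := by exact_mod_cast le_gridM
  have hj' : (j : ℤ) ≤ 3 * gridM K := by exact_mod_cast hj
  have hpad := abs_paddedCount_le hm
  have hW := abs_chebW_eval_le (K := K) (m := m) hj
  have hdig := kronDigit_gridA hj h
  have hraw := abs_rawWeight_le hj h
  rw [gridA_mul_eval, ← paddedCount, ← hm] at hdig
  rw [← hm] at hraw
  generalize ((kronZ K m : ℕ) : ℤ) = Z at *
  set u := (gridU (gridM K)).eval Z with hu
  set v := (gridV (gridM K) j).eval Z with hv
  set V := paddedCount K h Z with hV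
  have hZ0 : 0 ≤ Z := by linarith
  have hZ1 : 1 ≤ Z := by linarith
  have hue : u = (gridM K : ℤ) * gridM K * ((1 + Z) * (1 + Z)) := by
    rw [hu, gridU]
    simp only [Polynomial.eval_mul, Polynomial.eval_C, Polynomial.eval_pow, Polynomial.eval_add,
      Polynomial.eval_one, Polynomial.eval_X]
    ring
  set l : ℤ := (2 * gridM K - j) * Z + (gridM K - j) with hl
  have hve : v = l * l := by
    rw [hv, gridV]
    simp only [Polynomial.eval_mul, Polynomial.eval_C, Polynomial.eval_pow, Polynomial.eval_add,
      Polynomial.eval_X]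
    ring
  have hlb : |l| ≤ Z ^ 3 := by
    have h1 : |2 * (gridM K : ℤ) - j| ≤ 2 * gridM K := by
      rw [abs_le]; constructor <;> linarith
    have h2 : |(gridM K : ℤ) - j| ≤ 2 * gridM K := by
      rw [abs_le]; constructor <;> linarith
    refine (abs_add_le _ _).trans ?_
    rw [abs_mul, abs_of_nonneg hZ0]
    have h3 : |2 * (gridM K : ℤ) - j| * Z ≤ Z * Z := by
      gcongr; linarith
    nlinarith
  have hvb : |v| ≤ Z ^ 6 := by
    rw [hve, abs_mul]
    calc |l| * |l| ≤ Z ^ 3 * Z ^ 3 := by gcongr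
      _ = Z ^ 6 := by ring
  have hub : |u| ≤ Z ^ 5 := by
    rw [abs_of_nonneg (by rw [hue]; positivity), hue]
    calc (gridM K : ℤ) * gridM K * ((1 + Z) * (1 + Z)) ≤ Z * (Z ^ 2 * Z ^ 2) := by
          gcongr <;> nlinarith
      _ = Z ^ 5 := by ring
  exact reach_pointBody_aux hB hZ hM16 hKM hj' hpad hW hdig hraw hue hl hve hlb hvb hub _ _ _ _ _
    _ _ _

theorem reach_point_loop {B K m : ℕ} {h : ℕ → ℕ} {x w : ℕ → ℤ}
    (hm : m = ∑ i ∈ Finset.range (K + 1), h i)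
    (hB : ∀ v : ℤ, |v| ≤ (kronZ K m : ℤ) ^ (6 * K + 10) → bits v ≤ B) (l0 l8 : ℤ) :
    ∃ s', Reach B ((3 * gridM K + 1) * (K * 6 + 14 + 1) + 1)
      (loop ((var 9).lt (lit 3 * var 2 + lit 1)) pointBody)
      (mem K h x w [l0, (K / 8 : ℕ), gridM K, m, 0, kronZ K m, paddedCount K h (kronZ K m),
        (kronZ K m : ℤ) ^ (K + 1), l8, 0, 0, 0, 0, 0, 0, 0]) s' ∧
      (var 9).eval s' = (3 * gridM K + 1 : ℕ) ∧ (var 2).eval s' = gridM K ∧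
      ∀ j < 3 * gridM K + 1, s' 2 j = gridPoint (gridM K) j ∧ s' 3 j = max 1 (rawWeight K h j) := by
  obtain ⟨s', hr, l0', l10, l11, l12, l13, l14, l15, x', w', rfl, hxw⟩ :=
    Reach.loop (B := B) (N := K * 6 + 14) (n := 3 * gridM K + 1)
      (b := (var 9).lt (lit 3 * var 2 + lit 1)) (c := pointBody)
      (s := mem K h x w [l0, (K / 8 : ℕ), gridM K, m, 0, kronZ K m, paddedCount K h (kronZ K m),
        (kronZ K m : ℤ) ^ (K + 1), l8, 0, 0, 0, 0, 0, 0, 0])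
      (Inv := fun j s => ∃ l0' l10 l11 l12 l13 l14 l15 x' w', s = mem K h x' w'
        [l0', (K / 8 : ℕ), gridM K, m, 0, kronZ K m, paddedCount K h (kronZ K m),
          (kronZ K m : ℤ) ^ (K + 1), l8, (j : ℕ), l10, l11, l12, l13, l14, l15] ∧
        ∀ i < j, x' i = gridPoint (gridM K) i ∧ w' i = max 1 (rawWeight K h i))
      (by decide)
      (by
        rintro j hj s ⟨l0', l10, l11, l12, l13, l14, l15, x', w', rfl, hxw⟩
        obtain ⟨k0, k10, k11, k12, k13, k14, k15, hr⟩ := reach_pointBody (x := x') (w := w')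
          hm hB (Nat.lt_succ_iff.1 hj) l0' l8 l10 l11 l12 l13 l14 l15
        refine ⟨?_, _, hr, k0, k10, k11, k12, k13, k14, k15, _, _, rfl, fun i hi => ?_⟩
        · have : (j : ℤ) < 3 * gridM K + 1 := by exact_mod_cast hj
          simp [this]
        · rcases Nat.lt_succ_iff_lt_or_eq.1 hi with h1 | rfl
          · rw [Function.update_of_ne h1.ne, Function.update_of_ne h1.ne]
            exact hxw i h1
          · simp)
      (by
        rintro s ⟨l0', l10, l11, l12, l13, l14, l15, x', w', rfl, hxw⟩
        simp)
      ⟨l0, 0, 0, 0, 0, 0, 0, x, w, by simp, by simp⟩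
  exact ⟨_, hr, by simp, by simp, fun j hj => hxw j hj⟩

/-- Extension of the input by zeros. -/
def extendCounts {K : ℕ} (h : Fin (K + 1) → ℕ) (i : ℕ) : ℕ :=
  if hi : i < K + 1 then h ⟨i, hi⟩ else 0

theorem inputStore_eq_mem {K : ℕ} (h : Fin (K + 1) → ℕ) :
    inputStore h = mem K (extendCounts h) (fun _ => 0) (fun _ => 0)
      [0, 0, 0, 0, 0, 0, 0, 0, 0, 0, 0, 0, 0, 0, 0, 0] := by
  funext a i
  have hL : ∀ i : ℕ, ([0, 0, 0, 0, 0, 0, 0, 0, 0, 0, 0, 0, 0, 0, 0, 0] : List ℤ).getD i 0 = 0 := by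
    intro i
    have : ([0, 0, 0, 0, 0, 0, 0, 0, 0, 0, 0, 0, 0, 0, 0, 0] : List ℤ) = List.replicate 16 0 := rfl
    rw [this, List.getD_eq_getElem?_getD, List.getElem?_replicate]
    split_ifs <;> rfl
  unfold inputStore mem
  rcases a with _ | _ | _ | _ | _ | _ | a
  · simp only [if_true, extendCounts]
    split_ifs <;> simp
  · simp
  · simp
  · simp
  · simp
  · rw [hL]; simp
  · simp

/-! ### Bit lengths and the run of the whole program -/

/-- A bound for the number of bits of `kronZ`. -/
def kronBits (K b : ℕ) : ℕ := 2 + (8 * K + 4) * (K + 1) + K * (K + 1) + (K + b + 1)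

theorem succ_le_two_pow (K : ℕ) : K + 1 ≤ 2 ^ K := Nat.lt_two_pow_self

theorem gridM_le_two_pow (K : ℕ) : gridM K ≤ 2 ^ (4 * K) := by
  unfold gridM
  rw [mul_comm, pow_mul]
  exact Nat.pow_le_pow_left (succ_le_two_pow K) 4

theorem kronZ_le {K m b : ℕ} (hm : m ≤ (K + 1) * 2 ^ b) : kronZ K m ≤ 2 ^ kronBits K b := by
  have h1 : 16 * gridM K ^ 2 ≤ 2 ^ (8 * K + 4) := by
    calc 16 * gridM K ^ 2 ≤ 2 ^ 4 * (2 ^ (4 * K)) ^ 2 := by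
          gcongr
          · norm_num
          · exact gridM_le_two_pow K
      _ = _ := by rw [← pow_mul, ← pow_add]; congr 1; ring
  have h2 : (K + 1).factorial ≤ 2 ^ (K * (K + 1)) := by
    refine (Nat.factorial_le_pow _).trans ?_
    rw [pow_mul]
    exact Nat.pow_le_pow_left (succ_le_two_pow K) _
  have h3 : m + 1 ≤ 2 ^ (K + b + 1) := by
    have h4 : (K + 1) * 2 ^ b ≤ 2 ^ (K + b) := by
      rw [pow_add]; exact Nat.mul_le_mul_right _ (succ_le_two_pow K)
    have : 0 < 2 ^ (K + b) := by positivity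
    rw [pow_succ]
    omega
  have e : 2 ^ kronBits K b =
      2 ^ 2 * (2 ^ (8 * K + 4)) ^ (K + 1) * 2 ^ (K * (K + 1)) * 2 ^ (K + b + 1) := by
    rw [kronBits, pow_add, pow_add, pow_add, pow_mul]
  rw [e, kronZ]
  gcongr
  norm_num

/-- A bound for the number of bits of all numbers that occur. -/
def totalBits (K b : ℕ) : ℕ := kronBits K b * (6 * K + 10) + 1

theorem bits_le_totalBits {K m b : ℕ} (hm : m ≤ (K + 1) * 2 ^ b) (v : ℤ)
    (hv : |v| ≤ (kronZ K m : ℤ) ^ (6 * K + 10)) : bits v ≤ totalBits K b := by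
  rw [bits_le_iff]
  have h1 : v.natAbs ≤ kronZ K m ^ (6 * K + 10) := by
    rw [Int.abs_eq_natAbs] at hv
    exact_mod_cast hv
  have h2 : kronZ K m ^ (6 * K + 10) ≤ (2 ^ kronBits K b) ^ (6 * K + 10) :=
    Nat.pow_le_pow_left (kronZ_le hm) _
  rw [← pow_mul] at h2
  unfold totalBits
  refine lt_of_le_of_lt (h1.trans h2) (Nat.pow_lt_pow_right (by norm_num) (by omega))

theorem reach_reconstruct {B K m : ℕ} {h : ℕ → ℕ}
    (hm : m = ∑ i ∈ Finset.range (K + 1), h i)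
    (hB : ∀ v : ℤ, |v| ≤ (kronZ K m : ℤ) ^ (6 * K + 10) → bits v ≤ B) :
    ∃ s', Reach B ((3 * gridM K + 1) * (K * 6 + 15) + (13 * K + 30)) reconstruct
      (mem K h (fun _ => 0) (fun _ => 0) [0, 0, 0, 0, 0, 0, 0, 0, 0, 0, 0, 0, 0, 0, 0, 0]) s' ∧
      s' 4 0 = (3 * gridM K + 1 : ℕ) ∧ s' 4 1 = gridM K ∧
      ∀ j < 3 * gridM K + 1, s' 2 j = gridPoint (gridM K) j ∧ s' 3 j = max 1 (rawWeight K h j) := by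
  have hZ : (4 : ℤ) ≤ kronZ K m := by exact_mod_cast four_le_kronZ K m
  have hZ0 : (0 : ℤ) ≤ kronZ K m := by linarith
  have hZ1 : (1 : ℤ) ≤ kronZ K m := by linarith
  have hBp : ∀ a ≤ 6 * K + 10, ∀ v : ℤ, |v| ≤ (kronZ K m : ℤ) ^ a → bits v ≤ B := fun a ha v hv =>
    hB v (hv.trans (pow_le_pow_right₀ hZ1 ha))
  have hBn : ∀ v : ℕ, v ≤ kronZ K m → bits (v : ℤ) ≤ B := fun v hv => by
    refine hBp 1 (by omega) v ?_
    rw [pow_one, Nat.abs_cast]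
    exact_mod_cast hv
  have hM16 := four_mul_gridM_le (K := K) (m := m)
  have hKM := le_gridM (K := K)
  have hfm := factorial_le_kronZ (K := K) (m := m)
  have hfpos := (K + 1).factorial_pos
  have hfac : (K + 1).factorial ≤ kronZ K m := le_trans (Nat.le_mul_of_pos_right _ (by omega)) hfm
  have hmZ : m ≤ kronZ K m :=
    (Nat.le_succ m).trans ((Nat.le_mul_of_pos_left _ hfpos).trans hfm)
  have hpad := abs_paddedCount_le hm
  have hcount : ∀ k ≤ K + 1, bits ((countPoly K k h).eval (kronZ K m : ℤ)) ≤ B := fun k hk => by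
    refine hBp (K + 2) (by omega) _ ?_
    rw [abs_of_nonneg (countPoly_eval_nonneg k h hZ0)]
    exact countPoly_eval_le hk h hm
  have hZeq : (4 * (16 * (gridM K : ℤ) ^ 2) ^ (K + 1) * (K + 1).factorial * (m + 1) : ℤ) =
      kronZ K m := by
    unfold kronZ; push_cast; ring
  have hk : ∀ k ≤ K + 1, bits (k : ℤ) ≤ B := fun k hk => hBn k (by omega)
  have hL1 := reach_sum_loop (B := B) (K := K) (h := h) (x := fun _ => 0) (w := fun _ => 0)
    ((K / 8 : ℕ) : ℤ) (gridM K) hk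
    (fun k hk => hBn _ (le_trans (by
      rw [hm]; exact Finset.sum_le_sum_of_subset (Finset.range_subset_range.2 hk)) hmZ))
    (fun k hk => hBn _ ((Nat.factorial_le hk).trans hfac))
    (fun k hk => by
      have := hBn _ (pow_le_kronZ (K := K) (m := m) hk)
      push_cast at this
      exact this)
  rw [← hm] at hL1
  have hL2 := reach_horner_loop (B := B) (K := K) (h := h) (x := fun _ => 0) (w := fun _ => 0)
    (K / 8) (gridM K) m (kronZ K m) hk
    (fun k hk => hBn _ (by
      unfold hornerWeight
      split_ifs with h1
      · exact (binomWeight_le K k h1).trans hfac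
      · exact Nat.zero_le _)) hcount
    (fun k hk => hBp k (by omega) _ (by rw [abs_of_nonneg (pow_nonneg hZ0 _)]))
    (fun k hk => hBp (2 * k) (by omega) _ (by
      rw [abs_of_nonneg (by positivity), pow_mul]
      gcongr
      nlinarith))
  obtain ⟨s', hL3, h9, h2, hout⟩ := reach_point_loop (x := fun _ => 0) (w := fun _ => 0) hm hB
    (K + 1 : ℕ) ((1 + (kronZ K m : ℤ)) ^ (K - 8 * (K / 8)))
  -- Array `4` is constantly `0` in `mem`, so the last two writes are made on a bare store.
  refine ⟨(s'.write 4 0 (3 * gridM K + 1 : ℕ)).write 4 1 (gridM K), ?_, ?_, ?_, fun j hj => ?_⟩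
  · obtain ⟨N, hN⟩ : ∃ N, N = (3 * gridM K + 1) * (K * 6 + 14 + 1) + 1 := ⟨_, rfl⟩
    rw [← hN] at hL3
    have hN' : (3 * gridM K + 1) * (K * 6 + 15) + (13 * K + 30) = N + 13 * K + 29 := by
      rw [hN]; ring
    rw [hN']
    refine Reach.mono (Reach.step (N := N + 13 * K + 27)
      (reach_assign (v := (K / 8 : ℕ)) ?_ (hBn _ (by omega))) ?_) (by omega)
    · simp
    refine Reach.mono (Reach.step (N := N + 13 * K + 26)
      (reach_assign (v := (gridM K : ℕ)) ?_ (hBn _ (by omega))) ?_) (by omega)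
    · simp [gridM]; ring
    refine Reach.mono (Reach.step (N := N + 13 * K + 25)
      (reach_assign (v := 1) ?_ (hBn 1 (by omega))) ?_) (by omega)
    · simp
    refine Reach.mono (Reach.step (N := N + 13 * K + 24)
      (reach_assign (v := 1) ?_ (hBn 1 (by omega))) ?_) (by omega)
    · simp
    refine Reach.mono (Reach.cons (N₂ := N + 7 * K + 17) hL1 ?_) (by omega)
    refine Reach.mono (Reach.step (N := N + 7 * K + 16)
      (reach_assign (v := kronZ K m) ?_ (hBn _ le_rfl)) ?_) (by omega)
    · rw [← hZeq, hm]; simp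
    refine Reach.mono (Reach.step (N := N + 7 * K + 15)
      (reach_assign (v := 1) ?_ (hBn 1 (by omega))) ?_) (by omega)
    · simp
    refine Reach.mono (Reach.step (N := N + 7 * K + 14)
      (reach_assign (v := 1) ?_ (hBn 1 (by omega))) ?_) (by omega)
    · simp
    refine Reach.mono (Reach.step (N := N + 7 * K + 13)
      (reach_assign (v := 0) ?_ (hBn 0 (by omega))) ?_) (by omega)
    · simp
    refine Reach.mono (Reach.cons (N₂ := N + 5) hL2 ?_) (by omega)
    refine Reach.mono (Reach.step (N := N + 4)
      (reach_assign (v := paddedCount K h (kronZ K m)) ?_ (hBp _ (by omega) _ hpad)) ?_) (by omega)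
    · simp [paddedCount]
    refine Reach.mono (Reach.cons (N₂ := 3) hL3 ?_) (by omega)
    refine Reach.step (Reach.set (k := 0) (v := (3 * gridM K + 1 : ℕ)) rfl h9 (hBn _ (by omega))
      (by decide)) ?_
    exact Reach.step (Reach.set (k := 1) (v := gridM K) rfl h2 (hBn _ (by omega)) (by decide))
      Reach.nil
  · simp [Store.write]
  · simp [Store.write]
  · simpa [Store.write] using hout j hj

end program

/-! ### The estimator -/

/-- The `j`-th point of the output. -/
noncomputable def outPoint (M j : ℕ) : I :=
  ⟨gridPoint M j / M, by positivity,
    div_le_one_of_le₀ (by exact_mod_cast Nat.min_le_right (j - M) M) (by positivity)⟩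

/-- The unnormalized weight of the `j`-th point of the output. -/
noncomputable def outWeight (K : ℕ) (h : ℕ → ℕ) (j : ℕ) : ℤ := max 1 (rawWeight K h j)

theorem outWeight_pos (K : ℕ) (h : ℕ → ℕ) (j : ℕ) : 0 < outWeight K h j :=
  lt_of_lt_of_le one_pos (le_max_left _ _)

/-- The mixture that is reconstructed from the counts `h`. -/
noncomputable def estimate (K : ℕ) (h : ℕ → ℕ) : Measure I :=
  ∑ j ∈ Finset.range (3 * gridM K + 1), ENNReal.ofReal ((outWeight K h j : ℝ) /
    ∑ i ∈ Finset.range (3 * gridM K + 1), (outWeight K h i : ℝ)) •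
      Measure.dirac (outPoint (gridM K) j)

theorem sum_outWeight_pos (K : ℕ) (h : ℕ → ℕ) :
    0 < ∑ i ∈ Finset.range (3 * gridM K + 1), (outWeight K h i : ℝ) :=
  Finset.sum_pos (fun i _ => by exact_mod_cast outWeight_pos K h i) ⟨0, by simp⟩

instance (K : ℕ) (h : ℕ → ℕ) : IsProbabilityMeasure (estimate K h) := by
  have hW := sum_outWeight_pos K h
  refine ⟨?_⟩
  unfold estimate
  simp only [Measure.finsetSum_apply, Measure.smul_apply, smul_eq_mul, measure_univ, mul_one]
  rw [← ENNReal.ofReal_sum_of_nonneg fun i _ => div_nonneg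
    (by exact_mod_cast (outWeight_pos K h i).le) hW.le, ← Finset.sum_div, div_self hW.ne',
    ENNReal.ofReal_one]

theorem map_estimate (K : ℕ) (h : ℕ → ℕ) :
    (estimate K h).map (Subtype.val : I → ℝ) =
      ∑ j ∈ Finset.range (3 * gridM K + 1), ENNReal.ofReal ((outWeight K h j : ℝ) /
        ∑ i ∈ Finset.range (3 * gridM K + 1), (outWeight K h i : ℝ)) •
          Measure.dirac ((gridPoint (gridM K) j : ℝ) / (gridM K : ℝ)) := by
  ext t ht
  rw [Measure.map_apply measurable_subtype_coe ht, estimate]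
  simp only [Measure.finsetSum_apply, Measure.smul_apply, smul_eq_mul,
    Measure.dirac_apply' _ (measurable_subtype_coe ht), Measure.dirac_apply' _ ht]
  rfl

theorem describes_estimate {K : ℕ} {h : ℕ → ℕ} {s : Store}
    (h0 : s 4 0 = (3 * gridM K + 1 : ℕ)) (h1 : s 4 1 = gridM K)
    (hs : ∀ j < 3 * gridM K + 1, s 2 j = gridPoint (gridM K) j ∧ s 3 j = outWeight K h j) :
    Describes s ⟨estimate K h, inferInstance⟩ := by
  have hN : outSize s = 3 * gridM K + 1 := by rw [outSize, h0, Int.toNat_natCast]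
  have hW : outTotal s = ∑ j ∈ Finset.range (3 * gridM K + 1), outWeight K h j := by
    rw [outTotal, hN]
    exact Finset.sum_congr rfl fun j hj => (hs j (Finset.mem_range.1 hj)).2
  refine ⟨?_, ?_, ?_, ?_⟩
  · rw [outDenom, h1]; exact_mod_cast gridM_pos K
  · rw [hW]; exact_mod_cast sum_outWeight_pos K h
  · intro j hj
    rw [hN] at hj
    rw [(hs j hj).1, (hs j hj).2, outDenom, h1]
    exact ⟨by positivity, by exact_mod_cast Nat.min_le_right (j - gridM K) (gridM K),
      (outWeight_pos K h j).le⟩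
  · change (estimate K h).map _ = _
    rw [map_estimate, hN]
    refine Finset.sum_congr rfl fun j hj => ?_
    rw [(hs j (Finset.mem_range.1 hj)).1, (hs j (Finset.mem_range.1 hj)).2, hW, outDenom, h1]
    push_cast
    rfl

section time

open Polynomial

/-- The polynomial time bound of the program for `2 ^ (C * K)` coins. -/
noncomputable def timeBound (c : ℕ) : ℕ[X] :=
  ((3 * (X + 1) ^ 4 + 1) * (X * 6 + 15) + (13 * X + 30)) *
    (320000 * ((2 + (8 * X + 4) * (X + 1) + X * (X + 1) + (X + C c * X + 1)) *
      (6 * X + 10) + 1 + 1))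

theorem timeBound_eval (c K : ℕ) : (timeBound c).eval K =
    ((3 * gridM K + 1) * (K * 6 + 15) + (13 * K + 30)) * stepCost (totalBits K (c * K)) := by
  simp [timeBound, stepCost, totalBits, kronBits, gridM]

end time

/-- No probability enters: the bound holds for every input with counts of `O(K)` bits. Here `m` is
the sum that the program itself computes, and clipping at `1` makes the output a valid mixture on
every input. -/
theorem outputsWithin_estimate {K c : ℕ} (h : Fin (K + 1) → ℕ) (hh : ∀ i, h i ≤ 2 ^ (c * K)) :
    OutputsWithin reconstruct h ((timeBound c).eval K)
      ⟨estimate K (extendCounts h), inferInstance⟩ := by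
  obtain ⟨m, hm⟩ : ∃ m, m = ∑ i ∈ Finset.range (K + 1), extendCounts h i := ⟨_, rfl⟩
  have hext : ∀ i, extendCounts h i ≤ 2 ^ (c * K) := fun i => by
    unfold extendCounts
    split_ifs
    · exact hh _
    · exact Nat.zero_le _
  have hmle : m ≤ (K + 1) * 2 ^ (c * K) := by
    rw [hm]
    refine (Finset.sum_le_card_nsmul _ _ _ fun i _ => hext i).trans ?_
    simp
  have hB := bits_le_totalBits hmle
  obtain ⟨s', hr, h0, h1, hs⟩ := reach_reconstruct hm hB
  have hZ1 : 1 ≤ kronZ K m := le_trans (by norm_num) (four_le_kronZ K m)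
  have hBn : ∀ v : ℕ, v ≤ kronZ K m → bits (v : ℤ) ≤ totalBits K (c * K) := fun v hv => by
    refine hB v ?_
    rw [Nat.abs_cast]
    exact_mod_cast hv.trans (Nat.le_self_pow (by omega) _)
  have hbd : (inputStore h).Bounded (totalBits K (c * K)) := by
    intro a i
    unfold inputStore
    split_ifs with h2 h3
    · refine hBn _ ?_
      have h4 : h ⟨i, h3⟩ = extendCounts h i := by simp [extendCounts, h3]
      have h5 : extendCounts h i ≤ m := by
        rw [hm]
        exact Finset.single_le_sum (f := extendCounts h) (fun _ _ => Nat.zero_le _)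
          (Finset.mem_range.2 h3)
      rw [h4]
      exact h5.trans ((Nat.le_succ m).trans ((Nat.le_mul_of_pos_left _
        (K + 1).factorial_pos).trans factorial_le_kronZ))
    · exact hBn 0 (Nat.zero_le _)
    · refine hBn _ ?_
      have := le_gridM (K := K)
      have := four_mul_gridM_le (K := K) (m := m)
      omega
    · exact hBn 0 (Nat.zero_le _)
  rw [← inputStore_eq_mem] at hr
  obtain ⟨_, t, hex, ht⟩ := hr hbd
  refine ⟨t, s', hex, ?_, ?_, describes_estimate h0 h1 hs⟩
  · rw [timeBound_eval]; exact ht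
  · rw [outSize, h0, Int.toNat_natCast, timeBound_eval]
    have h2 : 3 * gridM K + 1 ≤ (3 * gridM K + 1) * (K * 6 + 15) + (13 * K + 30) := by nlinarith
    exact h2.trans (Nat.le_mul_of_pos_right _ (by unfold stepCost; omega))

/-! ### The error of the estimator -/

/-- The right side is the distance from `y` to the unclipped grid point `j / M - 1`; projecting that
point to `[0,1]` cannot increase its distance to a point of `[0,1]`. -/
theorem dist_outPoint_le {M : ℕ} (hM : 0 < M) (j : ℕ) (y : I) :
    dist y (outPoint M j) ≤ 2 * |gridT M j y| := by
  have hM' : (0 : ℝ) < M := by exact_mod_cast hM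
  have e1 : 2 * |gridT M j y| = |M * (y : ℝ) + M - j| / M := by
    rw [gridT, abs_div, abs_of_pos (by positivity : (0 : ℝ) < 2 * M)]
    field_simp
  have e2 : dist y (outPoint M j) = |M * (y : ℝ) - gridPoint M j| / M := by
    change |(y : ℝ) - gridPoint M j / M| = _
    rw [show (y : ℝ) - gridPoint M j / M = (M * y - gridPoint M j) / M by field_simp, abs_div,
      abs_of_pos hM']
  rw [e1, e2]
  refine div_le_div_of_nonneg_right ?_ hM'.le
  have hy0 : 0 ≤ M * (y : ℝ) := mul_nonneg hM'.le y.2.1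
  have hy1 : M * (y : ℝ) ≤ M := by nlinarith [y.2.2]
  unfold gridPoint
  rcases le_total j M with h1 | h1
  · have h1' : (j : ℝ) ≤ M := by exact_mod_cast h1
    rw [Nat.sub_eq_zero_of_le h1, Nat.zero_min, Nat.cast_zero, sub_zero, abs_of_nonneg hy0]
    refine le_trans ?_ (le_abs_self _)
    linarith
  rcases le_total (j - M) M with h2 | h2
  · rw [min_eq_left h2, Nat.cast_sub h1]
    refine le_of_eq ?_
    congr 1
    ring
  · rw [min_eq_right h2]
    have h3 : (2 * M : ℝ) ≤ j := by exact_mod_cast (by omega : 2 * M ≤ j)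
    rw [abs_of_nonpos (by linarith), abs_of_nonpos (by linarith)]
    linarith

/-- The Bernstein expansion is integrated termwise. The factor `(K+1)!` turns the division by `K
choose i`, needed to pass from probabilities to moments, into the integer `binomWeight`. -/
theorem integral_gridD (K j : ℕ) (hj : j ≤ 3 * gridM K) (ϑ : Measure I) [IsProbabilityMeasure ϑ] :
    ((K + 1).factorial : ℝ) * ((gridM K : ℝ) ^ (8 * (K / 8)) *
      ∫ y : I, gridD (K / 8) (gridM K) j y ∂ϑ) =
      ∑ i ∈ Finset.range (K + 1), ((gridA K (gridM K) j).coeff i : ℝ) * (binomWeight K i *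
        (snapshotLaw K ϑ).real {f | numHeads f = i}) := by
  rw [← integral_const_mul]
  simp_rw [← sum_gridA_eq (K := K) (gridM_pos K) hj]
  have hint : ∀ i, Integrable (fun y : I => (y : ℝ) ^ i * (1 - (y : ℝ)) ^ (K - i)) ϑ := fun i =>
    Continuous.integrable_of_hasCompactSupport (by fun_prop) (HasCompactSupport.of_compactSpace _)
  rw [integral_finsetSum _ fun i _ => (hint i).const_mul _, Finset.mul_sum]
  refine Finset.sum_congr rfl fun i hi => ?_
  rw [integral_const_mul, snapshotLaw_real_numHeads,
    ← binomWeight_mul_choose (Nat.lt_succ_iff.1 (Finset.mem_range.1 hi))]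
  push_cast
  ring

/-- The binomial coefficient in the bound for the kernel coefficients cancels against `binomWeight`,
so every count has the same worst-case influence. -/
theorem abs_rawWeight_sub_le {K j : ℕ} (hj : j ≤ 3 * gridM K) (ϑ : Measure I)
    [IsProbabilityMeasure ϑ] (h : ℕ → ℕ) (m r : ℝ)
    (hr : ∀ i < K + 1, |(h i : ℝ) - m * (snapshotLaw K ϑ).real {f | numHeads f = i}| ≤ r) :
    |(rawWeight K h j : ℝ) - m * ((K + 1).factorial : ℝ) * (gridM K : ℝ) ^ (8 * (K / 8)) *
      ∫ y : I, gridD (K / 8) (gridM K) j y ∂ϑ| ≤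
      (K + 1) * ((8 * (gridM K : ℝ) ^ 2) ^ (4 * (K / 8)) * (K + 1).factorial * r) := by
  have e1 : m * ((K + 1).factorial : ℝ) * (gridM K : ℝ) ^ (8 * (K / 8)) *
      ∫ y : I, gridD (K / 8) (gridM K) j y ∂ϑ =
      m * (((K + 1).factorial : ℝ) * ((gridM K : ℝ) ^ (8 * (K / 8)) *
      ∫ y : I, gridD (K / 8) (gridM K) j y ∂ϑ)) := by ring
  rw [e1, integral_gridD K j hj, Finset.mul_sum, rawWeight]
  push_cast
  rw [← Finset.sum_sub_distrib]
  refine (Finset.abs_sum_le_sum_abs _ _).trans ?_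
  refine (Finset.sum_le_card_nsmul _ _ ((8 * (gridM K : ℝ) ^ 2) ^ (4 * (K / 8)) *
    (K + 1).factorial * r) fun i hi => ?_).trans (by simp)
  have hi' := Finset.mem_range.1 hi
  have e2 : ((gridA K (gridM K) j).coeff i : ℝ) * ((binomWeight K i : ℝ) * (h i : ℝ)) -
      m * (((gridA K (gridM K) j).coeff i : ℝ) * ((binomWeight K i : ℝ) *
        (snapshotLaw K ϑ).real {f | numHeads f = i})) =
      ((gridA K (gridM K) j).coeff i : ℝ) * (binomWeight K i : ℝ) *
        ((h i : ℝ) - m * (snapshotLaw K ϑ).real {f | numHeads f = i}) := by ring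
  rw [e2, abs_mul, abs_mul, Nat.abs_cast]
  have h1 : |((gridA K (gridM K) j).coeff i : ℝ)| ≤
      (8 * (gridM K : ℝ) ^ 2) ^ (4 * (K / 8)) * (K.choose i : ℝ) := by
    have := abs_coeff_gridA_le (K := K) hj i
    exact_mod_cast this
  have hr0 : 0 ≤ r := (abs_nonneg _).trans (hr i hi')
  calc _ ≤ (8 * (gridM K : ℝ) ^ 2) ^ (4 * (K / 8)) * (K.choose i : ℝ) *
          (binomWeight K i : ℝ) * r := by
        gcongr
        exact hr i hi'
    _ = (8 * (gridM K : ℝ) ^ 2) ^ (4 * (K / 8)) * (binomWeight K i * K.choose i : ℕ) * r := by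
        push_cast; ring
    _ = _ := by rw [binomWeight_mul_choose (Nat.lt_succ_iff.1 hi')]

/-- The left side is at most `2^(3 + 7 K) r`; the `10` makes room for the `3` when `K ≥ 1`. -/
theorem deviation_factor_le {K m r : ℕ} (hK : 1 ≤ K) (hm : 2 ^ (10 * K) * r ≤ m) :
    2 * ((K + 1) * (8 ^ (4 * (K / 8)) * r)) * (3 * gridM K + 1) ≤ m := by
  have h1 : 8 ^ (4 * (K / 8)) ≤ 2 ^ (2 * K) := by
    rw [show 8 = 2 ^ 3 by norm_num, ← pow_mul]
    exact Nat.pow_le_pow_right two_pos (by omega)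
  have h2 : 3 * gridM K + 1 ≤ 4 * 2 ^ (4 * K) := by
    have := gridM_le_two_pow K
    have := gridM_pos K
    omega
  have h3 : 2 ^ (3 + 7 * K) ≤ 2 ^ (10 * K) := Nat.pow_le_pow_right two_pos (by omega)
  calc _ ≤ 2 * (2 ^ K * (2 ^ (2 * K) * r)) * (4 * 2 ^ (4 * K)) := by
        gcongr
        exact succ_le_two_pow K
    _ = 2 ^ (3 + 7 * K) * r := by ring
    _ ≤ 2 ^ (10 * K) * r := by gcongr
    _ ≤ m := hm

theorem sum_abs_outWeight_sub_le {K m r : ℕ} (hK : 1 ≤ K) (hr1 : 1 ≤ r)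
    (hm : 2 ^ (10 * K) * r ≤ m) (ϑ : Measure I) [IsProbabilityMeasure ϑ] (h : ℕ → ℕ)
    (hr : ∀ i < K + 1, |(h i : ℝ) - m * (snapshotLaw K ϑ).real {f | numHeads f = i}| ≤ r) :
    ∑ j ∈ Finset.range (3 * gridM K + 1), |(outWeight K h j : ℝ) /
      (m * ((K + 1).factorial : ℝ) * (gridM K : ℝ) ^ (8 * (K / 8))) -
      ∫ y : I, gridD (K / 8) (gridM K) j y ∂ϑ| ≤ 1 := by
  have hr1' : (1 : ℝ) ≤ r := by exact_mod_cast hr1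
  have hM1 : (1 : ℝ) ≤ gridM K := by exact_mod_cast gridM_pos K
  have hm1 : (1 : ℝ) ≤ m := by
    exact_mod_cast hr1.trans ((Nat.le_mul_of_pos_left _ (by positivity)).trans hm)
  have hf1 : (1 : ℝ) ≤ (K + 1).factorial := by exact_mod_cast (K + 1).factorial_pos
  set F : ℝ := ((K + 1).factorial : ℝ)
  set P : ℝ := (gridM K : ℝ) ^ (8 * (K / 8)) with hP
  have hP1 : 1 ≤ P := one_le_pow₀ hM1
  have hΛ : 0 < m * F * P := by positivity
  set E : ℝ := (K + 1) * ((8 * (gridM K : ℝ) ^ 2) ^ (4 * (K / 8)) * F * r) with hE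
  have hE' : E = (K + 1) * (8 ^ (4 * (K / 8)) * r) * (F * P) := by
    rw [hE, mul_pow, ← pow_mul, show 2 * (4 * (K / 8)) = 8 * (K / 8) by ring]
    ring
  -- This absorbs the clipping: the target of each weight is nonnegative, so raising a smaller raw
  -- weight to `1` overshoots by at most `1 ≤ E`.
  have hE1 : 1 ≤ E := by
    rw [hE']
    have h8 : (1 : ℝ) ≤ 8 ^ (4 * (K / 8)) := one_le_pow₀ (by norm_num)
    have hK1 : (1 : ℝ) ≤ K + 1 := by linarith [(Nat.cast_nonneg K : (0 : ℝ) ≤ K)]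
    exact one_le_mul_of_one_le_of_one_le (one_le_mul_of_one_le_of_one_le hK1
      (one_le_mul_of_one_le_of_one_le h8 hr1')) (one_le_mul_of_one_le_of_one_le hf1 hP1)
  have hEΛ : 2 * E * (3 * gridM K + 1) ≤ m * F * P := by
    have := deviation_factor_le hK hm
    have h' : (2 * ((K + 1) * (8 ^ (4 * (K / 8)) * r)) * (3 * gridM K + 1) : ℝ) ≤ m := by
      exact_mod_cast this
    calc 2 * E * (3 * gridM K + 1) =
          2 * ((K + 1) * (8 ^ (4 * (K / 8)) * r)) * (3 * gridM K + 1) * (F * P) := by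
          rw [hE']; ring
      _ ≤ m * (F * P) := by gcongr
      _ = _ := by ring
  refine (Finset.sum_le_card_nsmul _ _ (2 * E / (m * F * P)) fun j hj => ?_).trans ?_
  · have hj' : j ≤ 3 * gridM K := Nat.lt_succ_iff.1 (Finset.mem_range.1 hj)
    have h1 := abs_rawWeight_sub_le hj' ϑ h m r hr
    rw [← hE] at h1
    set g := ∫ y : I, gridD (K / 8) (gridM K) j y ∂ϑ
    have hg : 0 ≤ m * F * P * g :=
      mul_nonneg hΛ.le (integral_nonneg fun y => gridD_nonneg _ _ _ _)
    have e : (outWeight K h j : ℝ) / (m * F * P) - g =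
        ((outWeight K h j : ℝ) - m * F * P * g) / (m * F * P) := by
      field_simp
    rw [e, abs_div, abs_of_pos hΛ]
    refine div_le_div_of_nonneg_right ?_ hΛ.le
    have hmax : (outWeight K h j : ℝ) = max 1 (rawWeight K h j : ℝ) := by
      rw [outWeight]; push_cast; rfl
    rw [hmax, abs_le]
    have h2 := abs_le.1 h1
    have h3 := le_max_right 1 (rawWeight K h j : ℝ)
    refine ⟨by linarith [h2.1], ?_⟩
    rcases max_cases 1 (rawWeight K h j : ℝ) with h4 | h4 <;> rw [h4.1] <;> linarith [h2.2]
  · rw [Finset.card_range, nsmul_eq_mul, ← mul_div_assoc, div_le_one hΛ]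
    push_cast
    linarith

/-- The deterministic half of the theorem. The exponent `4` in `gridM` is used through `N⁴ ≤ M`: it
makes the rounding error `N⁶` at most `M N²`, a fraction `O(1/N)` of the kernel sum. -/
theorem tran_estimate_le {K m r : ℕ} (hK : 1 ≤ K) (hr1 : 1 ≤ r)
    (hm : 2 ^ (10 * K) * r ≤ m) (ϑ : Measure I) [IsProbabilityMeasure ϑ] (h : ℕ → ℕ)
    (hr : ∀ i < K + 1, |(h i : ℝ) - m * (snapshotLaw K ϑ).real {f | numHeads f = i}| ≤ r) :
    tran ϑ (estimate K h) ≤ ENNReal.ofReal (1384 / K) := by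
  have hm1 : 0 < m := lt_of_lt_of_le (by positivity) hm
  have hMpos := gridM_pos K
  have hM0 : (0 : ℝ) < gridM K := by exact_mod_cast hMpos
  have hNM : 2 * (K / 8) + 1 ≤ gridM K := le_trans (by omega) le_gridM
  have hMN : ((2 * (K / 8 : ℕ) + 1 : ℝ)) ^ 4 ≤ gridM K := by
    have : (2 * (K / 8) + 1) ^ 4 ≤ gridM K := Nat.pow_le_pow_left (by omega) 4
    exact_mod_cast this
  have hKN : (K : ℝ) ≤ 8 * (2 * (K / 8 : ℕ) + 1 : ℝ) := by
    have : K ≤ 8 * (2 * (K / 8) + 1) := by omega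
    exact_mod_cast this
  have hS0 := le_gridS_zero (K / 8) hNM
  have hdev := fun y : I => abs_le.1 (abs_gridS_sub_le (K / 8) hMpos y.2)
  have hsum := fun y : I => sum_abs_mul_gridD_le (K / 8) (gridM K) hNM y.2
  have hΔ := sum_abs_outWeight_sub_le hK hr1 hm ϑ h hr
  set n := K / 8
  set M := gridM K
  set N : ℝ := 2 * (n : ℝ) + 1 with hN
  have hN1 : 1 ≤ N := by rw [hN]; linarith [(Nat.cast_nonneg n : (0 : ℝ) ≤ n)]
  set κ : ℝ := 8 * N ^ 6 + 16 * M with hκ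
  have hκ0 : 0 ≤ κ := by positivity
  set S : ℝ := gridS n M 0 + κ with hS
  have hSM : M * N ^ 3 / 2 ≤ S := by linarith
  have hSpos : 0 < S := lt_of_lt_of_le (by positivity) hSM
  have key := tran_le_of_kernel ϑ (Finset.range (3 * M + 1)) (fun j y => gridD n M j y)
    (fun j => (continuous_gridD n M j).comp continuous_subtype_val)
    (fun j y => gridD_nonneg _ _ _ _) (outPoint M) (fun j => (outWeight K h j : ℝ))
    (fun j _ => by exact_mod_cast (outWeight_pos K h j).le) (sum_outWeight_pos K h)
    (S := S) (κ := 2 * κ) (Λ := m * ((K + 1).factorial : ℝ) * (M : ℝ) ^ (8 * n)) (Δ := 1)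
    (b := S / N + 36 * M * N ^ 2) hSpos (by positivity)
    (fun y => by have := (hdev y).2; unfold gridS at this hS; linarith)
    (fun y => by have := (hdev y).1; unfold gridS at this hS; linarith)
    hΔ ?_
  · refine key.trans (ENNReal.ofReal_le_ofReal ?_)
    have hK0 : (0 : ℝ) < K := by exact_mod_cast hK
    have h6 : N ^ 6 ≤ M * N ^ 2 := by
      calc N ^ 6 = N ^ 4 * N ^ 2 := by ring
        _ ≤ _ := by gcongr
    have hN2 : 1 ≤ N ^ 2 := one_le_pow₀ hN1
    have hM1 : (1 : ℝ) ≤ M := by exact_mod_cast hMpos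
    have hMN2 : (M : ℝ) ≤ M * N ^ 2 := le_mul_of_one_le_right hM0.le hN2
    have hSN : M * N ^ 2 / 2 ≤ S / N := by
      rw [le_div_iff₀ (by linarith)]
      linarith [show (M : ℝ) * N ^ 2 / 2 * N = M * N ^ 3 / 2 by ring]
    -- Since `κ ≤ 24 M N²`, the last three terms sum to at most `(36 + 48 + 2) M N² ≤ 172 S / N`.
    -- With `K ≤ 8 N` the final constant is `8 * 173 = 1384`.
    have h1 : S / N + 36 * M * N ^ 2 + 2 * κ + 2 * 1 ≤ 173 * (S / N) := by
      rw [hκ]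
      nlinarith
    rw [div_le_div_iff₀ hSpos hK0]
    calc _ ≤ 173 * (S / N) * (8 * N) := by gcongr
      _ = _ := by field_simp; norm_num
  · intro y
    refine le_trans (Finset.sum_le_sum fun j _ => ?_) ((hsum y).trans ?_)
    · rw [mul_comm]
      exact mul_le_mul_of_nonneg_right (dist_outPoint_le hMpos j y) (gridD_nonneg _ _ _ _)
    · have := (hdev y).2
      gcongr
      linarith

/-- From `K + 1 ≤ 2ᴷ` and `exp (1/2) ≤ 2`; the exponents balance as `1 + (c' + 21) + c' = 2 (c' +
11)`. -/
theorem failure_probability_le {c : ℝ} {c' K : ℕ} (hc : 2 * c ≤ c') :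
    (K + 1 : ℝ) * (((2 ^ ((c' + 21) * K) : ℕ) : ℝ) / ((2 ^ ((c' + 11) * K) : ℕ) : ℝ) ^ 2) ≤
      Real.exp (-(c * K)) := by
  have h1 : (K + 1 : ℝ) ≤ 2 ^ K := by exact_mod_cast succ_le_two_pow K
  have h2 : Real.exp (c * K) ≤ 2 ^ (c' * K) := by
    have he : Real.exp (1 / 2) ≤ 2 := by
      have h3 : Real.exp (1 / 2) ^ 2 = Real.exp 1 := by rw [← Real.exp_nat_mul]; norm_num
      nlinarith [Real.exp_one_lt_d9, Real.exp_pos (1 / 2)]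
    calc Real.exp (c * K) ≤ Real.exp ((c' * K : ℕ) * (1 / 2)) := by
          refine Real.exp_le_exp.2 ?_
          push_cast
          nlinarith [(Nat.cast_nonneg K : (0 : ℝ) ≤ K)]
      _ = Real.exp (1 / 2) ^ (c' * K) := Real.exp_nat_mul _ _
      _ ≤ 2 ^ (c' * K) := by gcongr
  rw [Real.exp_neg, ← one_div, ← mul_div_assoc, div_le_div_iff₀ (by positivity) (Real.exp_pos _)]
  push_cast
  calc (K + 1 : ℝ) * 2 ^ ((c' + 21) * K) * Real.exp (c * K)
      ≤ 2 ^ K * 2 ^ ((c' + 21) * K) * 2 ^ (c' * K) := by gcongr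
    _ = 1 * (2 ^ ((c' + 11) * K)) ^ 2 := by
        rw [one_mul, ← pow_add, ← pow_add, ← pow_mul]; congr 1; ring

end CoinProblem

/-! ### The main theorem -/

theorem mainTheorem5 :
    ∃ (alg : CoinProblem.Cmd) (A : ℝ), 0 < A ∧
      ∀ c : ℝ, 0 < c →
        ∃ (C : ℕ) (T : Polynomial ℕ), ∀ K : ℕ, 1 ≤ K →
          ∃ est : (Fin (2 ^ (C * K)) → Fin K → Bool) → ProbabilityMeasure unitInterval,
            (∀ ω, CoinProblem.OutputsWithin alg (CoinProblem.headsCount ω) (T.eval K) (est ω)) ∧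
            ∀ ϑ : ProbabilityMeasure unitInterval,
              1 - Real.exp (-(c * K)) ≤
                (CoinProblem.sampleLaw (2 ^ (C * K)) K (ϑ : Measure unitInterval)).real
                  {ω | CoinProblem.tran (ϑ : Measure unitInterval) (est ω : Measure unitInterval) ≤
                    ENNReal.ofReal (A / K)} := by
  refine ⟨CoinProblem.reconstruct, 1384, by norm_num, fun c _ => ?_⟩
  -- With tolerance `r = 2^((c' + 11) K)` for the counts, `21` meets both demands: `m / r = 2^(10
  -- K)` for accuracy and `(K + 1) m / r² ≤ exp (-c K)` for the failure probability.
  refine ⟨⌈2 * c⌉₊ + 21, CoinProblem.timeBound (⌈2 * c⌉₊ + 21), fun K hK => ?_⟩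
  refine ⟨fun ω => ⟨CoinProblem.estimate K (CoinProblem.extendCounts (CoinProblem.headsCount ω)),
    inferInstance⟩, fun ω => ?_, fun ϑ => ?_⟩
  · refine CoinProblem.outputsWithin_estimate _ fun i => ?_
    refine (Finset.card_filter_le _ _).trans ?_
    rw [Finset.card_univ, Fintype.card_fin]
  set c' := ⌈2 * c⌉₊
  have hr1 : 1 ≤ 2 ^ ((c' + 11) * K) := Nat.one_le_two_pow
  have h := le_sampleLaw_real_counts (2 ^ ((c' + 21) * K)) K (ϑ : Measure I)
    (r := ((2 ^ ((c' + 11) * K) : ℕ) : ℝ)) (by exact_mod_cast hr1)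
  refine le_trans (sub_le_sub_left
    (CoinProblem.failure_probability_le (Nat.le_ceil (2 * c))) 1) (h.trans ?_)
  refine measureReal_mono fun ω hω => ?_
  refine CoinProblem.tran_estimate_le (m := 2 ^ ((c' + 21) * K)) hK hr1 (le_of_eq ?_)
    (ϑ : Measure I) _ fun i hi => ?_
  · rw [← pow_add]; congr 1; ring
  · have := hω ⟨i, hi⟩
    simp only [CoinProblem.extendCounts, hi, dif_pos]
    exact this.le
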